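/- Let $\mathcal M$ be a symplectic manifold of dimension $2M$ whose second de Rham cohomology vanishes, with Poisson bracket $\{\cdot,\cdot\}$. Let $\star$ be a star product on $C^\infty(\mathcal M,\mathbb C)[[\hbar]]$: an associative product with unit $1$, $F\star G=\sum_k\hbar^kC_k(F,G)$ with bidifferential operators $C_k$ extended $\hbar$-bilinearly, such that $F\star G=FG+O(\hbar)$ and $\{F,G\}_\star:=F\star G-G\star F=i\hbar\{F,G\}+O(\hbar^2)$. For a symbol $F=f+\hbar F_1+\dots$ write $\pi F=f$, and let $J=\begin{pmatrix}0&1\\-1&0\end{pmatrix}$ (with $M\times M$ blocks). Let $H^1,\dots,H^M\in C^\infty(\mathcal M,\mathbb C)[[\hbar]]$ be a quantum integrable system, $\{H^i,H^j\}_\star=0$, whose classical limit $h^i=\pi H^i$ has global action-angle variables: there are actions $I^i:\mathcal M\to[0,\infty)$ and angles $\theta^i$ (with values in $\mathbb R/2\pi\mathbb Z$, irrelevant where $I^i=0$) such that - every joint level set of the actions is a full torus, i.e. on it all values of those angles $\theta^i$ with $I^i>0$ occur; - the functions $z^i=\sqrt{2I^i}\cos\theta^i$, $z^{i+M}=-\sqrt{2I^i}\sin\theta^i$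 ($1\le i\le M$) are smooth, separate the points of $\mathcal M$, and are Darboux coordinates, $\{z^a,z^b\}=J^{ab}$; - $h^i=f^i\circ I$ for real-valued functions $f^i$ that are smooth near each value of $I$ and functionally independent in the sense that the frequency matrix $\partial f^i/\partial I^j$ is invertible at every value of $I$ (including those on the boundary, where some $I^i=0$). Then there exist s'Darboux symbols $Z^1,\dots,Z^{2M}\in C^\infty(\mathcal M,\mathbb C)[[\hbar]]$, i.e. $\{Z^a,Z^b\}_\star=i\hbar J^{ab}$, with $\pi Z^a=z^a$, that are compatible with the system: with $A^i=\frac1{\sqrt2}(Z^i-iZ^{i+M})$ and $\bar A^i=\frac1{\sqrt2}(Z^i+iZ^{i+M})$, the number symbols $N^i=\bar A^i\star A^i$ satisfy $\{H^i,N^j\}_\star=0$ for all $i,j$. If moreover $\star$ is Hermitian ($\overline{F\star G}=\bar G\star\bar F$, with $\hbar$ real) and the $H^i$ are real, then the $Z^a$ can be chosen real, so that $\bar A^i$ is the complex conjugate of $A^i$. -/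

import Mathlib

open scoped Manifold ContDiff PowerSeries

noncomputable section

namespace DefQuant

/-- The algebra `C^∞(𝓜)` of smooth complex-valued functions on a manifold `𝓜` of
(real) dimension `2m`. -/
def smoothAlg (m : ℕ) (𝓜 : Type*) [TopologicalSpace 𝓜]
    [ChartedSpace (EuclideanSpace ℝ (Fin (2 * m))) 𝓜] : Subalgebra ℂ (𝓜 → ℂ) where
  carrier := {f | ContMDiff (𝓡 (2 * m)) 𝓘(ℝ, ℂ) ∞ f}
  mul_mem' := fun hf hg =>
    (contDiff_mul (𝕜 := ℝ) (𝔸 := ℂ) (n := ∞)).contMDiff.comp (ContMDiff.prodMk_space hf hg)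
  add_mem' := fun hf hg =>
    (contDiff_add (𝕜 := ℝ) (F := ℂ) (n := ∞)).contMDiff.comp (ContMDiff.prodMk_space hf hg)
  algebraMap_mem' := fun _ => contMDiff_const

/-- Smooth complex-valued functions, as a type. -/
abbrev Smooth (m : ℕ) (𝓜 : Type*) [TopologicalSpace 𝓜]
    [ChartedSpace (EuclideanSpace ℝ (Fin (2 * m))) 𝓜] : Type _ :=
  ↥(smoothAlg m 𝓜)

/-- Symbols: formal power series in `ħ` (the variable `X`) with coefficients in `C^∞(𝓜)`. -/
abbrev Symbol (m : ℕ) (𝓜 : Type*) [TopologicalSpace 𝓜]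
    [ChartedSpace (EuclideanSpace ℝ (Fin (2 * m))) 𝓜] : Type _ :=
  PowerSeries (Smooth m 𝓜)

section

variable {m : ℕ} {𝓜 : Type*} [TopologicalSpace 𝓜]
  [ChartedSpace (EuclideanSpace ℝ (Fin (2 * m))) 𝓜]

/-- Pointwise complex conjugation of smooth functions. -/
def conjFun (f : Smooth m 𝓜) : Smooth m 𝓜 :=
  ⟨fun p => (starRingEnd ℂ) (f.1 p),
    (Complex.conjCLE.contDiff (n := ∞)).contMDiff.comp (show ContMDiff _ _ _ f.1 from f.2)⟩

/-- Complex conjugation of symbols, coefficient by coefficient (`ħ` is real). -/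
def conjSymbol (F : Symbol m 𝓜) : Symbol m 𝓜 :=
  PowerSeries.mk fun n => conjFun (PowerSeries.coeff n F)

/-- The symbol `F` is real. -/
def IsRealSymbol (F : Symbol m 𝓜) : Prop := conjSymbol F = F

/-- The principal symbol `π F`: the coefficient of `ħ^0`. -/
def principal (F : Symbol m 𝓜) : Smooth m 𝓜 := PowerSeries.coeff 0 F

/-- Evaluation of smooth functions at a point. -/
def evalAt (p : 𝓜) : Smooth m 𝓜 →+* ℂ :=
  (Pi.evalRingHom (fun _ : 𝓜 => ℂ) p).comp (smoothAlg m 𝓜).subtype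

variable (m) in
/-- The ideal of smooth functions vanishing at `p`. -/
def vanishAt (p : 𝓜) : Ideal (Smooth m 𝓜) := RingHom.ker (evalAt p)

/-- `D` is a bidifferential operator: for some `N`, the value of `D f g` at a point `p` depends
only on the `N`-jets of `f` and `g` at `p`, i.e. it vanishes as soon as one of `f`, `g` lies
in the `(N+1)`-st power of the ideal of functions vanishing at `p`. -/
def IsBidifferential (D : Smooth m 𝓜 →ₗ[ℂ] Smooth m 𝓜 →ₗ[ℂ] Smooth m 𝓜) : Prop :=
  ∃ N : ℕ, ∀ (p : 𝓜) (f g : Smooth m 𝓜),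
    (f ∈ vanishAt m p ^ (N + 1) ∨ g ∈ vanishAt m p ^ (N + 1)) → (D f g).1 p = 0

variable (m 𝓜) in
/-- A symplectic structure on `𝓜`, given by its Poisson bracket (extended complex-bilinearly to
complex-valued functions): a real Poisson bracket that is nondegenerate at every point. -/
structure SymplecticBracket where
  /-- the Poisson bracket -/
  bracket : Smooth m 𝓜 →ₗ[ℂ] Smooth m 𝓜 →ₗ[ℂ] Smooth m 𝓜
  real : ∀ f g, bracket (conjFun f) (conjFun g) = conjFun (bracket f g)
  skew : ∀ f g, bracket f g = -bracket g f
  leibniz : ∀ f g k, bracket f (g * k) = bracket f g * k + g * bracket f k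
  jacobi : ∀ f g k,
    bracket f (bracket g k) + bracket g (bracket k f) + bracket k (bracket f g) = 0
  nondegenerate : ∀ (p : 𝓜) (f : Smooth m 𝓜), (∀ g, (bracket f g).1 p = 0) →
    mfderiv (𝓡 (2 * m)) 𝓘(ℝ, ℂ) f.1 p = 0

/-- The product of symbols defined by a sequence of bilinear operators,
`F ⋆ G = ∑ₖ ħ^k C_k(F, G)`, extended `ħ`-bilinearly. -/
def starMul (C : ℕ → Smooth m 𝓜 →ₗ[ℂ] Smooth m 𝓜 →ₗ[ℂ] Smooth m 𝓜)
    (F G : Symbol m 𝓜) : Symbol m 𝓜 :=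
  PowerSeries.mk fun n =>
    ∑ x ∈ Finset.HasAntidiagonal.antidiagonal n, ∑ y ∈ Finset.HasAntidiagonal.antidiagonal x.2,
      C x.1 (PowerSeries.coeff y.1 F) (PowerSeries.coeff y.2 G)

/-- A star product on a symplectic manifold: an associative unital product of symbols, given by
bidifferential operators, which is the ordinary product at lowest order and whose commutator is
`iħ` times the Poisson bracket up to `O(ħ²)`. -/
structure StarProduct (P : SymplecticBracket m 𝓜) where
  /-- the coefficient of `ħ^k` in the product of two functions -/
  C : ℕ → Smooth m 𝓜 →ₗ[ℂ] Smooth m 𝓜 →ₗ[ℂ] Smooth m 𝓜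
  bidifferential : ∀ k, IsBidifferential (C k)
  assoc : ∀ F G K : Symbol m 𝓜,
    starMul C (starMul C F G) K = starMul C F (starMul C G K)
  one_star : ∀ F : Symbol m 𝓜, starMul C 1 F = F
  star_one : ∀ F : Symbol m 𝓜, starMul C F 1 = F
  lowest : ∀ f g, C 0 f g = f * g
  commutator : ∀ f g, C 1 f g - C 1 g f = Complex.I • P.bracket f g

namespace StarProduct

variable {P : SymplecticBracket m 𝓜} (S : StarProduct P)

/-- The star product of two symbols. -/
def mul (F G : Symbol m 𝓜) : Symbol m 𝓜 := starMul S.C F G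

/-- The star commutator `{F, G}_⋆ = F ⋆ G - G ⋆ F`. -/
def comm (F G : Symbol m 𝓜) : Symbol m 𝓜 := S.mul F G - S.mul G F

/-- The star product is Hermitian: conjugation reverses products, as taking adjoints does for
operators. -/
def IsHermitian : Prop :=
  ∀ F G : Symbol m 𝓜, conjSymbol (S.mul F G) = S.mul (conjSymbol G) (conjSymbol F)

end StarProduct

/-- The constant matrix `J`, with blocks `0, 1, -1, 0`; the indices `i` and `i + m` of a list of
`2m` functions are written `Sum.inl i` and `Sum.inr i`. -/
def matJ (m : ℕ) : Matrix (Fin m ⊕ Fin m) (Fin m ⊕ Fin m) ℂ := Matrix.fromBlocks 0 1 (-1) 0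

/-- `Z` is a list of s'Darboux symbols: `{Z^a, Z^b}_⋆ = iħ J^{ab}`. -/
def IsSDarboux {P : SymplecticBracket m 𝓜} (S : StarProduct P)
    (Z : Fin m ⊕ Fin m → Symbol m 𝓜) : Prop :=
  ∀ a b, S.comm (Z a) (Z b) =
    PowerSeries.monomial 1 (algebraMap ℂ (Smooth m 𝓜) (Complex.I * matJ m a b))

/-- `A^i = (Z^i - i Z^{i+m}) / √2`. -/
def annihilation (Z : Fin m ⊕ Fin m → Symbol m 𝓜) (i : Fin m) : Symbol m 𝓜 :=
  (1 / (Real.sqrt 2 : ℂ)) • (Z (Sum.inl i) - Complex.I • Z (Sum.inr i))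

/-- `(Z^i + i Z^{i+m}) / √2`; for real `Z` this is the complex conjugate of `A^i`. -/
def creation (Z : Fin m ⊕ Fin m → Symbol m 𝓜) (i : Fin m) : Symbol m 𝓜 :=
  (1 / (Real.sqrt 2 : ℂ)) • (Z (Sum.inl i) + Complex.I • Z (Sum.inr i))

/-- The number symbols `N^i`. -/
def numberSymbol {P : SymplecticBracket m 𝓜} (S : StarProduct P)
    (Z : Fin m ⊕ Fin m → Symbol m 𝓜) (i : Fin m) : Symbol m 𝓜 :=
  S.mul (creation Z i) (annihilation Z i)

/-- `Z` is compatible with `H`: the number symbols of `Z` star-commute with all `H^j`. -/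
def IsCompatible {P : SymplecticBracket m 𝓜} (S : StarProduct P)
    (H : Fin m → Symbol m 𝓜) (Z : Fin m ⊕ Fin m → Symbol m 𝓜) : Prop :=
  ∀ i j, S.comm (H i) (numberSymbol S Z j) = 0

variable (m 𝓜) in
/-- The second de Rham cohomology of `𝓜` vanishes. Vector fields are the derivations of
`C^∞(𝓜)`, forms are alternating and `C^∞(𝓜)`-multilinear in vector fields, and the exterior
derivative is given by the invariant formula: every closed 2-form is exact. -/
def SecondCohomologyTrivial : Prop :=
  ∀ η : Derivation ℂ (Smooth m 𝓜) (Smooth m 𝓜) →ₗ[Smooth m 𝓜]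
      Derivation ℂ (Smooth m 𝓜) (Smooth m 𝓜) →ₗ[Smooth m 𝓜] Smooth m 𝓜,
    (∀ X, η X X = 0) →
    (∀ X Y W, X (η Y W) - Y (η X W) + W (η X Y)
      - η ⁅X, Y⁆ W + η ⁅X, W⁆ Y - η ⁅Y, W⁆ X = 0) →
    ∃ τ : Derivation ℂ (Smooth m 𝓜) (Smooth m 𝓜) →ₗ[Smooth m 𝓜] Smooth m 𝓜,
      ∀ X Y, η X Y = X (τ Y) - Y (τ X) - τ ⁅X, Y⁆

/-- Global action-angle variables for the functions `h^i`, together with the smooth Darboux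
coordinates `z` built from them. -/
structure GlobalActionAngle (P : SymplecticBracket m 𝓜) (h : Fin m → Smooth m 𝓜) where
  /-- the actions `I^i` -/
  act : Fin m → 𝓜 → ℝ
  /-- the angles `θ^i`, defined modulo `2π`; the value at a point where `I^i = 0` is irrelevant -/
  ang : Fin m → 𝓜 → Real.Angle
  act_nonneg : ∀ i p, 0 ≤ act i p
  /-- the level sets of the actions are full tori: all values of the angles occur -/
  full_torus : ∀ (p : 𝓜) (φ : Fin m → Real.Angle),
    ∃ q, ∀ i, act i q = act i p ∧ (0 < act i p → ang i q = φ i)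
  /-- the Darboux coordinates -/
  z : Fin m ⊕ Fin m → Smooth m 𝓜
  z_left : ∀ i p, (z (Sum.inl i)).1 p = ((Real.sqrt (2 * act i p) * (ang i p).cos : ℝ) : ℂ)
  z_right : ∀ i p, (z (Sum.inr i)).1 p = ((-(Real.sqrt (2 * act i p) * (ang i p).sin) : ℝ) : ℂ)
  darboux : ∀ a b, P.bracket (z a) (z b) = algebraMap ℂ (Smooth m 𝓜) (matJ m a b)
  /-- `z` is a global coordinate system: it separates points -/
  z_injective : Function.Injective fun (p : 𝓜) (a : Fin m ⊕ Fin m) => (z a).1 p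
  /-- the functions `f^i` expressing the `h^i` through the actions -/
  f : (Fin m → ℝ) → (Fin m → ℝ)
  f_smooth : ∀ p, ContDiffAt ℝ ∞ f (fun k => act k p)
  h_eq : ∀ i p, (h i).1 p = ((f (fun k => act k p) i : ℝ) : ℂ)
  /-- functional independence: the frequency matrix `∂f/∂I` is invertible at all occurring values
  of the actions -/
  independent : ∀ p, (fderiv ℝ f (fun k => act k p)).det ≠ 0

end

end DefQuant

end

/-!
The symbols are constructed order by order in `ħ`; at each order two linear equations for classical
functions have to be solved.

*Canonical commutation relations* (`exists_darboux`). If the relations hold up to some order, then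
by the Jacobi identity the first coefficient at which they fail is a closed two-form, in the frame
of the commuting Hamiltonian vector fields `{z a, ·}`. As the second cohomology vanishes it has a
primitive (`closedIsExact`), which gives the next correction of the `Z a`.

*Compatibility* (`exists_compatible_step`). Let the commutators of the `H i` with the number symbols
`N j` vanish up to some order. Their next coefficients are brackets `i {g i, I j}` with one function
`g i` for all `j` (`exists_coeff_comm_eq_bracket`): the coefficients of `H i` of lower order are,
successively, invariant under the torus, so they can be subtracted after extending them to symbols
that commute with all `N j` exactly. Such extensions come from normal ordering (`exists_lift`): put
the creation symbols to the left and the annihilation symbols to the right. For polynomials this is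
algebra, since commutation with a number symbol multiplies each of them by a scalar. It extends to
smooth functions because its coefficients turn out to be differential operators, which are
determined by their values on polynomials.

Transforming the `Z a` with the flow of a Hamiltonian `w` of the right order in `ħ` changes the
obstruction by `{h i, {w, I j}}`, so the homological equation `{h i, {w, I j}} = -{g i, I j}` is to
be solved (`exists_generator`). Because the frequency matrix is invertible and torus-invariant, this
becomes a system of equations along the individual angles. Its integrability condition holds,
because `{H i, H j}_⋆ = 0` makes its failure torus-invariant while that failure has zero mean along
the angles (`curl_eq_zero`). Solutions are found by integrating along one angle after another
(`exists_primitive`); this uses that all tori are full and gives smooth functions even where some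
actions vanish, as the rotations act smoothly in the coordinates `z`. Transforming with `w` spoils
the commutation relations only at higher order, where they are restored.

In the Hermitian case the equations are real, and real parts of solutions are solutions.

The manifold enters only through the Darboux coordinates: they embed it as an open subset of
Euclidean space (`isOpen_range_coord`), since their brackets make their differentials independent.
Hadamard's lemma then shows that derivations act through partial derivatives (`derivation_apply`).
-/

noncomputable section

namespace DefQuant

/-! ### Order-by-order constructions of power series -/

section

open Finset

theorem exists_X_pow_mul {A : Type*} [CommRing A] {n : ℕ} {F : A⟦X⟧}
    (hF : ∀ k < n, PowerSeries.coeff k F = 0) : ∃ F', F = PowerSeries.X ^ n * F' :=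
  PowerSeries.X_pow_dvd_iff.2 hF

/-- An order-by-order construction that changes at the `n`-th step only the coefficients
of order above `n` converges to families of power series. -/
theorem exists_limit {A ι : Type*} [CommRing A] (Φ : ℕ → (ι → A⟦X⟧) → Prop)
    {Y₀ : ι → A⟦X⟧} (h₀ : Φ 0 Y₀)
    (step : ∀ n Y, Φ n Y → ∃ Y', Φ (n + 1) Y' ∧
      ∀ a, ∀ k < n + 1, PowerSeries.coeff k (Y' a) = PowerSeries.coeff k (Y a)) :
    ∃ Y : ι → A⟦X⟧, ∀ n, ∃ Y', Φ n Y' ∧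
      ∀ a, ∀ k < n + 1, PowerSeries.coeff k (Y a) = PowerSeries.coeff k (Y' a) := by
  choose! next hnext hagree using step
  let W : ℕ → ι → A⟦X⟧ := fun n => Nat.rec Y₀ (fun n Y => next n Y) n
  have hW : ∀ n, Φ n (W n) := fun n => by
    induction n with
    | zero => exact h₀
    | succ n ih => exact hnext n _ ih
  have hst : ∀ a k d, PowerSeries.coeff k (W (k + d) a) = PowerSeries.coeff k (W k a) := by
    intro a k d
    induction d with
    | zero => rfl
    | succ d ih => rw [← ih]; exact hagree (k + d) _ (hW _) a k (by omega)
  refine ⟨fun a => PowerSeries.mk fun k => PowerSeries.coeff k (W k a), fun n =>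
    ⟨W n, hW n, fun a k hk => ?_⟩⟩
  obtain ⟨d, rfl⟩ := Nat.exists_eq_add_of_le (Nat.lt_succ_iff.1 hk)
  rw [PowerSeries.coeff_mk, hst]

/-! ### Formal star products on a commutative algebra -/

section FormalStar

variable {A : Type*} [CommRing A] [Algebra ℂ A]

theorem coeff_csmul (n : ℕ) (c : ℂ) (F : A⟦X⟧) :
    PowerSeries.coeff n (c • F) = c • PowerSeries.coeff n F := rfl

/-- The `ħ`-bilinear extension to power series of a sequence of bilinear maps on `A`. -/
def starProd (C : ℕ → A →ₗ[ℂ] A →ₗ[ℂ] A) : A⟦X⟧ →ₗ[ℂ] A⟦X⟧ →ₗ[ℂ] A⟦X⟧ :=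
  LinearMap.mk₂ ℂ
    (fun F G => PowerSeries.mk fun n =>
      ∑ x ∈ antidiagonal n, ∑ y ∈ antidiagonal x.2,
        C x.1 (PowerSeries.coeff y.1 F) (PowerSeries.coeff y.2 G))
    (fun F F' G => by ext n; simp [sum_add_distrib])
    (fun c F G => by ext n; simp [smul_sum])
    (fun F G G' => by ext n; simp [sum_add_distrib])
    (fun c F G => by ext n; simp [smul_sum])

/-- The data of a star product on a commutative algebra `A` quantizing a Poisson bracket. -/
structure FormalStar (A : Type*) [CommRing A] [Algebra ℂ A] where
  /-- the coefficients of the star product -/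
  C : ℕ → A →ₗ[ℂ] A →ₗ[ℂ] A
  /-- the Poisson bracket -/
  bracket : A →ₗ[ℂ] A →ₗ[ℂ] A
  skew : ∀ f g, bracket f g = -bracket g f
  leibniz : ∀ f g k, bracket f (g * k) = bracket f g * k + g * bracket f k
  jacobi : ∀ f g k,
    bracket f (bracket g k) + bracket g (bracket k f) + bracket k (bracket f g) = 0
  assoc : ∀ F G K : A⟦X⟧,
    starProd C (starProd C F G) K = starProd C F (starProd C G K)
  one_star : ∀ F : A⟦X⟧, starProd C 1 F = F
  star_one : ∀ F : A⟦X⟧, starProd C F 1 = F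
  lowest : ∀ f g, C 0 f g = f * g
  commutator : ∀ f g, C 1 f g - C 1 g f = Complex.I • bracket f g

namespace FormalStar

variable (S : FormalStar A)

/-- The star product. -/
def mul : A⟦X⟧ →ₗ[ℂ] A⟦X⟧ →ₗ[ℂ] A⟦X⟧ := starProd S.C

/-- The star commutator. -/
def comm : A⟦X⟧ →ₗ[ℂ] A⟦X⟧ →ₗ[ℂ] A⟦X⟧ := S.mul - S.mul.flip

theorem comm_apply (F G : A⟦X⟧) : S.comm F G = S.mul F G - S.mul G F := rfl

theorem coeff_mul (n : ℕ) (F G : A⟦X⟧) :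
    PowerSeries.coeff n (S.mul F G) =
      ∑ x ∈ antidiagonal n, ∑ y ∈ antidiagonal x.2,
        S.C x.1 (PowerSeries.coeff y.1 F) (PowerSeries.coeff y.2 G) := by
  simp [mul, starProd]

/-- The coefficients of a product up to order `n` only depend on those of the factors. -/
theorem coeff_mul_congr {n : ℕ} {F F' G G' : A⟦X⟧}
    (hF : ∀ k < n + 1, PowerSeries.coeff k F = PowerSeries.coeff k F')
    (hG : ∀ k < n + 1, PowerSeries.coeff k G = PowerSeries.coeff k G') :
    PowerSeries.coeff n (S.mul F G) = PowerSeries.coeff n (S.mul F' G') := by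
  rw [coeff_mul, coeff_mul]
  refine sum_congr rfl fun x hx => sum_congr rfl fun y hy => ?_
  rw [HasAntidiagonal.mem_antidiagonal] at hx hy
  rw [hF _ (by omega), hG _ (by omega)]

theorem coeff_comm_congr {n : ℕ} {F F' G G' : A⟦X⟧}
    (hF : ∀ k < n + 1, PowerSeries.coeff k F = PowerSeries.coeff k F')
    (hG : ∀ k < n + 1, PowerSeries.coeff k G = PowerSeries.coeff k G') :
    PowerSeries.coeff n (S.comm F G) = PowerSeries.coeff n (S.comm F' G') := by
  rw [comm_apply, comm_apply, map_sub, map_sub, coeff_mul_congr S hF hG, coeff_mul_congr S hG hF]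

theorem mul_assoc (F G K : A⟦X⟧) : S.mul (S.mul F G) K = S.mul F (S.mul G K) := S.assoc F G K

theorem one_mul (F : A⟦X⟧) : S.mul 1 F = F := S.one_star F

theorem mul_one (F : A⟦X⟧) : S.mul F 1 = F := S.star_one F

theorem comm_self (F : A⟦X⟧) : S.comm F F = 0 := by simp [comm_apply]

theorem comm_skew (F G : A⟦X⟧) : S.comm F G = -S.comm G F := by simp [comm_apply]

theorem comm_jacobi (F G K : A⟦X⟧) :
    S.comm F (S.comm G K) = S.comm (S.comm F G) K + S.comm G (S.comm F K) := by
  simp only [comm_apply, map_sub, LinearMap.sub_apply, mul_assoc]; abel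

theorem comm_mul (F G K : A⟦X⟧) :
    S.comm F (S.mul G K) = S.mul (S.comm F G) K + S.mul G (S.comm F K) := by
  simp only [comm_apply, map_sub, LinearMap.sub_apply, mul_assoc]; abel

theorem mul_comm' (F G K : A⟦X⟧) :
    S.comm (S.mul G K) F = S.mul (S.comm G F) K + S.mul G (S.comm K F) := by
  simp only [comm_apply, map_sub, LinearMap.sub_apply, mul_assoc]; abel

theorem mul_X_mul (F G : A⟦X⟧) : S.mul F (PowerSeries.X * G) = PowerSeries.X * S.mul F G := by
  ext n
  cases n with
  | zero => simp [coeff_mul]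
  | succ n =>
    rw [PowerSeries.coeff_succ_X_mul, coeff_mul, coeff_mul, Nat.antidiagonal_succ']
    rw [sum_cons]
    simp only [Finset.Nat.antidiagonal_zero, sum_singleton, PowerSeries.coeff_zero_X_mul,
      map_zero, zero_add, sum_map]
    refine sum_congr rfl fun x _ => ?_
    simp [Nat.antidiagonal_succ']

theorem X_mul_mul (F G : A⟦X⟧) : S.mul (PowerSeries.X * F) G = PowerSeries.X * S.mul F G := by
  ext n
  cases n with
  | zero => simp [coeff_mul]
  | succ n =>
    rw [PowerSeries.coeff_succ_X_mul, coeff_mul, coeff_mul, Nat.antidiagonal_succ']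
    rw [sum_cons]
    simp only [Finset.Nat.antidiagonal_zero, sum_singleton, PowerSeries.coeff_zero_X_mul,
      map_zero, zero_add, sum_map, LinearMap.zero_apply]
    refine sum_congr rfl fun x _ => ?_
    simp [Nat.antidiagonal_succ]

theorem X_pow_mul_mul (n : ℕ) (F G : A⟦X⟧) :
    S.mul (PowerSeries.X ^ n * F) G = PowerSeries.X ^ n * S.mul F G := by
  induction n with
  | zero => simp
  | succ n ih => rw [pow_succ', _root_.mul_assoc, X_mul_mul, ih, _root_.mul_assoc]

theorem mul_X_pow_mul (n : ℕ) (F G : A⟦X⟧) :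
    S.mul F (PowerSeries.X ^ n * G) = PowerSeries.X ^ n * S.mul F G := by
  induction n with
  | zero => simp
  | succ n ih => rw [pow_succ', _root_.mul_assoc, mul_X_mul, ih, _root_.mul_assoc]

theorem X_mul_comm (F G : A⟦X⟧) : S.comm (PowerSeries.X * F) G = PowerSeries.X * S.comm F G := by
  simp only [comm_apply, X_mul_mul, mul_X_mul, mul_sub]

theorem comm_X_mul (F G : A⟦X⟧) : S.comm F (PowerSeries.X * G) = PowerSeries.X * S.comm F G := by
  simp only [comm_apply, X_mul_mul, mul_X_mul, mul_sub]

theorem X_pow_mul_comm (n : ℕ) (F G : A⟦X⟧) :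
    S.comm (PowerSeries.X ^ n * F) G = PowerSeries.X ^ n * S.comm F G := by
  simp only [comm_apply, X_pow_mul_mul, mul_X_pow_mul, mul_sub]

theorem comm_X_pow_mul (n : ℕ) (F G : A⟦X⟧) :
    S.comm F (PowerSeries.X ^ n * G) = PowerSeries.X ^ n * S.comm F G := by
  simp only [comm_apply, X_pow_mul_mul, mul_X_pow_mul, mul_sub]

theorem coeff_zero_mul (F G : A⟦X⟧) :
    PowerSeries.coeff 0 (S.mul F G) = PowerSeries.coeff 0 F * PowerSeries.coeff 0 G := by
  simp [coeff_mul, S.lowest]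

theorem coeff_zero_comm (F G : A⟦X⟧) : PowerSeries.coeff 0 (S.comm F G) = 0 := by
  rw [comm_apply, map_sub, coeff_zero_mul, coeff_zero_mul, _root_.mul_comm, sub_self]

theorem coeff_one_comm (F G : A⟦X⟧) :
    PowerSeries.coeff 1 (S.comm F G) =
      Complex.I • S.bracket (PowerSeries.coeff 0 F) (PowerSeries.coeff 0 G) := by
  rw [← S.commutator, comm_apply, map_sub, coeff_mul, coeff_mul]
  simp [Nat.antidiagonal_succ, S.lowest]
  ring

theorem coeff_mul_lead {n l : ℕ} {F G : A⟦X⟧} (hF : ∀ k < n, PowerSeries.coeff k F = 0)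
    (hG : ∀ k < l, PowerSeries.coeff k G = 0) :
    (∀ k < n + l, PowerSeries.coeff k (S.mul F G) = 0) ∧
    PowerSeries.coeff (n + l) (S.mul F G) = PowerSeries.coeff n F * PowerSeries.coeff l G := by
  obtain ⟨F, rfl⟩ := exists_X_pow_mul hF
  obtain ⟨G, rfl⟩ := exists_X_pow_mul hG
  rw [X_pow_mul_mul, mul_X_pow_mul, ← _root_.mul_assoc, ← pow_add]
  refine ⟨fun k hk => ?_, ?_⟩
  · rw [PowerSeries.coeff_X_pow_mul', if_neg (by omega)]
  · simp only [PowerSeries.coeff_X_pow_mul', le_refl, if_true, Nat.sub_self, coeff_zero_mul]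

/-- The leading coefficient of a star commutator is `i` times the Poisson bracket of the
leading coefficients. -/
theorem coeff_comm_lead {n l : ℕ} {F G : A⟦X⟧} (hF : ∀ k < n, PowerSeries.coeff k F = 0)
    (hG : ∀ k < l, PowerSeries.coeff k G = 0) :
    (∀ k < n + l + 1, PowerSeries.coeff k (S.comm F G) = 0) ∧
    PowerSeries.coeff (n + l + 1) (S.comm F G) =
      Complex.I • S.bracket (PowerSeries.coeff n F) (PowerSeries.coeff l G) := by
  obtain ⟨F, rfl⟩ := exists_X_pow_mul hF
  obtain ⟨G, rfl⟩ := exists_X_pow_mul hG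
  rw [X_pow_mul_comm, comm_X_pow_mul, ← _root_.mul_assoc, ← pow_add]
  refine ⟨fun k hk => ?_, ?_⟩
  · rw [PowerSeries.coeff_X_pow_mul']
    split_ifs with h
    · rw [show k - (n + l) = 0 by omega, coeff_zero_comm]
    · rfl
  · simp only [PowerSeries.coeff_X_pow_mul', le_refl, if_true, Nat.sub_self, Nat.le_add_right,
      Nat.add_sub_cancel_left, coeff_one_comm]

theorem comm_csmul_one (F : A⟦X⟧) (c : ℂ) : S.comm F (c • 1) = 0 := by
  rw [map_smul, comm_apply, mul_one, one_mul, sub_self, smul_zero]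

theorem bracket_jacobi (f g k : A) :
    S.bracket f (S.bracket g k) = S.bracket (S.bracket f g) k + S.bracket g (S.bracket f k) := by
  have h := S.jacobi f g k
  rw [S.skew k f, S.skew k (S.bracket f g), map_neg] at h
  linear_combination h

theorem mul_bracket (f g k : A) :
    S.bracket (f * g) k = f * S.bracket g k + S.bracket f k * g := by
  rw [S.skew, S.leibniz, S.skew k f, S.skew k g]; ring

/-- The Hamiltonian derivation `{f, ·}`. -/
def ham (f : A) : Derivation ℂ A A :=
  Derivation.mk' (S.bracket f) fun g k => by
    rw [S.leibniz, smul_eq_mul, smul_eq_mul]; ring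

@[simp]
theorem ham_apply (f g : A) : S.ham f g = S.bracket f g := rfl

end FormalStar

end FormalStar

end

/-! ### Complex conjugation of power series -/

section

open Finset

section Conj

variable {A : Type*} [CommRing A] [StarRing A]

/-- Coefficientwise conjugation of power series. -/
def conjSeries (F : A⟦X⟧) : A⟦X⟧ := PowerSeries.mk fun n => star (PowerSeries.coeff n F)

@[simp]
theorem coeff_conjSeries (n : ℕ) (F : A⟦X⟧) :
    PowerSeries.coeff n (conjSeries F) = star (PowerSeries.coeff n F) := by simp [conjSeries]

/-- A power series is real if conjugation fixes it. -/
def IsRealSeries (F : A⟦X⟧) : Prop := conjSeries F = F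

theorem IsRealSeries.coeff {F : A⟦X⟧} (hF : IsRealSeries F) (n : ℕ) :
    star (PowerSeries.coeff n F) = PowerSeries.coeff n F := by
  rw [← coeff_conjSeries, hF]

theorem conjSeries_add (F G : A⟦X⟧) : conjSeries (F + G) = conjSeries F + conjSeries G := by
  ext n; simp

theorem conjSeries_sub (F G : A⟦X⟧) : conjSeries (F - G) = conjSeries F - conjSeries G := by
  ext n; simp

theorem isRealSeries_add_monomial {n : ℕ} {F : A⟦X⟧} (hF : IsRealSeries F) {f : A}
    (hf : star f = f) : IsRealSeries (F + PowerSeries.monomial n f) := by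
  rw [IsRealSeries, conjSeries_add, hF]
  congr 1
  ext k
  rw [coeff_conjSeries, PowerSeries.coeff_monomial]
  split_ifs <;> simp [hf]

theorem conjSeries_smul [Algebra ℂ A] [StarModule ℂ A] (c : ℂ) (F : A⟦X⟧) :
    conjSeries (c • F) = (starRingEnd ℂ c) • conjSeries F := by
  ext n
  rw [coeff_conjSeries, coeff_csmul, coeff_csmul, star_smul, coeff_conjSeries]
  rfl

/-- A complex linear equation with real coefficients and real right-hand side that has a solution
has a real one: the real part. -/
theorem exists_selfAdjoint_solution {A B : Type*} [AddCommGroup A] [StarAddMonoid A] [Module ℂ A]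
    [StarModule ℂ A] [AddCommGroup B] [StarAddMonoid B] [Module ℂ B] [StarModule ℂ B]
    {ι : Type*} (L : ι → (A →ₗ[ℂ] B)) (e : ι → B) {Q : Prop}
    (hL : Q → ∀ i f, star (L i f) = L i (star f)) (he : Q → ∀ i, star (e i) = e i)
    (h : ∃ w, ∀ i, L i w = e i) : ∃ w, (∀ i, L i w = e i) ∧ (Q → star w = w) := by
  obtain ⟨w, hw⟩ := h
  by_cases hQ : Q
  · refine ⟨(2⁻¹ : ℂ) • (w + star w), fun i => ?_, fun _ => ?_⟩
    · rw [map_smul, map_add, ← hL hQ, hw, he hQ, ← two_smul ℂ, smul_smul]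
      norm_num
    · rw [star_smul, star_add, star_star, add_comm]
      norm_num
  · exact ⟨w, hw, fun h => absurd h hQ⟩

end Conj

/-! ### Quantization of Darboux coordinates -/

namespace FormalStar

variable {A : Type*} [CommRing A] [Algebra ℂ A] (S : FormalStar A)

/-- The symbols `Z` satisfy the canonical commutation relations `[Zᵃ, Zᵇ] = iħ Jᵃᵇ` for the
coefficients of order up to `n`. -/
def DarbouxUpTo {σ : Type*} (J : σ → σ → ℂ) (n : ℕ) (Z : σ → A⟦X⟧) : Prop :=
  ∀ a b, ∀ k ≤ n, PowerSeries.coeff k (S.comm (Z a) (Z b)) =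
    PowerSeries.coeff k (PowerSeries.monomial 1 (algebraMap ℂ A (Complex.I * J a b)))

/-- The canonical commutation relations `[Zᵃ, Zᵇ] = iħ Jᵃᵇ`. -/
def Darboux {σ : Type*} (J : σ → σ → ℂ) (Z : σ → A⟦X⟧) : Prop :=
  ∀ a b, S.comm (Z a) (Z b) = PowerSeries.monomial 1 (algebraMap ℂ A (Complex.I * J a b))

theorem monomial_one_algebraMap (c : ℂ) :
    PowerSeries.monomial 1 (algebraMap ℂ A c) = PowerSeries.X * (c • (1 : A⟦X⟧)) := by
  ext k
  rcases k with _ | k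
  · simp [PowerSeries.coeff_monomial]
  · rw [PowerSeries.coeff_succ_X_mul, coeff_csmul, PowerSeries.coeff_monomial,
      PowerSeries.coeff_one, Algebra.algebraMap_eq_smul_one]
    rcases k with _ | k <;> simp

/-- The lowest-order effect on commutators of a perturbation of order `n + 1`. -/
theorem coeff_comm_perturb {n : ℕ} (F G : A⟦X⟧) (f g : A) :
    (∀ k < n + 2, PowerSeries.coeff k
      (S.comm (F + PowerSeries.monomial (n + 1) f) (G + PowerSeries.monomial (n + 1) g)) =
        PowerSeries.coeff k (S.comm F G)) ∧
    PowerSeries.coeff (n + 2)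
      (S.comm (F + PowerSeries.monomial (n + 1) f) (G + PowerSeries.monomial (n + 1) g)) =
        PowerSeries.coeff (n + 2) (S.comm F G) +
          Complex.I •
            (S.bracket (PowerSeries.coeff 0 F) g + S.bracket f (PowerSeries.coeff 0 G)) := by
  have hm : ∀ f : A, ∀ k < n + 1, PowerSeries.coeff k (PowerSeries.monomial (n + 1) f) = 0 :=
    fun f k hk => by rw [PowerSeries.coeff_monomial, if_neg (by omega)]
  have h0 : ∀ F : A⟦X⟧, ∀ k < 0, PowerSeries.coeff k F = 0 := fun F k hk => absurd hk (by omega)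
  obtain ⟨h1, h1'⟩ := S.coeff_comm_lead (h0 F) (hm g)
  obtain ⟨h2, h2'⟩ := S.coeff_comm_lead (hm f) (h0 G)
  obtain ⟨h3, -⟩ := S.coeff_comm_lead (hm f) (hm g)
  rw [PowerSeries.coeff_monomial_same] at h1' h2'
  have e : 0 + (n + 1) + 1 = n + 2 := by omega
  have e' : n + 1 + 0 + 1 = n + 2 := by omega
  rw [e] at h1 h1'
  rw [e'] at h2 h2'
  constructor
  · intro k hk
    simp only [map_add, LinearMap.add_apply, h1 k hk, h2 k hk, h3 k (by omega), add_zero]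
  · simp only [map_add, LinearMap.add_apply, h1', h2', h3 (n + 2) (by omega), add_zero, smul_add]
    abel

variable [StarRing A]

/-- The star product is compatible with conjugation in the way operator products are
compatible with adjoints, and the bracket is real. -/
structure IsHermitian : Prop where
  conj_mul : ∀ F G, conjSeries (S.mul F G) = S.mul (conjSeries G) (conjSeries F)
  star_bracket : ∀ f g, star (S.bracket f g) = S.bracket (star f) (star g)

variable {S} in
/-- Star commutators of real symbols are imaginary. -/
theorem IsHermitian.star_coeff_comm (hS : S.IsHermitian) {F G : A⟦X⟧} (hF : IsRealSeries F)
    (hG : IsRealSeries G) (n : ℕ) :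
    star (PowerSeries.coeff n (S.comm F G)) = -PowerSeries.coeff n (S.comm F G) := by
  rw [← coeff_conjSeries, ← map_neg, comm_apply, conjSeries_sub, hS.conj_mul, hS.conj_mul, hF, hG,
    neg_sub]

/-- Poincaré lemma for two-forms, in the frame of the Hamiltonian vector fields of functions `z`
with constant brackets: closed antisymmetric matrices of functions are curls. -/
def ClosedIsExact {σ : Type*} (z : σ → A) : Prop :=
  ∀ e : σ → σ → A, (∀ a, e a a = 0) → (∀ a b, e a b = -e b a) →
    (∀ a b c, S.bracket (z a) (e b c) + S.bracket (z b) (e c a) + S.bracket (z c) (e a b) = 0) →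
    ∃ w : σ → A, ∀ a b, S.bracket (z a) (w b) - S.bracket (z b) (w a) = e a b

variable [StarModule ℂ A]

variable {S} {σ : Type*} {J : σ → σ → ℂ} {z : σ → A}

/-- The failure of the canonical commutation relations at order `n + 2` is a closed two-form, by
the Jacobi identity; a primitive of it gives the correction of order `n + 1`. -/
theorem exists_darboux_step (hex : S.ClosedIsExact z) {Q : Prop}
    (hQ : Q → S.IsHermitian) {n : ℕ} {Z : σ → A⟦X⟧} (hZ0 : ∀ a, PowerSeries.coeff 0 (Z a) = z a)
    (hZ : S.DarbouxUpTo J (n + 1) Z) (hZr : Q → ∀ a, IsRealSeries (Z a)) :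
    ∃ w : σ → A, (Q → ∀ a, star (w a) = w a) ∧
      S.DarbouxUpTo J (n + 2) (fun a => Z a + PowerSeries.monomial (n + 1) (w a)) := by
  let E : σ → σ → A := fun a b => PowerSeries.coeff (n + 2) (S.comm (Z a) (Z b))
  have hEs : ∀ a b, E a b = -E b a := fun a b => by
    simp only [E]; rw [S.comm_skew, map_neg]
  have hEd : ∀ a, E a a = 0 := fun a => by simp only [E]; rw [S.comm_self, map_zero]
  -- the part of `[Zᵇ, Zᶜ]` beyond `iħ Jᵇᶜ` starts at order `n + 2`
  have hjac : ∀ a b c, PowerSeries.coeff (n + 3) (S.comm (Z a) (S.comm (Z b) (Z c))) =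
      Complex.I • S.bracket (z a) (E b c) := by
    intro a b c
    let D := S.comm (Z b) (Z c) - PowerSeries.monomial 1 (algebraMap ℂ A (Complex.I * J b c))
    have hD : ∀ k < n + 2, PowerSeries.coeff k D = 0 := fun k hk => by
      simp only [D, map_sub]; rw [hZ b c k (by omega), sub_self]
    have hD' : PowerSeries.coeff (n + 2) D = E b c := by
      simp only [D, map_sub, PowerSeries.coeff_monomial]
      rw [if_neg (by omega), sub_zero]
    have h0 : ∀ k < 0, PowerSeries.coeff k (Z a) = 0 := fun k hk => absurd hk (by omega)
    have h1 := (S.coeff_comm_lead h0 hD).2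
    have h2 : S.comm (Z a) (S.comm (Z b) (Z c)) = S.comm (Z a) D := by
      simp only [D, map_sub]
      rw [monomial_one_algebraMap, comm_X_mul, comm_csmul_one, mul_zero, sub_zero]
    rw [h2, ← hD', ← hZ0 a, ← h1]
    congr 2; omega
  have hcl : ∀ a b c, S.bracket (z a) (E b c) + S.bracket (z b) (E c a) +
      S.bracket (z c) (E a b) = 0 := by
    intro a b c
    have h := S.comm_jacobi (Z a) (Z b) (Z c)
    rw [S.comm_skew (S.comm (Z a) (Z b)), S.comm_skew (Z a) (Z c), map_neg] at h
    have h' := congrArg (PowerSeries.coeff (n + 3)) h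
    rw [map_add, map_neg, map_neg, hjac, hjac, hjac, ← smul_neg, ← smul_neg, ← smul_add] at h'
    have h'' := smul_right_injective A Complex.I_ne_zero h'
    rw [h'']; ring
  obtain ⟨w, hw⟩ := hex (fun a b => Complex.I • E a b) (fun a => by rw [hEd, smul_zero])
    (fun a b => by rw [← smul_neg, ← hEs]) (fun a b c => by
      simp only [map_smul]; rw [← smul_add, ← smul_add, hcl, smul_zero])
  obtain ⟨w, hw, hwr⟩ := exists_selfAdjoint_solution (Q := Q)
    (fun i : σ × σ => (S.bracket (z i.1)) ∘ₗ (LinearMap.proj (φ := fun _ : σ => A) i.2) -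
      (S.bracket (z i.2)) ∘ₗ (LinearMap.proj i.1)) (fun i => Complex.I • E i.1 i.2)
    (fun q i f => by
      have hzr : ∀ a, star (z a) = z a := fun a => by
        rw [← hZ0]; exact (hZr q a).coeff 0
      simp [(hQ q).star_bracket, hzr])
    (fun q i => by
      simp only [E, star_smul, (hQ q).star_coeff_comm (hZr q i.1) (hZr q i.2)]
      simp) ⟨w, fun i => hw i.1 i.2⟩
  refine ⟨w, fun q a => congrFun (hwr q) a, fun a b k hk => ?_⟩
  obtain ⟨h1, h2⟩ := S.coeff_comm_perturb (n := n) (Z a) (Z b) (w a) (w b)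
  rcases Nat.lt_or_ge k (n + 2) with h | h
  · rw [h1 k h, hZ a b k (by omega)]
  · obtain rfl : k = n + 2 := by omega
    have hw' := hw (a, b)
    simp only [LinearMap.sub_apply, LinearMap.comp_apply, LinearMap.proj_apply] at hw'
    rw [h2, hZ0, hZ0, S.skew (w a) (z b), ← sub_eq_add_neg, hw', smul_smul, Complex.I_mul_I,
      PowerSeries.coeff_monomial, if_neg (by omega)]
    simp [E]

/-- Symbols satisfying the canonical commutation relations up to order `n + 1` can be corrected in
the orders above `n` to satisfy them exactly. -/
theorem exists_darboux (hex : S.ClosedIsExact z) {Q : Prop}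
    (hQ : Q → S.IsHermitian) {n : ℕ} {Z : σ → A⟦X⟧} (hZ0 : ∀ a, PowerSeries.coeff 0 (Z a) = z a)
    (hZ : S.DarbouxUpTo J (n + 1) Z) (hZr : Q → ∀ a, IsRealSeries (Z a)) :
    ∃ Z' : σ → A⟦X⟧, S.Darboux J Z' ∧ (Q → ∀ a, IsRealSeries (Z' a)) ∧
      ∀ a, ∀ k < n + 1, PowerSeries.coeff k (Z' a) = PowerSeries.coeff k (Z a) := by
  obtain ⟨Y, hY⟩ := exists_limit (Y₀ := Z)
    (fun l Y => S.DarbouxUpTo J (n + l + 1) Y ∧ (Q → ∀ a, IsRealSeries (Y a)) ∧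
      ∀ a, ∀ k < n + 1, PowerSeries.coeff k (Y a) = PowerSeries.coeff k (Z a))
    ⟨hZ, hZr, fun _ _ _ => rfl⟩ (fun l Y hY => by
      obtain ⟨w, hwr, hw⟩ := exists_darboux_step hex hQ
        (fun a => by rw [hY.2.2 a 0 (by omega), hZ0]) hY.1 hY.2.1
      have hc : ∀ a, ∀ k < n + l + 1, PowerSeries.coeff k
          (Y a + PowerSeries.monomial (n + l + 1) (w a)) = PowerSeries.coeff k (Y a) := by
        intro a k hk
        rw [map_add, PowerSeries.coeff_monomial, if_neg (by omega), add_zero]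
      exact ⟨_, ⟨hw, fun q a => isRealSeries_add_monomial (hY.2.1 q a) (hwr q a),
        fun a k hk => by rw [hc a k (by omega), hY.2.2 a k hk]⟩,
        fun a k hk => hc a k (by omega)⟩)
  refine ⟨Y, fun a b => ?_, fun q a => ?_, fun a k hk => ?_⟩
  · ext k
    obtain ⟨Y', hY', hag⟩ := hY k
    rw [← hY'.1 a b k (by omega)]
    exact S.coeff_comm_congr (hag a) (hag b)
  · ext k
    obtain ⟨Y', hY', hag⟩ := hY k
    rw [coeff_conjSeries, hag a k (by omega), (hY'.2.1 q a).coeff]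
  · obtain ⟨Y', hY', hag⟩ := hY k
    rw [hag a k (by omega), hY'.2.2 a k hk]

end FormalStar

end

/-! ### Algebraic differential operators -/

section

open Finset

section DiffOp

variable {A B : Type*} [CommRing A] [Algebra ℂ A] [CommRing B] [Algebra ℂ B]

/-- The commutator of a linear map `t : B → A` with multiplication by `b`, the algebra `B` acting
on `A` through `φ`. -/
def adOp (φ : B →ₐ[ℂ] A) (b : B) : (B →ₗ[ℂ] A) →ₗ[ℂ] (B →ₗ[ℂ] A) where
  toFun t := t ∘ₗ LinearMap.mulLeft ℂ b - (LinearMap.mulLeft ℂ (φ b)) ∘ₗ t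
  map_add' s t := by ext; simp [mul_add]; ring
  map_smul' c t := by ext; simp [smul_sub]

theorem adOp_apply (φ : B →ₐ[ℂ] A) (b : B) (t : B →ₗ[ℂ] A) (q : B) :
    adOp φ b t q = t (b * q) - φ b * t q := rfl

theorem adOp_comm (φ : B →ₐ[ℂ] A) (b c : B) (t : B →ₗ[ℂ] A) :
    adOp φ b (adOp φ c t) = adOp φ c (adOp φ b t) := by
  ext q
  simp only [adOp_apply, mul_left_comm c b]
  ring

/-- `t : B → A` is a differential operator of order less than `n`, in the sense that its `n`-fold
commutators with multiplications by members of the family `v` vanish. -/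
def IsDiffOp {κ : Type*} (φ : B →ₐ[ℂ] A) (v : κ → B) : ℕ → (B →ₗ[ℂ] A) → Prop
  | 0, t => t = 0
  | n + 1, t => ∀ i, IsDiffOp φ v n (adOp φ (v i) t)

variable {κ : Type*} {φ : B →ₐ[ℂ] A} {v : κ → B}

theorem isDiffOp_zero (n : ℕ) : IsDiffOp φ v n 0 := by
  induction n with
  | zero => rfl
  | succ n ih => intro i; rwa [map_zero]

theorem IsDiffOp.succ {n : ℕ} {t : B →ₗ[ℂ] A} (h : IsDiffOp φ v n t) : IsDiffOp φ v (n + 1) t := by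
  induction n generalizing t with
  | zero => rw [show t = 0 from h]; exact isDiffOp_zero _
  | succ n ih => exact fun i => ih (h i)

theorem IsDiffOp.mono {n l : ℕ} (hnl : n ≤ l) {t : B →ₗ[ℂ] A} (h : IsDiffOp φ v n t) :
    IsDiffOp φ v l t := by
  induction hnl with
  | refl => exact h
  | step _ ih => exact ih.succ

theorem IsDiffOp.add {n : ℕ} {s t : B →ₗ[ℂ] A} (hs : IsDiffOp φ v n s) (ht : IsDiffOp φ v n t) :
    IsDiffOp φ v n (s + t) := by
  induction n generalizing s t with
  | zero => rw [show s = 0 from hs, show t = 0 from ht, add_zero]; rfl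
  | succ n ih => intro i; rw [map_add]; exact ih (hs i) (ht i)

theorem IsDiffOp.smul {n : ℕ} {t : B →ₗ[ℂ] A} (ht : IsDiffOp φ v n t) (c : ℂ) :
    IsDiffOp φ v n (c • t) := by
  induction n generalizing t with
  | zero => rw [show t = 0 from ht, smul_zero]; rfl
  | succ n ih => intro i; rw [map_smul]; exact ih (ht i)

/-- Differential operators on `A`, of order less than `n`. -/
abbrev IsDiffEnd (n : ℕ) (D : A →ₗ[ℂ] A) : Prop := IsDiffOp (AlgHom.id ℂ A) (id : A → A) n D

theorem IsDiffOp.comp {n l : ℕ} {D : A →ₗ[ℂ] A} {t : B →ₗ[ℂ] A} (hD : IsDiffEnd n D)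
    (ht : IsDiffOp φ v l t) : IsDiffOp φ v (n + l) (D ∘ₗ t) := by
  induction h : n + l generalizing n l D t with
  | zero =>
    obtain rfl : n = 0 := by omega
    rw [show D = 0 from hD, LinearMap.zero_comp]; rfl
  | succ N ih =>
    rcases n with _ | n
    · rw [show D = 0 from hD, LinearMap.zero_comp]; exact isDiffOp_zero _
    rcases l with _ | l
    · rw [show t = 0 from ht, LinearMap.comp_zero]; exact isDiffOp_zero _
    intro i
    have : adOp φ (v i) (D ∘ₗ t) = D ∘ₗ adOp φ (v i) t + adOp (AlgHom.id ℂ A) (φ (v i)) D ∘ₗ t := by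
      ext q; simp [adOp_apply]
    rw [this]
    exact (ih hD (ht i) (by omega)).add (ih (hD (φ (v i))) ht (by omega))

/-- `t` is a differential operator of some order. -/
def HasFiniteOrder {κ : Type*} (φ : B →ₐ[ℂ] A) (v : κ → B) (t : B →ₗ[ℂ] A) : Prop :=
  ∃ n, IsDiffOp φ v n t

theorem HasFiniteOrder.add {s t : B →ₗ[ℂ] A} (hs : HasFiniteOrder φ v s)
    (ht : HasFiniteOrder φ v t) : HasFiniteOrder φ v (s + t) := by
  obtain ⟨n, hn⟩ := hs
  obtain ⟨l, hl⟩ := ht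
  exact ⟨max n l, (hn.mono (le_max_left _ _)).add (hl.mono (le_max_right _ _))⟩

theorem HasFiniteOrder.smul {t : B →ₗ[ℂ] A} (ht : HasFiniteOrder φ v t) (c : ℂ) :
    HasFiniteOrder φ v (c • t) := by
  obtain ⟨n, hn⟩ := ht
  exact ⟨n, hn.smul c⟩

theorem HasFiniteOrder.sub {s t : B →ₗ[ℂ] A} (hs : HasFiniteOrder φ v s)
    (ht : HasFiniteOrder φ v t) : HasFiniteOrder φ v (s - t) := by
  rw [sub_eq_add_neg, ← neg_one_smul ℂ]
  exact hs.add (ht.smul _)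

theorem HasFiniteOrder.zero : HasFiniteOrder φ v 0 := ⟨0, isDiffOp_zero 0⟩

theorem HasFiniteOrder.sum {ι : Type*} (s : Finset ι) {t : ι → B →ₗ[ℂ] A}
    (ht : ∀ i ∈ s, HasFiniteOrder φ v (t i)) : HasFiniteOrder φ v (∑ i ∈ s, t i) :=
  Finset.sum_induction _ _ (fun _ _ => HasFiniteOrder.add) HasFiniteOrder.zero ht

/-- Differential operators on `A`, of any order. -/
abbrev IsDiffEndo (D : A →ₗ[ℂ] A) : Prop := HasFiniteOrder (AlgHom.id ℂ A) (id : A → A) D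

theorem HasFiniteOrder.comp {D : A →ₗ[ℂ] A} {t : B →ₗ[ℂ] A} (hD : IsDiffEndo D)
    (ht : HasFiniteOrder φ v t) : HasFiniteOrder φ v (D ∘ₗ t) := by
  obtain ⟨n, hn⟩ := hD
  obtain ⟨l, hl⟩ := ht
  exact ⟨n + l, hn.comp hl⟩

theorem hasFiniteOrder_of_adOp [Finite κ] {t : B →ₗ[ℂ] A}
    (ht : ∀ i, HasFiniteOrder φ v (adOp φ (v i) t)) : HasFiniteOrder φ v t := by
  cases nonempty_fintype κ
  choose n hn using ht
  exact ⟨univ.sup n + 1, fun i => (hn i).mono (le_sup (mem_univ i))⟩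

theorem isDiffEndo_mulLeft (a : A) : IsDiffEndo (LinearMap.mulLeft ℂ a) :=
  ⟨1, fun b => by
    change adOp _ _ _ = 0
    ext q; simp [adOp_apply]; ring⟩

theorem isDiffEndo_derivation (D : Derivation ℂ A A) : IsDiffEndo (D : A →ₗ[ℂ] A) :=
  ⟨2, fun b c => by
    change adOp _ _ _ = 0
    ext q; simp [adOp_apply]; ring⟩

end DiffOp

/-! ### Evaluation at points -/

section Points

variable {A : Type*} [CommRing A] [Algebra ℂ A]

/-- A family of characters of `A` that separates the elements, such that the elements annihilated
by a character form the ideal generated by the functions `u s - u s (p)` (Hadamard's lemma). -/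
structure IsCoordinateSystem {M σ : Type*} (ev : M → A →ₐ[ℂ] ℂ) (u : σ → A) : Prop where
  ext : ∀ f, (∀ p, ev p f = 0) → f = 0
  hadamard : ∀ p f, ev p f = 0 →
    f ∈ Ideal.span (Set.range fun s => u s - algebraMap ℂ A (ev p (u s)))

variable {M σ : Type*} {ev : M → A →ₐ[ℂ] ℂ} {u : σ → A}

theorem IsDiffOp.ev_eq_zero {p : M} {n : ℕ} {D : A →ₗ[ℂ] A} (hD : IsDiffEnd n D) {f : A}
    (hf : f ∈ RingHom.ker (ev p) ^ n) : ev p (D f) = 0 := by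
  induction n generalizing D f with
  | zero => rw [show D = 0 from hD, LinearMap.zero_apply, map_zero]
  | succ n ih =>
    rw [pow_succ'] at hf
    refine Submodule.mul_induction_on hf (fun g hg k hk => ?_) (fun x y hx hy => ?_)
    · have h := ih (hD g) hk
      rw [id, adOp_apply, map_sub, AlgHom.id_apply, map_mul (ev p),
        show ev p g = 0 from hg, zero_mul, sub_zero] at h
      exact h
    · rw [map_add, map_add, hx, hy, add_zero]

/-- Operators that depend on jets only are differential operators in the algebraic sense. -/
theorem isDiffEnd_of_ev_eq_zero (hext : ∀ f, (∀ p, ev p f = 0) → f = 0) {n : ℕ} {D : A →ₗ[ℂ] A}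
    (hD : ∀ p, ∀ f ∈ RingHom.ker (ev p) ^ n, ev p (D f) = 0) : IsDiffEnd n D := by
  induction n generalizing D with
  | zero =>
    refine LinearMap.ext fun f => hext _ fun p => hD p f ?_
    rw [pow_zero, Ideal.one_eq_top]; trivial
  | succ n ih =>
    intro g
    refine ih fun p f hf => ?_
    have h := hD p ((g - algebraMap ℂ A (ev p g)) * f) (by
      rw [pow_succ']
      refine Ideal.mul_mem_mul ?_ hf
      rw [RingHom.mem_ker, map_sub, AlgHom.commutes]
      exact sub_self _)
    rw [sub_mul, map_sub, map_sub, ← Algebra.smul_def, map_smul, map_smul] at h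
    rw [id, adOp_apply, map_sub, AlgHom.id_apply, map_mul (ev p)]
    exact h

/-- Taylor polynomials: every function agrees with a polynomial in the coordinates to any given
order at a point. -/
theorem IsCoordinateSystem.exists_polynomial (h : IsCoordinateSystem ev u) (p : M) (n : ℕ) (f : A) :
    ∃ q : MvPolynomial σ ℂ, f - MvPolynomial.aeval u q ∈ RingHom.ker (ev p) ^ n := by
  induction n generalizing f with
  | zero => exact ⟨0, by rw [pow_zero, Ideal.one_eq_top]; trivial⟩
  | succ n ih =>
    suffices H : ∀ g ∈ Ideal.span (Set.range fun s => u s - algebraMap ℂ A (ev p (u s))),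
        ∃ q : MvPolynomial σ ℂ, g - MvPolynomial.aeval u q ∈ RingHom.ker (ev p) ^ (n + 1) by
      obtain ⟨q, hq⟩ := H (f - algebraMap ℂ A (ev p f)) (h.hadamard p _ (by
        rw [map_sub, AlgHom.commutes]; exact sub_self _))
      refine ⟨q + MvPolynomial.C (ev p f), ?_⟩
      rw [map_add, MvPolynomial.aeval_C, ← sub_sub, sub_right_comm]
      exact hq
    intro g hg
    refine Submodule.span_induction (fun x hx => ?_) ⟨0, by simp⟩ (fun x y _ _ hx hy => ?_)
      (fun a x hx' hx => ?_) hg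
    · obtain ⟨s, rfl⟩ := hx
      refine ⟨MvPolynomial.X s - MvPolynomial.C (ev p (u s)), ?_⟩
      simp
    · obtain ⟨q, hq⟩ := hx
      obtain ⟨r, hr⟩ := hy
      refine ⟨q + r, ?_⟩
      rw [map_add, add_sub_add_comm]
      exact add_mem hq hr
    · obtain ⟨q, hq⟩ := hx
      obtain ⟨r, hr⟩ := ih a
      have hxk : x ∈ RingHom.ker (ev p) := by
        refine (Ideal.span_le.2 ?_) hx'
        rintro _ ⟨s, rfl⟩
        rw [SetLike.mem_coe, RingHom.mem_ker, map_sub, AlgHom.commutes]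
        exact sub_self _
      refine ⟨r * q, ?_⟩
      have e : a • x - MvPolynomial.aeval u (r * q) = (a - MvPolynomial.aeval u r) * x +
        MvPolynomial.aeval u r * (x - MvPolynomial.aeval u q) := by
        rw [smul_eq_mul, map_mul]; ring
      rw [e]
      refine add_mem ?_ (Ideal.mul_mem_left _ _ hq)
      rw [pow_succ]
      exact Ideal.mul_mem_mul hr hxk

/-- A differential operator is determined by its values on the polynomials in the coordinates. -/
theorem IsCoordinateSystem.eq_zero_of_polynomials (h : IsCoordinateSystem ev u) {D : A →ₗ[ℂ] A}
    (hD : IsDiffEndo D) (h0 : ∀ q : MvPolynomial σ ℂ, D (MvPolynomial.aeval u q) = 0) : D = 0 := by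
  obtain ⟨n, hn⟩ := hD
  refine LinearMap.ext fun f => h.ext _ fun p => ?_
  obtain ⟨q, hq⟩ := h.exists_polynomial p n f
  have := hn.ev_eq_zero hq
  rwa [map_sub, h0, sub_zero] at this

theorem IsCoordinateSystem.derivation_eq_zero (h : IsCoordinateSystem ev u)
    (D : Derivation ℂ A A) (h0 : ∀ s, D (u s) = 0) : D = 0 := by
  have : (D : A →ₗ[ℂ] A) = 0 := by
    refine h.eq_zero_of_polynomials (isDiffEndo_derivation D) fun q => ?_
    induction q using MvPolynomial.induction_on with
    | C a => simp
    | add p q hp hq => rw [map_add, map_add, hp, hq, add_zero]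
    | mul_X p s hp =>
      rw [map_mul, MvPolynomial.aeval_X, Derivation.coeFn_coe, Derivation.leibniz, h0]
      rw [Derivation.coeFn_coe] at hp
      rw [hp, smul_zero, smul_zero, add_zero]
  ext f
  exact LinearMap.congr_fun this f

end Points

end

/-! ### Extension of operators from polynomials to functions -/

section

open Finset

section Extension

variable {A : Type*} [CommRing A] [Algebra ℂ A] {σ : Type*}

/-- The terms of order `n` in `∂` of the Taylor expansion of `t` around multiplication
operators: formally, the value at `1` of `(∑ₛ ad Xₛ ⊗ ∂ₛ)ⁿ (t ⊗ f)`. -/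
def taylorTerm [Fintype σ] (u : σ → A) (D : σ → Derivation ℂ A A) :
    ℕ → (MvPolynomial σ ℂ →ₗ[ℂ] A) → (A →ₗ[ℂ] A)
  | 0, t => LinearMap.mulLeft ℂ (t 1)
  | n + 1, t => ∑ s, taylorTerm u D n (adOp (MvPolynomial.aeval u) (MvPolynomial.X s) t) ∘ₗ
      (D s : A →ₗ[ℂ] A)

/-- The differential operator extending `t : ℂ[X] → A`, if `t` is of order less than `N`. -/
def polyExtend [Fintype σ] (u : σ → A) (D : σ → Derivation ℂ A A) (N : ℕ)
    (t : MvPolynomial σ ℂ →ₗ[ℂ] A) : A →ₗ[ℂ] A :=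
  ∑ n ∈ range N, ((n.factorial : ℂ)⁻¹) • taylorTerm u D n t

variable [Fintype σ] {u : σ → A} {D : σ → Derivation ℂ A A}

theorem isDiffEndo_taylorTerm (n : ℕ) (t : MvPolynomial σ ℂ →ₗ[ℂ] A) :
    IsDiffEndo (taylorTerm u D n t) := by
  induction n generalizing t with
  | zero => exact isDiffEndo_mulLeft _
  | succ n ih => exact HasFiniteOrder.sum _ fun s _ => (ih _).comp (isDiffEndo_derivation _)

theorem isDiffEndo_polyExtend (N : ℕ) (t : MvPolynomial σ ℂ →ₗ[ℂ] A) :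
    IsDiffEndo (polyExtend u D N t) :=
  HasFiniteOrder.sum _ fun n _ => (isDiffEndo_taylorTerm n t).smul _

theorem taylorTerm_succ_apply (n : ℕ) (t : MvPolynomial σ ℂ →ₗ[ℂ] A) (f : A) :
    taylorTerm u D (n + 1) t f =
      ∑ s, taylorTerm u D n (adOp (MvPolynomial.aeval u) (MvPolynomial.X s) t) (D s f) := by
  simp [taylorTerm]

theorem taylorTerm_mul [DecidableEq σ] (hD : ∀ s r, D s (u r) = if s = r then 1 else 0) (n : ℕ)
    (t : MvPolynomial σ ℂ →ₗ[ℂ] A) (s : σ) (f : A) :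
    taylorTerm u D (n + 1) t (u s * f) = u s * taylorTerm u D (n + 1) t f +
      ((n + 1 : ℕ) : ℂ) •
        taylorTerm u D n (adOp (MvPolynomial.aeval u) (MvPolynomial.X s) t) f := by
  have hl : ∀ f r, D r (u s * f) = u s * D r f + if r = s then f else 0 := by
    intro f r
    rw [Derivation.leibniz, hD, smul_eq_mul, smul_eq_mul]
    split_ifs <;> simp
  induction n generalizing t f with
  | zero =>
    simp only [taylorTerm_succ_apply, hl, map_add, sum_add_distrib]
    simp [taylorTerm, mul_sum, mul_left_comm, apply_ite]
  | succ n ih =>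
    have hc : ∀ r, adOp (MvPolynomial.aeval u) (MvPolynomial.X s)
        (adOp (MvPolynomial.aeval u) (MvPolynomial.X r) t) =
        adOp (MvPolynomial.aeval u) (MvPolynomial.X r)
          (adOp (MvPolynomial.aeval u) (MvPolynomial.X s) t) := fun r => adOp_comm _ _ _ _
    have h1 : ∑ r, taylorTerm u D (n + 1) (adOp (MvPolynomial.aeval u) (MvPolynomial.X r) t)
        (if r = s then f else 0) =
        taylorTerm u D (n + 1) (adOp (MvPolynomial.aeval u) (MvPolynomial.X s) t) f := by
      rw [sum_eq_single s (fun r _ h => by rw [if_neg h, map_zero]) (by simp), if_pos rfl]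
    rw [taylorTerm_succ_apply (n + 1) t, taylorTerm_succ_apply (n + 1) t]
    simp only [hl, map_add, sum_add_distrib, ih, hc, h1]
    rw [← mul_sum, ← smul_sum, Nat.cast_succ (n + 1), add_smul, one_smul]
    simp only [← taylorTerm_succ_apply]
    ring

theorem taylorTerm_algebraMap (n : ℕ) (t : MvPolynomial σ ℂ →ₗ[ℂ] A) (c : ℂ) :
    taylorTerm u D (n + 1) t (algebraMap ℂ A c) = 0 := by
  rw [taylorTerm_succ_apply]
  simp

/-- The two sides agree on constants, and by `taylorTerm_mul` both react to multiplication by a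
coordinate in the same way. -/
theorem polyExtend_aeval [DecidableEq σ] (hD : ∀ s r, D s (u r) = if s = r then 1 else 0) {N : ℕ}
    {t : MvPolynomial σ ℂ →ₗ[ℂ] A} (ht : IsDiffOp (MvPolynomial.aeval u) MvPolynomial.X N t)
    (q : MvPolynomial σ ℂ) : polyExtend u D N t (MvPolynomial.aeval u q) = t q := by
  induction q using MvPolynomial.induction_on generalizing N t with
  | C c =>
    rcases N with _ | N
    · rw [show t = 0 from ht]; simp [polyExtend]
    · rw [polyExtend, sum_range_succ']
      rw [← MvPolynomial.algebraMap_eq, AlgHom.commutes]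
      simp only [LinearMap.add_apply, LinearMap.sum_apply, LinearMap.smul_apply,
        taylorTerm_algebraMap, smul_zero, sum_const_zero, zero_add]
      rw [Algebra.algebraMap_eq_smul_one, Algebra.algebraMap_eq_smul_one, map_smul]
      simp [taylorTerm]
  | add p q hp hq => rw [map_add, map_add, map_add, hp ht, hq ht]
  | mul_X p s hp =>
    rcases N with _ | N
    · rw [show t = 0 from ht]; simp [polyExtend]
    · have h1 : polyExtend u D (N + 1) t (u s * MvPolynomial.aeval u p) =
          u s * polyExtend u D (N + 1) t (MvPolynomial.aeval u p) +
          polyExtend u D N (adOp (MvPolynomial.aeval u) (MvPolynomial.X s) t)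
            (MvPolynomial.aeval u p) := by
        simp only [polyExtend, LinearMap.sum_apply, LinearMap.smul_apply]
        rw [sum_range_succ', sum_range_succ' _ N, mul_add, mul_sum, add_right_comm,
          ← sum_add_distrib]
        congr 1
        · refine sum_congr rfl fun n _ => ?_
          rw [taylorTerm_mul hD, smul_add, mul_smul_comm, smul_smul]
          congr 2
          rw [Nat.factorial_succ]
          push_cast
          have : (n.factorial : ℂ) ≠ 0 := by exact_mod_cast n.factorial_ne_zero
          have : (n + 1 : ℂ) ≠ 0 := by exact_mod_cast n.succ_ne_zero
          field_simp
        · simp [taylorTerm, mul_left_comm]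
      rw [mul_comm p, map_mul, MvPolynomial.aeval_X, h1, hp ht, hp (ht s), adOp_apply,
        MvPolynomial.aeval_X]
      ring

end Extension

open scoped IsMulCommutative in
/-- Commuting endomorphisms make a vector space a module over a polynomial ring. -/
theorem exists_polynomial_action {σ V : Type*} [AddCommGroup V] [Module ℂ V]
    (Θ : σ → Module.End ℂ V) (hΘ : ∀ s r, Θ s * Θ r = Θ r * Θ s) (x : V) :
    ∃ T : MvPolynomial σ ℂ →ₗ[ℂ] V, T 1 = x ∧ ∀ s q, T (MvPolynomial.X s * q) = Θ s (T q) := by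
  have := Algebra.isMulCommutative_adjoin ℂ (s := Set.range Θ) (by
    rintro _ ⟨s, rfl⟩ _ ⟨r, rfl⟩; exact hΘ s r)
  let ψ : MvPolynomial σ ℂ →ₐ[ℂ] Algebra.adjoin ℂ (Set.range Θ) :=
    MvPolynomial.aeval fun s => ⟨Θ s, Algebra.subset_adjoin ⟨s, rfl⟩⟩
  refine ⟨(LinearMap.applyₗ x : Module.End ℂ V →ₗ[ℂ] V) ∘ₗ
    (Algebra.adjoin ℂ (Set.range Θ)).val.toLinearMap ∘ₗ ψ.toLinearMap, ?_, fun s q => ?_⟩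
  · simp
  · have : ψ (MvPolynomial.X s * q) = ⟨Θ s, Algebra.subset_adjoin ⟨s, rfl⟩⟩ * ψ q := by
      rw [map_mul]; simp [ψ]
    simp [this]

section SeriesOp

variable {A : Type*} [CommRing A] [Algebra ℂ A]

/-- `Θ` acts on power series as `∑ₖ ħᵏ Θₖ` with differential operators `Θₖ`. -/
def IsDiffSeries (Θ : A⟦X⟧ →ₗ[ℂ] A⟦X⟧) (D : ℕ → A →ₗ[ℂ] A) : Prop :=
  (∀ k, IsDiffEndo (D k)) ∧ ∀ F n, PowerSeries.coeff n (Θ F) =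
    ∑ x ∈ HasAntidiagonal.antidiagonal n, D x.1 (PowerSeries.coeff x.2 F)

/-- The coefficient maps of the quantization of polynomials defined by operators
`Θ s = u s + O(ħ)` are of finite order, so the quantization extends to all functions. -/
theorem hasFiniteOrder_coeff {σ : Type*} [Finite σ] {u : σ → A}
    {Θ : σ → A⟦X⟧ →ₗ[ℂ] A⟦X⟧} {D : σ → ℕ → A →ₗ[ℂ] A} (hΘ : ∀ s, IsDiffSeries (Θ s) (D s))
    (hu : ∀ s f, D s 0 f = u s * f) {T : MvPolynomial σ ℂ →ₗ[ℂ] A⟦X⟧}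
    (hT : ∀ s q, T (MvPolynomial.X s * q) = Θ s (T q)) (n : ℕ) :
    HasFiniteOrder (MvPolynomial.aeval u) MvPolynomial.X
      ((PowerSeries.coeff n).restrictScalars ℂ ∘ₗ T) := by
  induction n using Nat.strong_induction_on with
  | _ n ih =>
    refine hasFiniteOrder_of_adOp fun s => ?_
    have h : adOp (MvPolynomial.aeval u) (MvPolynomial.X s)
        ((PowerSeries.coeff n).restrictScalars ℂ ∘ₗ T) =
        ∑ j ∈ range n, D s (n - j) ∘ₗ ((PowerSeries.coeff j).restrictScalars ℂ ∘ₗ T) := by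
      refine LinearMap.ext fun q => ?_
      rw [adOp_apply, MvPolynomial.aeval_X]
      simp only [LinearMap.comp_apply, LinearMap.sum_apply, LinearMap.restrictScalars_apply, hT,
        (hΘ s).2]
      rw [← Finset.Nat.sum_antidiagonal_swap, Finset.Nat.sum_antidiagonal_eq_sum_range_succ_mk,
        sum_range_succ]
      simp [hu]
    rw [h]
    exact HasFiniteOrder.sum _ fun j hj => ((hΘ s).1 _).comp (ih j (mem_range.1 hj))

end SeriesOp

end

/-! ### Quantization of functions invariant under number symbols -/

section

open Finset

namespace FormalStar

variable {A : Type*} [CommRing A] [Algebra ℂ A] (S : FormalStar A)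

/-- The coefficients of the star product are differential operators in each argument. -/
def IsDifferential : Prop :=
  ∀ k f, IsDiffEndo (S.C k f) ∧ IsDiffEndo ((S.C k).flip f)

variable {S}

theorem isDiffSeries_mul (hS : S.IsDifferential) (G : A⟦X⟧) :
    IsDiffSeries (S.mul G) fun n =>
      ∑ x ∈ HasAntidiagonal.antidiagonal n, S.C x.1 (PowerSeries.coeff x.2 G) := by
  refine ⟨fun k => HasFiniteOrder.sum _ fun x _ => (hS _ _).1, fun F n => ?_⟩
  simp only [coeff_mul, LinearMap.sum_apply]
  rw [sum_sigma', sum_sigma']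
  refine sum_nbij' (fun x => ⟨(x.1.1 + x.2.1, x.2.2), (x.1.1, x.2.1)⟩)
    (fun x => ⟨(x.2.1, x.2.2 + x.1.2), (x.2.2, x.1.2)⟩) ?_ ?_ ?_ ?_ ?_ <;>
  rintro ⟨⟨a, b⟩, ⟨c, d⟩⟩ h <;> simp only [mem_sigma, HasAntidiagonal.mem_antidiagonal] at h ⊢
  · exact ⟨by omega, trivial⟩
  · exact ⟨by omega, trivial⟩
  · obtain ⟨h1, rfl⟩ := h; rfl
  · obtain ⟨h1, rfl⟩ := h; rfl

theorem isDiffSeries_mul_flip (hS : S.IsDifferential) (G : A⟦X⟧) :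
    IsDiffSeries (S.mul.flip G) fun n =>
      ∑ x ∈ HasAntidiagonal.antidiagonal n, (S.C x.1).flip (PowerSeries.coeff x.2 G) := by
  refine ⟨fun k => HasFiniteOrder.sum _ fun x _ => (hS _ _).2, fun F n => ?_⟩
  simp only [LinearMap.flip_apply, coeff_mul, LinearMap.sum_apply]
  rw [sum_sigma', sum_sigma']
  refine sum_nbij' (fun x => ⟨(x.1.1 + x.2.2, x.2.1), (x.1.1, x.2.2)⟩)
    (fun x => ⟨(x.2.1, x.1.2 + x.2.2), (x.1.2, x.2.2)⟩) ?_ ?_ ?_ ?_ ?_ <;>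
  rintro ⟨⟨a, b⟩, ⟨c, d⟩⟩ h <;> simp only [mem_sigma, HasAntidiagonal.mem_antidiagonal] at h ⊢
  · exact ⟨by omega, trivial⟩
  · exact ⟨by omega, trivial⟩
  · obtain ⟨h1, rfl⟩ := h; rfl
  · obtain ⟨h1, rfl⟩ := h; rfl

variable {ι κ M : Type*} [Fintype ι] [DecidableEq ι] {ev : M → A →ₐ[ℂ] ℂ} {u : ι ⊕ ι → A}
  {Z : ι ⊕ ι → A⟦X⟧} {N : κ → A⟦X⟧}

/-- The operators of the normal ordering: the symbols `Z (inr i)` multiply from the left and the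
symbols `Z (inl i)` from the right. -/
def orderedMul (S : FormalStar A) (Z : ι ⊕ ι → A⟦X⟧) : ι ⊕ ι → A⟦X⟧ →ₗ[ℂ] A⟦X⟧ :=
  Sum.elim (fun i => S.mul.flip (Z (Sum.inl i))) fun i => S.mul (Z (Sum.inr i))

omit [Fintype ι] [DecidableEq ι] in
theorem orderedMul_comm
    (hl : ∀ i j, S.comm (Z (Sum.inl i)) (Z (Sum.inl j)) = 0)
    (hr : ∀ i j, S.comm (Z (Sum.inr i)) (Z (Sum.inr j)) = 0) (s r : ι ⊕ ι) (F : A⟦X⟧) :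
    orderedMul S Z s (orderedMul S Z r F) = orderedMul S Z r (orderedMul S Z s F) := by
  have hl' := fun i j => sub_eq_zero.1 ((S.comm_apply _ _).symm.trans (hl i j))
  have hr' := fun i j => sub_eq_zero.1 ((S.comm_apply _ _).symm.trans (hr i j))
  rcases s with i | i <;> rcases r with j | j <;>
    simp only [orderedMul, Sum.elim_inl, Sum.elim_inr, LinearMap.flip_apply, mul_assoc]
  · rw [hl']
  · rw [← mul_assoc, hr', mul_assoc]

omit [Fintype ι] [DecidableEq ι] in
theorem comm_orderedMul {G : A⟦X⟧} {w : ι ⊕ ι → ℂ}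
    (hN : ∀ s, S.comm (Z s) G = w s • (PowerSeries.X * Z s)) (s : ι ⊕ ι) (F : A⟦X⟧) :
    S.comm (orderedMul S Z s F) G =
      orderedMul S Z s (S.comm F G) + w s • (PowerSeries.X * orderedMul S Z s F) := by
  rcases s with i | i <;> simp only [orderedMul, Sum.elim_inl, Sum.elim_inr, LinearMap.flip_apply]
  · rw [mul_comm', hN, map_smul, mul_X_mul]
  · rw [mul_comm', hN, map_smul, LinearMap.smul_apply, X_mul_mul, add_comm]

/-- Let the symbols `Z` be eigenvectors of the star commutators with the symbols `N`. Normal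
ordering intertwines the Poisson brackets with the principal parts of `N` and the star commutators
with `N`. Hence a function that Poisson commutes with the principal parts of `N` is the principal
part of a symbol that commutes with `N`. Both sides of the intertwining relation are differential
operators in the function, so that polynomials are enough. -/
theorem exists_lift (hS : S.IsDifferential) (hc : IsCoordinateSystem ev u)
    (D : ι ⊕ ι → Derivation ℂ A A) (hD : ∀ s r, D s (u r) = if s = r then 1 else 0)
    (hZ0 : ∀ s, PowerSeries.coeff 0 (Z s) = u s)
    (hl : ∀ i j, S.comm (Z (Sum.inl i)) (Z (Sum.inl j)) = 0)
    (hr : ∀ i j, S.comm (Z (Sum.inr i)) (Z (Sum.inr j)) = 0)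
    (w : κ → ι ⊕ ι → ℂ) (hN : ∀ j s, S.comm (Z s) (N j) = w j s • (PowerSeries.X * Z s))
    {f : A} (hf : ∀ j, S.bracket f (PowerSeries.coeff 0 (N j)) = 0) :
    ∃ G, PowerSeries.coeff 0 G = f ∧ ∀ j, S.comm G (N j) = 0 := by
  obtain ⟨T, hT1, hT⟩ := exists_polynomial_action (V := A⟦X⟧) (orderedMul S Z)
    (fun s r => LinearMap.ext fun F => orderedMul_comm hl hr s r F) 1
  have hΘ : ∀ s, ∃ Ds, IsDiffSeries (orderedMul S Z s) Ds ∧ ∀ f, Ds 0 f = u s * f := by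
    rintro (i | i)
    · exact ⟨_, isDiffSeries_mul_flip hS _, fun f => by simp [hZ0, S.lowest, mul_comm]⟩
    · exact ⟨_, isDiffSeries_mul hS _, fun f => by simp [hZ0, S.lowest]⟩
  choose Ds hDs hDs0 using hΘ
  choose n hn using fun k => hasFiniteOrder_coeff hDs hDs0 hT k
  let t : ℕ → A →ₗ[ℂ] A := fun k =>
    polyExtend u D (n k) ((PowerSeries.coeff k).restrictScalars ℂ ∘ₗ T)
  have ht : ∀ k q, t k (MvPolynomial.aeval u q) = PowerSeries.coeff k (T q) := fun k q =>
    polyExtend_aeval hD (hn k) q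
  have htd : ∀ k, IsDiffEndo (t k) := fun k => isDiffEndo_polyExtend _ _
  have hTmul : ∀ p s, T (p * MvPolynomial.X s) = orderedMul S Z s (T p) := fun p s => by
    rw [_root_.mul_comm, hT]
  have hTC : ∀ c : ℂ, T (MvPolynomial.C c) = c • 1 := fun c => by
    rw [← hT1, ← map_smul, MvPolynomial.smul_eq_C_mul, _root_.mul_one]
  -- `t 0` is the identity
  have ht0 : t 0 - LinearMap.id = 0 := by
    refine hc.eq_zero_of_polynomials ((htd 0).sub ?_) fun q => ?_
    · have := isDiffEndo_mulLeft (1 : A)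
      rwa [LinearMap.mulLeft_one] at this
    · rw [LinearMap.sub_apply, ht, LinearMap.id_apply, sub_eq_zero]
      induction q using MvPolynomial.induction_on with
      | C c =>
        rw [hTC, coeff_csmul, ← MvPolynomial.algebraMap_eq, AlgHom.commutes,
          Algebra.algebraMap_eq_smul_one]
        simp
      | add p q hp hq => rw [map_add, map_add, map_add, hp, hq]
      | mul_X p s hp =>
        rw [hTmul, (hDs s).2]
        simp [hDs0, hp, _root_.mul_comm]
  refine ⟨PowerSeries.mk fun k => t k f, ?_, fun j => ?_⟩
  · rw [PowerSeries.coeff_mk, ← sub_eq_zero]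
    exact LinearMap.congr_fun ht0 f
  let δ : Derivation ℂ A A := -(Complex.I • S.ham (PowerSeries.coeff 0 (N j)))
  have hδ : ∀ g, δ g = Complex.I • S.bracket g (PowerSeries.coeff 0 (N j)) := fun g => by
    rw [S.skew g]; simp [δ]
  have hδu : ∀ s, δ (u s) = w j s • u s := fun s => by
    rw [hδ, ← hZ0, ← S.coeff_one_comm, hN, coeff_csmul]
    congr 1
    exact PowerSeries.coeff_succ_X_mul 0 _
  -- the intertwining relation for polynomials
  have hpoly : ∀ q, ∃ q', MvPolynomial.aeval u q' = δ (MvPolynomial.aeval u q) ∧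
      S.comm (T q) (N j) = PowerSeries.X * T q' := by
    intro q
    induction q using MvPolynomial.induction_on with
    | C c =>
      refine ⟨0, ?_, ?_⟩
      · rw [← MvPolynomial.algebraMap_eq, AlgHom.commutes, Derivation.map_algebraMap, map_zero]
      · rw [hTC, comm_skew, comm_csmul_one, map_zero, mul_zero, neg_zero]
    | add p q hp hq =>
      obtain ⟨p', hp1, hp2⟩ := hp
      obtain ⟨q', hq1, hq2⟩ := hq
      refine ⟨p' + q', ?_, ?_⟩
      · rw [map_add, hp1, hq1, map_add, map_add]
      · rw [map_add, map_add, LinearMap.add_apply, hp2, hq2, map_add, mul_add]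
    | mul_X p s hp =>
      obtain ⟨p', hp1, hp2⟩ := hp
      refine ⟨p' * MvPolynomial.X s + w j s • (p * MvPolynomial.X s), ?_, ?_⟩
      · rw [map_add, map_mul, map_smul, map_mul, MvPolynomial.aeval_X, Derivation.leibniz, hδu, hp1,
          smul_eq_mul, smul_eq_mul, mul_smul_comm]
        ring
      · rw [hTmul, comm_orderedMul (hN j), hp2, map_add, map_smul, hTmul, hTmul, mul_add,
          mul_smul_comm]
        congr 1
        rcases s with i | i <;>
          simp only [orderedMul, Sum.elim_inl, Sum.elim_inr, LinearMap.flip_apply, X_mul_mul,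
            mul_X_mul]
  have hDN := isDiffSeries_mul hS (N j)
  have hDN' := isDiffSeries_mul_flip hS (N j)
  obtain ⟨E₁, hE₁⟩ : ∃ E, IsDiffSeries (S.mul (N j)) E := ⟨_, hDN⟩
  obtain ⟨E₂, hE₂⟩ : ∃ E, IsDiffSeries (S.mul.flip (N j)) E := ⟨_, hDN'⟩
  have hcomm : ∀ F k, PowerSeries.coeff k (S.comm F (N j)) =
      ∑ x ∈ HasAntidiagonal.antidiagonal k, (E₂ x.1 - E₁ x.1) (PowerSeries.coeff x.2 F) := by
    intro F k
    simp only [LinearMap.sub_apply, sum_sub_distrib]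
    rw [← hE₁.2, ← hE₂.2, ← map_sub]; rfl
  -- its coefficients, which hold for all functions
  have hE : ∀ k, ∑ x ∈ HasAntidiagonal.antidiagonal (k + 1), (E₂ x.1 - E₁ x.1) ∘ₗ t x.2 -
      t k ∘ₗ (δ : A →ₗ[ℂ] A) = 0 := by
    intro k
    refine hc.eq_zero_of_polynomials ((HasFiniteOrder.sum _ fun x _ =>
      ((hE₂.1 _).sub (hE₁.1 _)).comp (htd _)).sub
      ((htd k).comp (isDiffEndo_derivation δ))) fun q => ?_
    obtain ⟨q', h1, h2⟩ := hpoly q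
    simp only [LinearMap.sub_apply, LinearMap.sum_apply, LinearMap.comp_apply]
    rw [Derivation.coeFn_coe, ← h1, ht, sub_eq_zero, ← PowerSeries.coeff_succ_X_mul, ← h2, hcomm]
    simp only [ht, LinearMap.sub_apply]
  ext k
  rcases k with _ | k
  · rw [coeff_zero_comm]; rfl
  · rw [hcomm]
    have h := LinearMap.congr_fun (hE k) f
    simp only [LinearMap.sub_apply, LinearMap.sum_apply, LinearMap.comp_apply] at h
    rw [Derivation.coeFn_coe, hδ, hf, smul_zero, map_zero, sub_zero] at h
    simpa using h

/-- If the star commutators of `F` with number-type symbols `N` vanish up to order `n`, then their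
coefficients of order `n + 1` are Poisson brackets of one common function `g`: the invariant
coefficients of `F` are removed one after another by symbols commuting with `N`. -/
theorem exists_coeff_comm_eq_bracket
    (hlift : ∀ f, (∀ j, S.bracket f (PowerSeries.coeff 0 (N j)) = 0) →
      ∃ G, PowerSeries.coeff 0 G = f ∧ ∀ j, S.comm G (N j) = 0)
    (n : ℕ) (F : A⟦X⟧) (hF : ∀ j, ∀ k < n + 1, PowerSeries.coeff k (S.comm F (N j)) = 0) :
    ∃ g, ∀ j, PowerSeries.coeff (n + 1) (S.comm F (N j)) =
      Complex.I • S.bracket g (PowerSeries.coeff 0 (N j)) := by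
  induction n generalizing F with
  | zero => exact ⟨PowerSeries.coeff 0 F, fun j => S.coeff_one_comm _ _⟩
  | succ n ih =>
    obtain ⟨G, hG0, hG⟩ := hlift (PowerSeries.coeff 0 F) fun j => by
      have h := hF j 1 (by omega)
      rw [S.coeff_one_comm] at h
      exact (smul_eq_zero_iff_right Complex.I_ne_zero).1 h
    obtain ⟨F', hF'⟩ := exists_X_pow_mul (n := 1) (F := F - G) (fun k hk => by
      obtain rfl : k = 0 := by omega
      rw [map_sub, hG0, sub_self])
    have hFc : ∀ j, S.comm F (N j) = PowerSeries.X * S.comm F' (N j) := fun j => by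
      rw [← X_mul_comm, ← pow_one PowerSeries.X, ← hF', map_sub, LinearMap.sub_apply, hG, sub_zero]
    obtain ⟨g, hg⟩ := ih F' fun j k hk => by
      rw [← PowerSeries.coeff_succ_X_mul, ← hFc]; exact hF j _ (by omega)
    exact ⟨g, fun j => by rw [hFc, PowerSeries.coeff_succ_X_mul, hg]⟩

end FormalStar

end

/-! ### The homological equation on tori -/

section

open Finset

section Homological

variable {A ι : Type*} [AddCommGroup A] [Module ℂ A] {V R : ι → Module.End ℂ A}

/-- For commuting operators `V k` (derivatives along the circles of a torus) with pseudo-inverses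
`R k`, the homological equation `V k w = γ k` is solvable up to invariant terms if `γ` is closed:
the circles are averaged out one after another. -/
theorem exists_primitive [Fintype ι] (hV : ∀ k l f, V k (V l f) = V l (V k f))
    (hVR : ∀ k l f, V k (R l f) = R l (V k f)) (hVRV : ∀ k f, V k (R k (V k f)) = V k f)
    (γ : ι → A) (hγ : ∀ k l, V k (γ l) = V l (γ k)) :
    ∃ w, ∀ k l, V l (V k w) = V l (γ k) := by
  classical
  have H : ∀ s : Finset ι, ∃ (w : A) (P : Module.End ℂ A), (∀ k f, V k (P f) = P (V k f)) ∧
      (∀ l ∈ s, ∀ f, V l (P f) = 0) ∧ ∀ k, V k w = γ k - P (γ k) := by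
    intro s
    induction s using Finset.induction_on with
    | empty => exact ⟨0, LinearMap.id, by simp, by simp, by simp⟩
    | insert n s _ ih =>
      obtain ⟨w, P, h1, h2, h3⟩ := ih
      refine ⟨w + R n (P (γ n)), P - R n ∘ₗ V n ∘ₗ P, fun k f => ?_, fun l hl f => ?_, fun k => ?_⟩
      · simp [hVR, h1, hV k n]
      · rcases Finset.mem_insert.1 hl with rfl | hl
        · simp only [LinearMap.sub_apply, LinearMap.comp_apply, map_sub, hVRV, sub_self]
        · simp only [LinearMap.sub_apply, LinearMap.comp_apply, map_sub, hVR, hV l n, h2 l hl,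
            map_zero, sub_self]
      · simp only [LinearMap.sub_apply, LinearMap.comp_apply, map_add, hVR, h3, h1, hγ k n]
        abel
  obtain ⟨w, P, -, h2, h3⟩ := H univ
  exact ⟨w, fun k l => by rw [h3, map_sub, h2 l (mem_univ l), sub_zero]⟩

/-- The failure of closedness has zero mean over the circles `a` and `b`, so it vanishes if it is
invariant under them. -/
theorem curl_eq_zero (hV : ∀ k l f, V k (V l f) = V l (V k f))
    (hVR : ∀ k l f, V k (R l f) = R l (V k f)) (hVRV : ∀ k f, V k (R k (V k f)) = V k f)
    {x y : A} {a b : ι} (ha : V a (V a y - V b x) = 0) (hb : V b (V a y - V b x) = 0) :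
    V a y - V b x = 0 := by
  have hp : ∀ k f, V k f - R k (V k (V k f)) = 0 := fun k f => by rw [← hVR, hVRV, sub_self]
  have e1 : V a y - V b x = (V a y - V b x) - R b (V b (V a y - V b x)) := by
    rw [hb, map_zero, sub_zero]
  have e2 : V a y - V b x = V a (y - R b (V b y)) := by
    conv_lhs => rw [e1]
    simp only [map_sub, hVR, hV b a]
    have := hp b x
    rw [sub_eq_zero] at this
    rw [← this]; abel
  have e3 := hp a (y - R b (V b y))
  rw [← e2, ha, map_zero, sub_zero] at e3
  exact e3

end Homological

namespace FormalStar

/-! ### Classical action variables -/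

variable {A : Type*} [CommRing A] [Algebra ℂ A] {m : ℕ}

/-- `(x i - i x (i+m)) / √2`. -/
def annih {V : Type*} [AddCommGroup V] [Module ℂ V] (x : Fin m ⊕ Fin m → V) (i : Fin m) : V :=
  (1 / (Real.sqrt 2 : ℂ)) • (x (Sum.inl i) - Complex.I • x (Sum.inr i))

/-- `(x i + i x (i+m)) / √2`. -/
def creat {V : Type*} [AddCommGroup V] [Module ℂ V] (x : Fin m ⊕ Fin m → V) (i : Fin m) : V :=
  (1 / (Real.sqrt 2 : ℂ)) • (x (Sum.inl i) + Complex.I • x (Sum.inr i))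

theorem coeff_annih (n : ℕ) (x : Fin m ⊕ Fin m → A⟦X⟧) (i : Fin m) :
    PowerSeries.coeff n (annih x i) = annih (fun s => PowerSeries.coeff n (x s)) i := by
  simp only [annih, coeff_csmul, map_sub]

theorem coeff_creat (n : ℕ) (x : Fin m ⊕ Fin m → A⟦X⟧) (i : Fin m) :
    PowerSeries.coeff n (creat x i) = creat (fun s => PowerSeries.coeff n (x s)) i := by
  simp only [creat, coeff_csmul, map_add]

theorem inv_sqrt_two_mul_self :
    (1 / (Real.sqrt 2 : ℂ)) * (1 / (Real.sqrt 2 : ℂ)) = 2⁻¹ := by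
  rw [div_mul_div_comm, ← Complex.ofReal_mul, Real.mul_self_sqrt (by norm_num)]
  norm_num

/-- The action variables `creat z i * annih z i = ((z i)² + (z (i+m))²) / 2`. -/
def action (z : Fin m ⊕ Fin m → A) (i : Fin m) : A := creat z i * annih z i

theorem action_eq (z : Fin m ⊕ Fin m → A) (i : Fin m) :
    action z i = (2⁻¹ : ℂ) • (z (Sum.inl i) ^ 2 + z (Sum.inr i) ^ 2) := by
  rw [action, creat, annih, smul_mul_smul_comm, inv_sqrt_two_mul_self]
  congr 1
  have : (z (Sum.inl i) + Complex.I • z (Sum.inr i)) * (z (Sum.inl i) - Complex.I • z (Sum.inr i)) =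
      z (Sum.inl i) ^ 2 - (Complex.I • z (Sum.inr i)) * (Complex.I • z (Sum.inr i)) := by ring
  rw [this, smul_mul_smul_comm, Complex.I_mul_I, neg_one_smul]
  ring

/-- Classical Darboux coordinates with an integrable system `h` that is a nondegenerate function
of the action variables, and inverses of the derivatives along the angles on functions of mean
zero. -/
structure ClassicalData (S : FormalStar A) (z : Fin m ⊕ Fin m → A) (h : Fin m → A) where
  darboux : ∀ a b, S.bracket (z a) (z b) = algebraMap ℂ A (matJ m a b)
  /-- the frequency matrix -/
  freq : Matrix (Fin m) (Fin m) A
  isUnit_det : IsUnit freq.det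
  bracket_h : ∀ i g, S.bracket (h i) g = ∑ k, freq i k * S.bracket (action z k) g
  bracket_freq : ∀ c i k, S.bracket (action z c) (freq i k) = 0
  /-- pseudo-inverses of the derivatives along the angles -/
  inv : Fin m → A →ₗ[ℂ] A
  bracket_inv : ∀ k l f, S.bracket (action z k) (inv l f) = inv l (S.bracket (action z k) f)
  bracket_inv_bracket : ∀ k f, S.bracket (action z k) (inv k (S.bracket (action z k) f)) =
    S.bracket (action z k) f

variable {S : FormalStar A} {z : Fin m ⊕ Fin m → A} {h : Fin m → A}

theorem bracket_algebraMap (f : A) (c : ℂ) : S.bracket f (algebraMap ℂ A c) = 0 :=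
  (S.ham f).map_algebraMap c

theorem matJ_inl_inl (i j : Fin m) : matJ m (Sum.inl i) (Sum.inl j) = 0 := by simp [matJ]

theorem matJ_inr_inr (i j : Fin m) : matJ m (Sum.inr i) (Sum.inr j) = 0 := by simp [matJ]

theorem matJ_inl_inr (i j : Fin m) : matJ m (Sum.inl i) (Sum.inr j) = if i = j then 1 else 0 := by
  simp [matJ, Matrix.one_apply]

theorem matJ_inr_inl (i j : Fin m) : matJ m (Sum.inr i) (Sum.inl j) = if i = j then -1 else 0 := by
  simp only [matJ, Matrix.fromBlocks_apply₂₁, Matrix.neg_apply, Matrix.one_apply]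
  split_ifs <;> simp

theorem bracket_action (S : FormalStar A) (z : Fin m ⊕ Fin m → A) (k : Fin m) (g : A) :
    S.bracket (action z k) g =
      z (Sum.inl k) * S.bracket (z (Sum.inl k)) g +
        z (Sum.inr k) * S.bracket (z (Sum.inr k)) g := by
  rw [action_eq, map_smul, LinearMap.smul_apply, map_add, LinearMap.add_apply, pow_two, pow_two,
    mul_bracket, mul_bracket, ← smul_right_inj (two_ne_zero : (2 : ℂ) ≠ 0), smul_smul,
    mul_inv_cancel₀ two_ne_zero, one_smul, two_smul]
  ring

theorem bracket_action_inl (hz : ∀ a b, S.bracket (z a) (z b) = algebraMap ℂ A (matJ m a b))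
    (k j : Fin m) : S.bracket (action z k) (z (Sum.inl j)) =
      if k = j then -z (Sum.inr j) else 0 := by
  rw [bracket_action, hz, hz, matJ_inl_inl, matJ_inr_inl]
  split_ifs with h
  · simp [h]
  · simp

theorem bracket_action_inr (hz : ∀ a b, S.bracket (z a) (z b) = algebraMap ℂ A (matJ m a b))
    (k j : Fin m) : S.bracket (action z k) (z (Sum.inr j)) =
      if k = j then z (Sum.inl j) else 0 := by
  rw [bracket_action, hz, hz, matJ_inr_inr, matJ_inl_inr]
  split_ifs with h
  · simp [h]
  · simp

theorem bracket_action_action (hz : ∀ a b, S.bracket (z a) (z b) = algebraMap ℂ A (matJ m a b))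
    (k j : Fin m) : S.bracket (action z k) (action z j) = 0 := by
  rw [action_eq z j, map_smul, map_add, pow_two, pow_two, S.leibniz, S.leibniz,
    bracket_action_inl hz, bracket_action_inr hz]
  split_ifs <;> simp [mul_comm]

namespace ClassicalData

variable (cd : ClassicalData S z h)

include cd

theorem bracket_h_action (i j : Fin m) : S.bracket (h i) (action z j) = 0 := by
  rw [cd.bracket_h]
  exact sum_eq_zero fun k _ => by rw [bracket_action_action cd.darboux, mul_zero]

theorem action_comm (k l : Fin m) (f : A) :
    S.bracket (action z k) (S.bracket (action z l) f) =
      S.bracket (action z l) (S.bracket (action z k) f) := by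
  rw [S.bracket_jacobi, bracket_action_action cd.darboux, map_zero, LinearMap.zero_apply, zero_add]

/-- Solution of the linearized normal form problem: a Hamiltonian `w` whose flow makes the
perturbations `g i` of `h i` invariant under the torus. -/
theorem exists_generator (g : Fin m → A)
    (hg : ∀ c l i, S.bracket (action z c) (S.bracket (h l) (g i) - S.bracket (h i) (g l)) = 0) :
    ∃ w, ∀ i j, S.bracket (h i) (S.bracket w (action z j)) = -S.bracket (g i) (action z j) := by
  -- in terms of `γ`, the derivatives along the angles can be treated separately
  let γ : Fin m → A := (cd.freq⁻¹).mulVec g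
  have hγ : ∀ i, g i = ∑ k, cd.freq i k * γ k := fun i => by
    have : cd.freq.mulVec γ = g := by
      simp only [γ]
      rw [Matrix.mulVec_mulVec, Matrix.mul_nonsing_inv _ cd.isUnit_det, Matrix.one_mulVec]
    exact (congrFun this i).symm
  have hVg : ∀ k i, S.bracket (action z k) (g i) =
      ∑ l, cd.freq i l * S.bracket (action z k) (γ l) := fun k i => by
    rw [hγ i, map_sum]
    exact sum_congr rfl fun l _ => by rw [S.leibniz, cd.bracket_freq, zero_mul, zero_add]
  let e : Fin m → Fin m → A := fun a b =>
    S.bracket (action z a) (γ b) - S.bracket (action z b) (γ a)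
  have hd : ∀ l i, S.bracket (h l) (g i) - S.bracket (h i) (g l) =
      ∑ a, ∑ b, cd.freq l a * (e a b * cd.freq i b) := by
    intro l i
    have h1 : S.bracket (h i) (g l) =
        ∑ a, ∑ b, cd.freq i b * (cd.freq l a * S.bracket (action z b) (γ a)) := by
      simp only [cd.bracket_h i, hVg, mul_sum]
      exact sum_comm
    rw [h1, cd.bracket_h l]
    simp only [hVg, mul_sum, ← sum_sub_distrib]
    exact sum_congr rfl fun a _ => sum_congr rfl fun b _ => by simp only [e]; ring
  have he : ∀ c a b, S.bracket (action z c) (e a b) = 0 := by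
    intro c
    let e' : Matrix (Fin m) (Fin m) A := Matrix.of fun a b => S.bracket (action z c) (e a b)
    have h1 : cd.freq * (e' * cd.freq.transpose) = 0 := by
      ext l i
      rw [Matrix.zero_apply, ← hg c l i, hd]
      simp only [Matrix.mul_apply, Matrix.transpose_apply, Matrix.of_apply, map_sum, mul_sum,
        S.leibniz,
        cd.bracket_freq, zero_mul, zero_add, mul_zero, add_zero, e']
    have h2 : e' = 0 := by
      have h3 : e' * cd.freq.transpose = 0 := by
        rw [← Matrix.one_mul (e' * _), ← Matrix.nonsing_inv_mul _ cd.isUnit_det,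
          Matrix.mul_assoc cd.freq⁻¹, h1, Matrix.mul_zero]
      have hu : IsUnit cd.freq.transpose.det := by rw [Matrix.det_transpose]; exact cd.isUnit_det
      rw [← Matrix.mul_one e', ← Matrix.mul_nonsing_inv _ hu, ← Matrix.mul_assoc, h3,
        Matrix.zero_mul]
    intro a b
    exact congrFun (congrFun h2 a) b
  have hcl : ∀ a b, S.bracket (action z a) (γ b) = S.bracket (action z b) (γ a) := fun a b =>
    sub_eq_zero.1 (curl_eq_zero (V := fun k => S.bracket (action z k)) (R := cd.inv)
      cd.action_comm cd.bracket_inv cd.bracket_inv_bracket (he a a b) (he b a b))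
  obtain ⟨w, hw⟩ := exists_primitive (V := fun k => S.bracket (action z k)) (R := cd.inv)
      cd.action_comm cd.bracket_inv cd.bracket_inv_bracket γ hcl
  refine ⟨-w, fun i j => ?_⟩
  have h1 : S.bracket (-w) (action z j) = S.bracket (action z j) w := by
    rw [S.skew, map_neg, neg_neg]
  rw [← S.skew (action z j), hVg, h1, cd.bracket_h]
  exact sum_congr rfl fun k _ => by rw [cd.action_comm, hw]

end ClassicalData

end FormalStar

end

/-! ### Quantum normal form -/

section

open Finset

namespace FormalStar

variable {A : Type*} [CommRing A] [Algebra ℂ A] {m : ℕ} {S : FormalStar A}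
  {z : Fin m ⊕ Fin m → A} {h : Fin m → A} {Z : Fin m ⊕ Fin m → A⟦X⟧}

/-- The number symbols. -/
def number (S : FormalStar A) (Z : Fin m ⊕ Fin m → A⟦X⟧) (i : Fin m) : A⟦X⟧ :=
  S.mul (creat Z i) (annih Z i)

theorem coeff_zero_number (hZ0 : ∀ a, PowerSeries.coeff 0 (Z a) = z a) (i : Fin m) :
    PowerSeries.coeff 0 (S.number Z i) = action z i := by
  rw [number, coeff_zero_mul, coeff_annih, coeff_creat, action]
  simp only [hZ0]

theorem Darboux.comm_eq (hZ : S.Darboux (matJ m) Z) (a b : Fin m ⊕ Fin m) :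
    S.comm (Z a) (Z b) = (Complex.I * matJ m a b) • PowerSeries.X := by
  rw [hZ a b, monomial_one_algebraMap, mul_smul_comm, _root_.mul_one]

theorem Darboux.comm_annih_annih (hZ : S.Darboux (matJ m) Z) (i j : Fin m) :
    S.comm (annih Z i) (annih Z j) = 0 := by
  simp only [annih, map_smul, map_sub, LinearMap.smul_apply, LinearMap.sub_apply, hZ.comm_eq,
    matJ_inl_inl, matJ_inr_inr, matJ_inl_inr, matJ_inr_inl]
  split_ifs <;> match_scalars <;> ring

theorem Darboux.comm_creat_creat (hZ : S.Darboux (matJ m) Z) (i j : Fin m) :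
    S.comm (creat Z i) (creat Z j) = 0 := by
  simp only [creat, map_smul, map_add, LinearMap.smul_apply, LinearMap.add_apply, hZ.comm_eq,
    matJ_inl_inl, matJ_inr_inr, matJ_inl_inr, matJ_inr_inl]
  split_ifs <;> match_scalars <;> ring

theorem Darboux.comm_annih_creat (hZ : S.Darboux (matJ m) Z) (i j : Fin m) :
    S.comm (annih Z i) (creat Z j) = if i = j then -PowerSeries.X else 0 := by
  simp only [annih, creat, map_smul, map_add, map_sub, LinearMap.smul_apply,
    LinearMap.sub_apply, hZ.comm_eq, matJ_inl_inl, matJ_inr_inr, matJ_inl_inr, matJ_inr_inl]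
  split_ifs
  · match_scalars
    linear_combination (2 * Complex.I * Complex.I) * inv_sqrt_two_mul_self + Complex.I_mul_I
  · match_scalars; ring

/-- The number symbols count: `annih Z` and `creat Z` are eigenvectors of commutation with them. -/
theorem Darboux.comm_number (hZ : S.Darboux (matJ m) Z) (j : Fin m) (s : Fin m ⊕ Fin m) :
    S.comm (Sum.elim (annih Z) (creat Z) s) (S.number Z j) =
      (Sum.elim (fun i => if i = j then (-1 : ℂ) else 0) (fun i => if i = j then 1 else 0) s) •
        (PowerSeries.X * Sum.elim (annih Z) (creat Z) s) := by
  rcases s with i | i <;> simp only [Sum.elim_inl, Sum.elim_inr, number, comm_mul]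
  · rw [hZ.comm_annih_annih, hZ.comm_annih_creat, map_zero, add_zero]
    split_ifs with h
    · rw [map_neg, LinearMap.neg_apply, h, neg_one_smul]
      have := S.X_mul_mul 1 (annih Z j)
      rw [_root_.mul_one, one_mul] at this
      rw [this]
    · simp
  · rw [hZ.comm_creat_creat, map_zero, LinearMap.zero_apply, zero_add, S.comm_skew,
      hZ.comm_annih_creat]
    simp only [@eq_comm _ j i]
    split_ifs with h
    · rw [neg_neg, h, one_smul]
      have := S.mul_X_mul (creat Z j) 1
      rw [_root_.mul_one, mul_one] at this
      rw [this]
    · simp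

section Lift

variable {M : Type*} {ev : M → A →ₐ[ℂ] ℂ}

theorem inv_sqrt_two_mul_self_smul (f : A) :
    (1 / (Real.sqrt 2 : ℂ)) • (1 / (Real.sqrt 2 : ℂ)) • f = (2⁻¹ : ℂ) • f := by
  rw [smul_smul, inv_sqrt_two_mul_self]

/-- The complex coordinates `annih z`, `creat z` are as good as the real coordinates `z`. -/
theorem isCoordinateSystem_annih_creat (hc : IsCoordinateSystem ev z) :
    IsCoordinateSystem ev (Sum.elim (annih z) (creat z)) := by
  refine ⟨hc.ext, fun p f hf => ?_⟩
  refine Ideal.span_le.2 ?_ (hc.hadamard p f hf)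
  have hu : ∀ s, Sum.elim (annih z) (creat z) s -
      algebraMap ℂ A (ev p (Sum.elim (annih z) (creat z) s)) ∈ Ideal.span (Set.range fun s =>
        Sum.elim (annih z) (creat z) s -
          algebraMap ℂ A (ev p (Sum.elim (annih z) (creat z) s))) := fun s =>
    Ideal.subset_span ⟨s, rfl⟩
  have key : ∀ (i : Fin m) (x : A) (c d : ℂ), x = c • annih z i + d • creat z i →
      x - algebraMap ℂ A (ev p x) ∈ Ideal.span (Set.range fun s =>
        Sum.elim (annih z) (creat z) s -
          algebraMap ℂ A (ev p (Sum.elim (annih z) (creat z) s))) := by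
    intro i x c d hx
    have : x - algebraMap ℂ A (ev p x) =
        algebraMap ℂ A c * (annih z i - algebraMap ℂ A (ev p (annih z i))) +
        algebraMap ℂ A d * (creat z i - algebraMap ℂ A (ev p (creat z i))) := by
      rw [hx, map_add, map_smul, map_smul, map_add, smul_eq_mul, smul_eq_mul, map_mul, map_mul,
        Algebra.smul_def, Algebra.smul_def]
      ring
    rw [this]
    exact add_mem (Ideal.mul_mem_left _ _ (hu (Sum.inl i)))
      (Ideal.mul_mem_left _ _ (hu (Sum.inr i)))
  rintro _ ⟨i | i, rfl⟩
  · refine key i _ (1 / (Real.sqrt 2 : ℂ)) (1 / (Real.sqrt 2 : ℂ)) ?_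
    rw [annih, creat, inv_sqrt_two_mul_self_smul, inv_sqrt_two_mul_self_smul, ← smul_add]
    rw [sub_add_add_cancel, ← two_smul ℂ, smul_smul]
    norm_num
  · refine key i _ (Complex.I * (1 / (Real.sqrt 2 : ℂ))) (-Complex.I * (1 / (Real.sqrt 2 : ℂ))) ?_
    rw [annih, creat, mul_smul, mul_smul, inv_sqrt_two_mul_self_smul, inv_sqrt_two_mul_self_smul,
      neg_smul, ← sub_eq_add_neg, ← smul_sub, ← smul_sub]
    rw [smul_smul]
    rw [show z (Sum.inl i) - Complex.I • z (Sum.inr i) - (z (Sum.inl i) + Complex.I • z (Sum.inr i))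
      = (-2 * Complex.I) • z (Sum.inr i) by rw [mul_smul, neg_smul, two_smul]; abel, smul_smul]
    rw [show Complex.I * 2⁻¹ * (-2 * Complex.I) = 1 by
      linear_combination -Complex.I_mul_I, one_smul]

/-- The first nonvanishing commutators with the number symbols are brackets with the actions. The
derivations used for normal ordering are the partial derivatives with respect to `annih z` and
`creat z`. -/
theorem Darboux.exists_coeff_comm (hZ : S.Darboux (matJ m) Z) (hS : S.IsDifferential)
    (hc : IsCoordinateSystem ev z) (hZ0 : ∀ a, PowerSeries.coeff 0 (Z a) = z a) (n : ℕ) (F : A⟦X⟧)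
    (hF : ∀ j, ∀ k < n + 1, PowerSeries.coeff k (S.comm F (S.number Z j)) = 0) :
    ∃ g, ∀ j, PowerSeries.coeff (n + 1) (S.comm F (S.number Z j)) =
      Complex.I • S.bracket g (action z j) := by
  have hb : ∀ F G, Complex.I • S.bracket (PowerSeries.coeff 0 F) (PowerSeries.coeff 0 G) =
      PowerSeries.coeff 1 (S.comm F G) := fun F G => (S.coeff_one_comm F G).symm
  have ha0 : ∀ i, annih z i = PowerSeries.coeff 0 (annih Z i) := fun i => by
    rw [coeff_annih]; simp only [hZ0]
  have hc0 : ∀ i, creat z i = PowerSeries.coeff 0 (creat Z i) := fun i => by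
    rw [coeff_creat]; simp only [hZ0]
  have hlift := fun f hf => exists_lift (f := f) (S := S)
    (Z := Sum.elim (annih Z) (creat Z)) (N := S.number Z)
    hS (isCoordinateSystem_annih_creat hc)
    (Sum.elim (fun i => Complex.I • S.ham (creat z i)) fun i => -(Complex.I • S.ham (annih z i)))
    (by
      rintro (i | i) (j | j) <;>
        simp only [Sum.elim_inl, Sum.elim_inr, Derivation.neg_apply, Derivation.smul_apply,
          ham_apply, ha0, hc0, hb, hZ.comm_annih_annih, hZ.comm_creat_creat, hZ.comm_annih_creat,
          S.comm_skew (creat Z i) (annih Z j), Sum.inl.injEq, Sum.inr.injEq, @eq_comm _ j i,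
          reduceCtorEq, if_false, map_zero, neg_zero]
      · split_ifs <;> simp
      · split_ifs <;> simp)
    (by rintro (i | i) <;> simp [ha0, hc0]) hZ.comm_annih_annih hZ.comm_creat_creat _
    hZ.comm_number hf
  obtain ⟨g, hg⟩ := exists_coeff_comm_eq_bracket hlift n F hF
  exact ⟨g, fun j => by rw [hg, coeff_zero_number hZ0]⟩

end Lift

section Real

variable [StarRing A] [StarModule ℂ A]

theorem conjSeries_annih (hZ : ∀ a, IsRealSeries (Z a)) (i : Fin m) :
    conjSeries (annih Z i) = creat Z i := by
  rw [annih, creat, conjSeries_smul, conjSeries_sub, conjSeries_smul, hZ, hZ]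
  simp

theorem conjSeries_creat (hZ : ∀ a, IsRealSeries (Z a)) (i : Fin m) :
    conjSeries (creat Z i) = annih Z i := by
  rw [annih, creat, conjSeries_smul, conjSeries_add, conjSeries_smul, hZ, hZ]
  simp [sub_eq_add_neg]

theorem IsHermitian.isRealSeries_number (hS : S.IsHermitian) (hZ : ∀ a, IsRealSeries (Z a))
    (i : Fin m) : IsRealSeries (S.number Z i) := by
  rw [IsRealSeries, number, hS.conj_mul, conjSeries_annih hZ, conjSeries_creat hZ]

variable {M : Type*} {ev : M → A →ₐ[ℂ] ℂ} {H : Fin m → A⟦X⟧}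

/-- If `H` commutes with the number symbols of exact Darboux symbols up to order `n + 1`, new
Darboux symbols, changed in the orders above `n` only, achieve this up to order `n + 2`: first they
are transformed by the Hamiltonian solving the homological equation, then the commutation relations
are restored at higher order. -/
theorem exists_compatible_step (hS : S.IsDifferential) (hc : IsCoordinateSystem ev z)
    (cd : ClassicalData S z h) (hex : S.ClosedIsExact z) {Q : Prop}
    (hQ : Q → S.IsHermitian ∧ ∀ i, IsRealSeries (H i)) (hH0 : ∀ i, PowerSeries.coeff 0 (H i) = h i)
    (hH : ∀ i j, S.comm (H i) (H j) = 0) {n : ℕ} (hZ : S.Darboux (matJ m) Z)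
    (hZ0 : ∀ a, PowerSeries.coeff 0 (Z a) = z a) (hZr : Q → ∀ a, IsRealSeries (Z a))
    (hHN : ∀ i j, ∀ k < n + 2, PowerSeries.coeff k (S.comm (H i) (S.number Z j)) = 0) :
    ∃ Z' : Fin m ⊕ Fin m → A⟦X⟧, S.Darboux (matJ m) Z' ∧ (Q → ∀ a, IsRealSeries (Z' a)) ∧
      (∀ i j, ∀ k < n + 3, PowerSeries.coeff k (S.comm (H i) (S.number Z' j)) = 0) ∧
      ∀ a, ∀ k < n + 1, PowerSeries.coeff k (Z' a) = PowerSeries.coeff k (Z a) := by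
  have h0 : ∀ F : A⟦X⟧, ∀ k < 0, PowerSeries.coeff k F = 0 := fun F k hk => absurd hk (by omega)
  choose g hg using fun i => hZ.exists_coeff_comm hS hc hZ0 (n + 1) (H i) (hHN i)
  -- Jacobi identity for `H l`, `H i` and the number symbols
  have hgc : ∀ c l i, S.bracket (action z c)
      (S.bracket (h l) (g i) - S.bracket (h i) (g l)) = 0 := by
    intro c l i
    have h1 : ∀ l i, PowerSeries.coeff (n + 3) (S.comm (H l) (S.comm (H i) (S.number Z c))) =
        Complex.I • Complex.I • S.bracket (h l) (S.bracket (g i) (action z c)) := by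
      intro l i
      have := (S.coeff_comm_lead (h0 (H l)) (hHN i c)).2
      rw [hg, hH0, map_smul] at this
      rw [← this]; congr 2; omega
    have h2 : S.comm (H l) (S.comm (H i) (S.number Z c)) =
        S.comm (H i) (S.comm (H l) (S.number Z c)) := by
      rw [S.comm_jacobi, hH, map_zero, LinearMap.zero_apply, zero_add]
    have h3 := h1 l i
    rw [h2, h1] at h3
    have h4 := smul_right_injective A Complex.I_ne_zero
      (smul_right_injective A Complex.I_ne_zero h3)
    rw [S.bracket_jacobi (h i), cd.bracket_h_action, map_zero, add_zero,
      S.bracket_jacobi (h l), cd.bracket_h_action, map_zero, add_zero] at h4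
    rw [S.skew, map_sub, LinearMap.sub_apply, h4, sub_self, neg_zero]
  obtain ⟨w, hw⟩ := cd.exists_generator g hgc
  obtain ⟨w, hw, hwr⟩ := exists_selfAdjoint_solution (Q := Q)
    (fun i : Fin m × Fin m => (S.bracket (h i.1)) ∘ₗ (S.bracket.flip (action z i.2)))
    (fun i => -S.bracket (g i.1) (action z i.2))
    (fun q i f => by
      have e1 : star (h i.1) = h i.1 := by rw [← hH0]; exact ((hQ q).2 _).coeff 0
      have e2 : star (action z i.2) = action z i.2 := by
        rw [← coeff_zero_number (S := S) hZ0]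
        exact ((hQ q).1.isRealSeries_number (hZr q) _).coeff 0
      simp only [LinearMap.comp_apply, LinearMap.flip_apply, (hQ q).1.star_bracket, e1, e2])
    (fun q i => by
      have e : -S.bracket (g i.1) (action z i.2) =
          Complex.I • PowerSeries.coeff (n + 2) (S.comm (H i.1) (S.number Z i.2)) := by
        rw [hg, smul_smul, Complex.I_mul_I, neg_one_smul]
      rw [e, star_smul, (hQ q).1.star_coeff_comm ((hQ q).2 _)
        ((hQ q).1.isRealSeries_number (hZr q) _)]
      simp) ⟨w, fun i => hw i.1 i.2⟩
  replace hw : ∀ i j, S.bracket (h i) (S.bracket w (action z j)) =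
      -S.bracket (g i) (action z j) := fun i j => hw (i, j)
  obtain ⟨Z', hZ', hZr', hag⟩ := exists_darboux (n := n + 1) (J := matJ m) (z := z) hex
    (fun q => (hQ q).1) (Z := fun a => Z a + PowerSeries.monomial (n + 1) (S.bracket w (z a)))
    (fun a => by rw [map_add, PowerSeries.coeff_monomial, if_neg (by omega), add_zero, hZ0])
    (fun a b k hk => by
      obtain ⟨h1, h2⟩ := S.coeff_comm_perturb (n := n) (Z a) (Z b) (S.bracket w (z a))
        (S.bracket w (z b))
      rcases Nat.lt_or_ge k (n + 2) with hk' | hk'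
      · rw [h1 k hk', hZ a b]
      · obtain rfl : k = n + 2 := by omega
        have h3 := S.bracket_jacobi w (z a) (z b)
        rw [cd.darboux, bracket_algebraMap] at h3
        rw [h2, hZ0, hZ0, add_comm (S.bracket (z a) _), ← h3, smul_zero, add_zero, hZ a b])
    (fun q a => isRealSeries_add_monomial (hZr q a) (by
      rw [(hQ q).1.star_bracket, hwr q, ← hZ0, (hZr q a).coeff]))
  have hlow : ∀ a, ∀ k < n + 1, PowerSeries.coeff k (Z' a - Z a) = 0 := fun a k hk => by
    rw [map_sub, hag a k (by omega), map_add, PowerSeries.coeff_monomial, if_neg (by omega),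
      add_zero, sub_self]
  have hlead : ∀ a, PowerSeries.coeff (n + 1) (Z' a - Z a) = S.bracket w (z a) := fun a => by
    rw [map_sub, hag a _ (by omega), map_add, PowerSeries.coeff_monomial_same, add_sub_cancel_left]
  refine ⟨Z', hZ', hZr', fun i j => ?_, fun a k hk => by
    have := hlow a k hk
    rwa [map_sub, sub_eq_zero] at this⟩
  -- the number symbols change by `ħ^(n + 1) {w, I}`
  have hN : S.number Z' j = S.number Z j + (S.mul (creat (fun a => Z' a - Z a) j) (annih Z' j) +
      S.mul (creat Z j) (annih (fun a => Z' a - Z a) j)) := by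
    have e1 : annih (fun a => Z' a - Z a) j = annih Z' j - annih Z j := by
      simp only [annih, ← smul_sub]; congr 1; rw [smul_sub]; abel
    have e2 : creat (fun a => Z' a - Z a) j = creat Z' j - creat Z j := by
      simp only [creat, ← smul_sub]; congr 1; rw [smul_sub]; abel
    rw [e1, e2, number, number, map_sub, map_sub, LinearMap.sub_apply]; abel
  have hZ0' : ∀ a, PowerSeries.coeff 0 (Z' a) = z a := fun a => by
    have := hlow a 0 (by omega)
    rwa [map_sub, sub_eq_zero, hZ0] at this
  obtain ⟨b1, b2⟩ := S.coeff_mul_lead (n := n + 1) (l := 0) (F := creat (fun a => Z' a - Z a) j)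
    (G := annih Z' j) (fun k hk => by rw [coeff_creat]; simp [hlow _ k hk, creat]) (h0 _)
  obtain ⟨a1, a2⟩ := S.coeff_mul_lead (n := 0) (l := n + 1) (F := creat Z j)
    (G := annih (fun a => Z' a - Z a) j) (h0 _)
    (fun k hk => by rw [coeff_annih]; simp [hlow _ k hk, annih])
  rw [Nat.zero_add] at a1 a2
  rw [Nat.add_zero] at b1 b2
  have hD0 : ∀ k < n + 1, PowerSeries.coeff k (S.mul (creat (fun a => Z' a - Z a) j) (annih Z' j) +
      S.mul (creat Z j) (annih (fun a => Z' a - Z a) j)) = 0 := fun k hk => by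
    rw [map_add, a1 k hk, b1 k hk, add_zero]
  have hD1 : PowerSeries.coeff (n + 1) (S.mul (creat (fun a => Z' a - Z a) j) (annih Z' j) +
      S.mul (creat Z j) (annih (fun a => Z' a - Z a) j)) = S.bracket w (action z j) := by
    rw [map_add, a2, b2, coeff_annih, coeff_annih, coeff_creat, coeff_creat]
    simp only [hlead, hZ0, hZ0']
    rw [action, S.leibniz]
    simp only [annih, creat, map_smul, map_add, map_sub]
  obtain ⟨c1, c2⟩ := S.coeff_comm_lead (h0 (H i)) hD0
  intro k hk
  rw [hN, map_add, map_add]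
  rcases Nat.lt_or_ge k (n + 2) with hk' | hk'
  · rw [hHN i j k hk', c1 k (by omega), add_zero]
  · obtain rfl : k = n + 2 := by omega
    rw [hg, show n + 2 = 0 + (n + 1) + 1 by omega, c2, hD1, hH0, hw, smul_neg, add_neg_cancel]

/-- Formal version of the normal form theorem. The proposition `Q` says whether real symbols are
wanted. -/
theorem exists_compatible (hS : S.IsDifferential) (hc : IsCoordinateSystem ev z)
    (cd : ClassicalData S z h) (hex : S.ClosedIsExact z) {Q : Prop}
    (hQ : Q → S.IsHermitian ∧ ∀ i, IsRealSeries (H i)) (hzr : ∀ a, star (z a) = z a)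
    (hH0 : ∀ i, PowerSeries.coeff 0 (H i) = h i) (hH : ∀ i j, S.comm (H i) (H j) = 0) :
    ∃ Z : Fin m ⊕ Fin m → A⟦X⟧, (∀ a, PowerSeries.coeff 0 (Z a) = z a) ∧ S.Darboux (matJ m) Z ∧
      (∀ i j, S.comm (H i) (S.number Z j) = 0) ∧ (Q → ∀ a, IsRealSeries (Z a)) := by
  have hm0 : ∀ a, PowerSeries.coeff 0 (PowerSeries.monomial 0 (z a)) = z a := fun a =>
    PowerSeries.coeff_monomial_same _ _
  obtain ⟨Y, hY, hYr, hY0⟩ := exists_darboux (n := 0) (J := matJ m) hex (fun q => (hQ q).1)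
    (Z := fun a => PowerSeries.monomial 0 (z a)) hm0
    (fun a b k hk => by
      rcases k with _ | k
      · rw [coeff_zero_comm, PowerSeries.coeff_monomial, if_neg (by omega)]
      · obtain rfl : k = 0 := by omega
        rw [zero_add, coeff_one_comm, hm0, hm0, cd.darboux, PowerSeries.coeff_monomial_same,
          map_mul, Algebra.smul_def])
    (fun q a => by
      have := isRealSeries_add_monomial (n := 0) (F := (0 : A⟦X⟧)) (by
        ext n; simp) (hzr a)
      rwa [zero_add] at this)
  replace hY0 : ∀ a, PowerSeries.coeff 0 (Y a) = z a := fun a => by rw [hY0 a 0 (by omega), hm0]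
  obtain ⟨Z, hZ⟩ := exists_limit (Y₀ := Y)
    (fun n Z => S.Darboux (matJ m) Z ∧ (∀ a, PowerSeries.coeff 0 (Z a) = z a) ∧
      (Q → ∀ a, IsRealSeries (Z a)) ∧
      ∀ i j, ∀ k < n + 2, PowerSeries.coeff k (S.comm (H i) (S.number Z j)) = 0)
    ⟨hY, hY0, hYr, fun i j k hk => by
      rcases k with _ | k
      · rw [coeff_zero_comm]
      · obtain rfl : k = 0 := by omega
        rw [zero_add, coeff_one_comm, hH0, coeff_zero_number hY0, cd.bracket_h_action, smul_zero]⟩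
    (fun n Z hZ => by
      obtain ⟨Z', h1, h2, h3, h4⟩ := exists_compatible_step hS hc cd hex hQ hH0 hH hZ.1 hZ.2.1
        hZ.2.2.1 hZ.2.2.2
      exact ⟨Z', ⟨h1, fun a => by rw [h4 a 0 (by omega), hZ.2.1], h2, h3⟩, h4⟩)
  refine ⟨Z, fun a => ?_, fun a b => ?_, fun i j => ?_, fun q a => ?_⟩
  · obtain ⟨Z', h1, h2⟩ := hZ 0
    rw [h2 a 0 (by omega), h1.2.1]
  · ext k
    obtain ⟨Z', h1, h2⟩ := hZ k
    rw [← h1.1 a b]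
    exact S.coeff_comm_congr (h2 a) (h2 b)
  · ext k
    obtain ⟨Z', h1, h2⟩ := hZ k
    rw [map_zero, ← h1.2.2.2 i j k (by omega)]
    refine S.coeff_comm_congr (fun _ _ => rfl) fun l hl => ?_
    have h2' : ∀ a, ∀ k < l + 1, PowerSeries.coeff k (Z a) = PowerSeries.coeff k (Z' a) :=
      fun a k hk => h2 a k (by omega)
    refine S.coeff_mul_congr (fun k hk => ?_) fun k hk => ?_
    · rw [coeff_creat, coeff_creat]; simp only [h2' _ k hk]
    · rw [coeff_annih, coeff_annih]; simp only [h2' _ k hk]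
  · ext k
    obtain ⟨Z', h1, h2⟩ := hZ k
    rw [coeff_conjSeries, h2 a k (by omega), (h1.2.2.1 q a).coeff]

end Real

end FormalStar

end

/-! ### Smooth dependence of integrals on parameters -/

section

section Parametric

open MeasureTheory Set

variable {E G : Type} [NormedAddCommGroup E] [NormedSpace ℝ E]
  [NormedAddCommGroup G] [NormedSpace ℝ G] {U : Set E} {a b : ℝ}

theorem continuousOn_slice {F : E × ℝ → G} {x : E}
    (hF : ∀ t ∈ uIcc a b, ContDiffAt ℝ ∞ F (x, t)) :
    ContinuousOn (fun t => F (x, t)) (uIcc a b) := fun t ht =>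
  ((hF t ht).continuousAt.comp (f := fun t : ℝ => (x, t)) (by fun_prop)).continuousWithinAt

theorem contDiffAt_fderiv_inl {F : E × ℝ → G} {y : E × ℝ} (hF : ContDiffAt ℝ ∞ F y) :
    ContDiffAt ℝ ∞ (fun y => (fderiv ℝ F y).comp (ContinuousLinearMap.inl ℝ E ℝ)) y :=
  (hF.fderiv_right (m := ∞) le_rfl).clm_comp contDiffAt_const

theorem hasFDerivAt_parametric_integral [FiniteDimensional ℝ E] {F : E × ℝ → G} (hU : IsOpen U)
    (hF : ∀ x ∈ U, ∀ t ∈ uIcc a b, ContDiffAt ℝ ∞ F (x, t)) {x : E} (hx : x ∈ U) :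
    HasFDerivAt (fun x => ∫ t in a..b, F (x, t))
      (∫ t in a..b, (fderiv ℝ F (x, t)).comp (ContinuousLinearMap.inl ℝ E ℝ)) x := by
  obtain ⟨ε, hε, hball⟩ := Metric.isOpen_iff.1 hU x hx
  have hsub : Metric.closedBall x (ε / 2) ⊆ U :=
    (Metric.closedBall_subset_ball (by linarith)).trans hball
  have : ProperSpace E := FiniteDimensional.proper ℝ E
  obtain ⟨K, hK⟩ := ((isCompact_closedBall x (ε / 2)).prod
    (isCompact_uIcc (a := a) (b := b))).exists_bound_of_continuousOn
    (f := fun y => (fderiv ℝ F y).comp (ContinuousLinearMap.inl ℝ E ℝ))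
    (fun y hy => (contDiffAt_fderiv_inl
      (hF y.1 (hsub hy.1) y.2 hy.2)).continuousAt.continuousWithinAt)
  have hmeas : ∀ {H : Type} [NormedAddCommGroup H] {φ : ℝ → H}, ContinuousOn φ (uIcc a b) →
      AEStronglyMeasurable φ (volume.restrict (uIoc a b)) := fun hφ =>
    hφ.aestronglyMeasurable_of_subset_isCompact isCompact_uIcc
      measurableSet_uIoc uIoc_subset_uIcc
  refine intervalIntegral.hasFDerivAt_integral_of_dominated_of_fderiv_le
    (F' := fun x t => (fderiv ℝ F (x, t)).comp (ContinuousLinearMap.inl ℝ E ℝ))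
    (bound := fun _ => K) (s := Metric.ball x (ε / 2)) (Metric.ball_mem_nhds x (by linarith))
    ?_ ?_ ?_ ?_ ?_ ?_
  · filter_upwards [hU.mem_nhds hx] with y hy
    exact hmeas (continuousOn_slice (hF y hy))
  · exact (continuousOn_slice (hF x hx)).intervalIntegrable
  · exact hmeas (continuousOn_slice fun t ht => contDiffAt_fderiv_inl (hF x hx t ht))
  · exact Filter.Eventually.of_forall fun t ht y hy =>
      hK (y, t) ⟨Metric.ball_subset_closedBall hy, uIoc_subset_uIcc ht⟩
  · simp
  · refine Filter.Eventually.of_forall fun t ht y hy => ?_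
    have h1 : HasFDerivAt F (fderiv ℝ F (y, t)) (y, t) :=
      ((hF y (hsub (Metric.ball_subset_closedBall hy)) t
        (uIoc_subset_uIcc ht)).differentiableAt (by simp)).hasFDerivAt
    exact h1.comp y (hasFDerivAt_prodMk_left y t)

theorem contDiffOn_parametric_integral [FiniteDimensional ℝ E] {F : E × ℝ → G} (hU : IsOpen U)
    (hF : ∀ x ∈ U, ∀ t ∈ uIcc a b, ContDiffAt ℝ ∞ F (x, t)) :
    ContDiffOn ℝ ∞ (fun x => ∫ t in a..b, F (x, t)) U := by
  rw [contDiffOn_infty]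
  intro n
  induction n generalizing G with
  | zero =>
    exact contDiffOn_zero.2 fun x hx =>
      (hasFDerivAt_parametric_integral hU hF hx).continuousAt.continuousWithinAt
  | succ n ih =>
    rw [Nat.cast_succ, contDiffOn_succ_iff_fderiv_of_isOpen hU]
    refine ⟨fun x hx =>
      (hasFDerivAt_parametric_integral hU hF hx).differentiableAt.differentiableWithinAt,
      fun h => absurd h (by simp), ?_⟩
    exact (ih fun x hx t ht => contDiffAt_fderiv_inl (hF x hx t ht)).congr fun x hx =>
      (hasFDerivAt_parametric_integral hU hF hx).fderiv

/-- Hadamard's lemma near a point. -/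
theorem exists_hadamard_ball [FiniteDimensional ℝ E] [CompleteSpace G] {F : E → G} {x₀ : E} {r : ℝ}
    (hF : ContDiffOn ℝ ∞ F (Metric.ball x₀ r)) :
    ∃ g : E → E →L[ℝ] G, ContDiffOn ℝ ∞ g (Metric.ball x₀ r) ∧
      (∀ x ∈ Metric.ball x₀ r, F x - F x₀ = g x (x - x₀)) ∧ g x₀ = fderiv ℝ F x₀ := by
  let γ : E × ℝ → E := fun y => x₀ + y.2 • (y.1 - x₀)
  have hγ : ∀ x ∈ Metric.ball x₀ r, ∀ t ∈ uIcc (0 : ℝ) 1, γ (x, t) ∈ Metric.ball x₀ r := by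
    intro x hx t ht
    rw [uIcc_of_le zero_le_one] at ht
    rw [mem_ball_iff_norm] at hx ⊢
    simp only [γ, add_sub_cancel_left, norm_smul, Real.norm_eq_abs, abs_of_nonneg ht.1]
    nlinarith [norm_nonneg (x - x₀), ht.2]
  have hFat : ∀ x ∈ Metric.ball x₀ r, ContDiffAt ℝ ∞ F x := fun x hx =>
    hF.contDiffAt (Metric.isOpen_ball.mem_nhds hx)
  have hdF : ∀ x ∈ Metric.ball x₀ r, ∀ t ∈ uIcc (0 : ℝ) 1,
      ContDiffAt ℝ ∞ (fun y => fderiv ℝ F (γ y)) (x, t) := fun x hx t ht =>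
    ((hFat _ (hγ x hx t ht)).fderiv_right (m := ∞) le_rfl).comp (x, t) (by fun_prop)
  refine ⟨fun x => ∫ t in (0 : ℝ)..1, fderiv ℝ F (γ (x, t)),
    contDiffOn_parametric_integral Metric.isOpen_ball hdF, fun x hx => ?_, ?_⟩
  · have hint : IntervalIntegrable (fun t => fderiv ℝ F (γ (x, t))) volume 0 1 :=
      (continuousOn_slice (hdF x hx)).intervalIntegrable
    rw [ContinuousLinearMap.intervalIntegral_apply hint]
    have hd : ∀ t ∈ uIcc (0 : ℝ) 1,
        HasDerivAt (fun t => F (γ (x, t))) (fderiv ℝ F (γ (x, t)) (x - x₀)) t := by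
      intro t ht
      refine (((hFat _ (hγ x hx t ht)).differentiableAt (by simp)).hasFDerivAt).comp_hasDerivAt t ?_
      have h := ((hasDerivAt_id t).smul_const (x - x₀)).const_add x₀
      rw [one_smul] at h
      exact h
    rw [intervalIntegral.integral_eq_sub_of_hasDerivAt hd]
    · simp [γ]
    · exact ((continuousOn_slice (hdF x hx)).clm_apply continuousOn_const).intervalIntegrable
  · simp [γ]

end Parametric

/-- Hadamard's lemma on an open set of `ℝ^σ`: functions vanishing at a point are combinations of the
coordinate functions, with coefficients that are smooth on the whole open set. -/
theorem exists_hadamard {σ : Type} [Fintype σ] {U : Set (σ → ℝ)} (hU : IsOpen U) {F : (σ → ℝ) → ℂ}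
    (hF : ContDiffOn ℝ ∞ F U) {x₀ : σ → ℝ} (hx₀ : x₀ ∈ U) :
    ∃ g : σ → (σ → ℝ) → ℂ, (∀ a, ContDiffOn ℝ ∞ (g a) U) ∧
      ∀ x ∈ U, F x - F x₀ = ∑ a, ((x a - x₀ a : ℝ) : ℂ) * g a x := by
  classical
  obtain ⟨r, hr, hball⟩ := Metric.isOpen_iff.1 hU x₀ hx₀
  obtain ⟨g, hg, hgF, -⟩ := exists_hadamard_ball (hF.mono hball)
  let χ : ContDiffBump x₀ := ⟨r / 3, r / 2, by linarith, by linarith⟩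
  let Q : (σ → ℝ) → ℝ := fun x => ∑ b, (x b - x₀ b) ^ 2
  have hQ : ∀ x, x ≠ x₀ → Q x ≠ 0 := by
    intro x hx h
    refine hx (funext fun b => ?_)
    have := (Finset.sum_eq_zero_iff_of_nonneg (fun b _ => sq_nonneg (x b - x₀ b))).1 h b
      (Finset.mem_univ b)
    exact sub_eq_zero.1 (pow_eq_zero_iff (two_ne_zero) |>.1 this)
  have hQs : ContDiff ℝ ∞ Q := by fun_prop
  have hexp : ∀ x ∈ Metric.ball x₀ r, F x - F x₀ =
      ∑ a, ((x a - x₀ a : ℝ) : ℂ) * g x (Pi.single a 1) := by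
    intro x hx
    rw [hgF x hx, ← (g x).coe_coe, LinearMap.pi_apply_eq_sum_univ]
    refine Finset.sum_congr rfl fun a _ => ?_
    rw [Complex.real_smul]
    congr 2
    ext b
    simp [Pi.single_apply, eq_comm]
  refine ⟨fun a x => (χ x : ℂ) * g x (Pi.single a 1) +
    ((1 - χ x : ℝ) : ℂ) * (((x a - x₀ a) / Q x : ℝ) : ℂ) * (F x - F x₀), fun a x hx => ?_,
    fun x hx => ?_⟩
  · have hχ : ContDiff ℝ ∞ (fun x => (χ x : ℂ)) := Complex.ofRealCLM.contDiff.comp χ.contDiff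
    refine ContDiffAt.contDiffWithinAt (ContDiffAt.add ?_ ?_)
    · by_cases hxb : x ∈ Metric.ball x₀ r
      · exact hχ.contDiffAt.mul
          ((hg.contDiffAt (Metric.isOpen_ball.mem_nhds hxb)).clm_apply contDiffAt_const)
      · refine (contDiffAt_const (c := (0 : ℂ))).congr_of_eventuallyEq ?_
        have : x ∈ (Metric.closedBall x₀ (r / 2))ᶜ := by
          simp only [Set.mem_compl_iff, Metric.mem_closedBall, Metric.mem_ball] at hxb ⊢
          linarith
        filter_upwards [Metric.isClosed_closedBall.isOpen_compl.mem_nhds this] with y hy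
        rw [χ.zero_of_le_dist (by
          simp only [Set.mem_compl_iff, Metric.mem_closedBall, not_le] at hy
          exact hy.le)]
        simp
    · by_cases hxx : x = x₀
      · subst hxx
        refine (contDiffAt_const (c := (0 : ℂ))).congr_of_eventuallyEq ?_
        filter_upwards [χ.eventuallyEq_one] with y hy
        rw [hy]; simp
      · have h1 : ContDiffAt ℝ ∞ (fun x => (((x a - x₀ a) / Q x : ℝ) : ℂ)) x :=
          Complex.ofRealCLM.contDiff.contDiffAt.comp x
            (ContDiffAt.div (by fun_prop) hQs.contDiffAt (hQ x hxx))
        have h2 : ContDiffAt ℝ ∞ (fun x => ((1 - χ x : ℝ) : ℂ)) x :=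
          Complex.ofRealCLM.contDiff.contDiffAt.comp x
            (contDiffAt_const.sub χ.contDiff.contDiffAt)
        exact (h2.mul h1).mul ((hF.contDiffAt (hU.mem_nhds hx)).sub contDiffAt_const)
  · have e1 : (χ x : ℂ) * (F x - F x₀) =
        ∑ a, ((x a - x₀ a : ℝ) : ℂ) * ((χ x : ℂ) * g x (Pi.single a 1)) := by
      by_cases hxb : x ∈ Metric.ball x₀ r
      · rw [hexp x hxb, Finset.mul_sum]
        exact Finset.sum_congr rfl fun a _ => by ring
      · rw [χ.zero_of_le_dist (by
          simp only [Metric.mem_ball, not_lt] at hxb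
          change r / 2 ≤ _
          linarith)]
        simp
    have e2 : ((1 - χ x : ℝ) : ℂ) * (F x - F x₀) = ∑ a, ((x a - x₀ a : ℝ) : ℂ) *
        (((1 - χ x : ℝ) : ℂ) * (((x a - x₀ a) / Q x : ℝ) : ℂ) * (F x - F x₀)) := by
      by_cases hxx : x = x₀
      · subst hxx; simp
      · have : ∑ a, ((x a - x₀ a : ℝ) : ℂ) * (((x a - x₀ a) / Q x : ℝ) : ℂ) = 1 := by
          rw [← Complex.ofReal_one, ← div_self (hQ x hxx)]
          simp only [← Complex.ofReal_mul, ← Complex.ofReal_sum]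
          congr 1
          simp only [Q, Finset.sum_div]
          exact Finset.sum_congr rfl fun a _ => by ring
        calc _ = (∑ a, ((x a - x₀ a : ℝ) : ℂ) * (((x a - x₀ a) / Q x : ℝ) : ℂ)) *
              (((1 - χ x : ℝ) : ℂ) * (F x - F x₀)) := by rw [this, one_mul]
          _ = _ := by
            rw [Finset.sum_mul]
            exact Finset.sum_congr rfl fun a _ => by ring
    simp only [mul_add, Finset.sum_add_distrib]
    rw [← e1, ← e2]
    push_cast
    ring

end

/-! ### Smooth functions and their derivations -/

section

open Filter Topology

section Manifold

variable {m : ℕ} {𝓜 : Type*} [TopologicalSpace 𝓜]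
  [ChartedSpace (EuclideanSpace ℝ (Fin (2 * m))) 𝓜]

instance : StarRing (Smooth m 𝓜) where
  star := conjFun
  star_involutive _ := Subtype.ext (funext fun _ => Complex.conj_conj _)
  star_mul f g := Subtype.ext (funext fun p =>
    (map_mul (starRingEnd ℂ) (f.1 p) (g.1 p)).trans (mul_comm _ _))
  star_add f g := Subtype.ext (funext fun p => map_add (starRingEnd ℂ) (f.1 p) (g.1 p))

instance : StarModule ℂ (Smooth m 𝓜) where
  star_smul c f := Subtype.ext (funext fun p => map_mul (starRingEnd ℂ) c (f.1 p))

theorem Smooth.contMDiff (f : Smooth m 𝓜) : ContMDiff (𝓡 (2 * m)) 𝓘(ℝ, ℂ) ∞ f.1 := f.2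

/-- Evaluation at a point, as a character of the algebra of smooth functions. -/
def evalHom (p : 𝓜) : Smooth m 𝓜 →ₐ[ℂ] ℂ :=
  (Pi.evalAlgHom ℂ (fun _ : 𝓜 => ℂ) p).comp (smoothAlg m 𝓜).val

theorem evalHom_apply (p : 𝓜) (f : Smooth m 𝓜) : evalHom p f = f.1 p := rfl

theorem Smooth.ext_evalHom {f g : Smooth m 𝓜} (h : ∀ p, evalHom p f = evalHom p g) : f = g :=
  Subtype.ext (funext h)

variable [IsManifold (𝓡 (2 * m)) ∞ 𝓜]

/-- A map on the manifold, read in the preferred chart at `p`. -/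
def inChart (p : 𝓜) {V : Type*} (f : 𝓜 → V) : EuclideanSpace ℝ (Fin (2 * m)) → V :=
  f ∘ (extChartAt (𝓡 (2 * m)) p).symm

theorem contDiffOn_inChart {V : Type*} [NormedAddCommGroup V] [NormedSpace ℝ V] (p : 𝓜) {f : 𝓜 → V}
    (hf : ContMDiff (𝓡 (2 * m)) 𝓘(ℝ, V) ∞ f) :
    ContDiffOn ℝ ∞ (inChart p f) (extChartAt (𝓡 (2 * m)) p).target := by
  rw [← contMDiffOn_iff_contDiffOn]
  exact hf.comp_contMDiffOn (contMDiffOn_extChartAt_symm p)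

theorem contDiffAt_inChart {V : Type*} [NormedAddCommGroup V] [NormedSpace ℝ V] (p : 𝓜) {f : 𝓜 → V}
    (hf : ContMDiff (𝓡 (2 * m)) 𝓘(ℝ, V) ∞ f) :
    ContDiffAt ℝ ∞ (inChart p f) (extChartAt (𝓡 (2 * m)) p p) :=
  (contDiffOn_inChart p hf).contDiffAt ((isOpen_extChartAt_target p).mem_nhds
    (mem_extChartAt_target p))

variable [T2Space 𝓜]

/-- Derivations are of first order: they kill functions whose differential vanishes, since by
Hadamard's lemma such a function is, up to a constant and near the point, a sum of products of
functions vanishing at the point. -/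
theorem derivation_apply_eq_zero (D : Derivation ℂ (Smooth m 𝓜) (Smooth m 𝓜)) (f : Smooth m 𝓜)
    (p : 𝓜) (hf : fderiv ℝ (inChart p f.1) (extChartAt (𝓡 (2 * m)) p p) = 0) :
    evalHom p (D f) = 0 := by
  set e := extChartAt (𝓡 (2 * m)) p with he
  set x₀ := e p with hx₀
  obtain ⟨r, hr, hball⟩ := Metric.isOpen_iff.1 (isOpen_extChartAt_target (I := 𝓡 (2 * m)) p) x₀
    (mem_extChartAt_target p)
  obtain ⟨g, hg, hgF, hg0⟩ := exists_hadamard_ball ((contDiffOn_inChart p f.contMDiff).mono hball)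
  have hs : e.source ∩ e ⁻¹' Metric.ball x₀ r ∈ 𝓝 p :=
    inter_mem (extChartAt_source_mem_nhds p)
      ((continuousAt_extChartAt p).preimage_mem_nhds (Metric.ball_mem_nhds x₀ hr))
  obtain ⟨ρ, -, hρ⟩ := (SmoothBumpFunction.nhds_basis_tsupport (I := 𝓡 (2 * m)) p).mem_iff.1 hs
  have hρ0 : ∀ q, q ∉ e.source ∩ e ⁻¹' Metric.ball x₀ r → ρ q = 0 := fun q hq =>
    image_eq_zero_of_notMem_tsupport fun h => hq (hρ h)
  have hρp : ρ p = 1 := ρ.eq_one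
  have hρs : ContMDiff (𝓡 (2 * m)) 𝓘(ℝ, ℂ) ∞ fun q => (ρ q : ℂ) :=
    Complex.ofRealCLM.contDiff.contMDiff.comp ρ.contMDiff
  -- functions on the ball, cut off by `ρ`, are smooth functions on the manifold
  have hcut : ∀ k : EuclideanSpace ℝ (Fin (2 * m)) → ℂ, ContDiffOn ℝ ∞ k (Metric.ball x₀ r) →
      ∃ K : Smooth m 𝓜, ∀ q, K.1 q = (ρ q : ℂ) * k (e q) := by
    intro k hk
    refine ⟨⟨fun q => (ρ q : ℂ) * k (e q), contMDiff_of_tsupport fun q hq => ?_⟩, fun _ => rfl⟩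
    have hq' : q ∈ tsupport ρ := by
      refine closure_mono (fun y hy => ?_) hq
      intro h
      exact hy (by simp only [h]; simp)
    obtain ⟨hq1, hq2⟩ := hρ hq'
    have h1 : ContMDiffAt (𝓡 (2 * m)) 𝓘(ℝ, ℂ) ∞ (fun q => k (e q)) q :=
      ((hk.contDiffAt (Metric.isOpen_ball.mem_nhds hq2)).contMDiffAt).comp q
        (contMDiffAt_extChartAt' (by rwa [he, extChartAt_source] at hq1))
    exact (contDiff_mul (𝕜 := ℝ) (𝔸 := ℂ) (n := ∞)).contMDiff.contMDiffAt.comp q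
      (ContMDiffAt.prodMk_space hρs.contMDiffAt h1)
  choose X hX using fun a : Fin (2 * m) =>
    hcut (fun x => ((x a - x₀ a : ℝ) : ℂ))
      (Complex.ofRealCLM.contDiff.comp_contDiffOn
        (by fun_prop : ContDiffOn ℝ ∞ (fun x => x a - x₀ a) (Metric.ball x₀ r)))
  choose Y hY using fun a : Fin (2 * m) =>
    hcut (fun x => g x (EuclideanSpace.single a 1)) (hg.clm_apply contDiffOn_const)
  let B : Smooth m 𝓜 := ⟨fun q => (ρ q : ℂ), hρs⟩
  have hexp : f = algebraMap ℂ _ (evalHom p f) + ((1 - B * B) * (f - algebraMap ℂ _ (evalHom p f)) +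
      ∑ a, X a * Y a) := by
    refine Smooth.ext_evalHom fun q => ?_
    have h : B.1 q * B.1 q * (f.1 q - f.1 p) = ∑ a, evalHom q (X a * Y a) := by
      have hXY : ∀ a, evalHom q (X a * Y a) =
        (ρ q : ℂ) * (ρ q : ℂ) *
          (((e q a - x₀ a : ℝ) : ℂ) * g (e q) (EuclideanSpace.single a 1)) := by
        intro a
        rw [map_mul, evalHom_apply, evalHom_apply, hX, hY]; ring
      simp only [hXY]
      rw [← Finset.mul_sum]
      by_cases hq : q ∈ e.source ∩ e ⁻¹' Metric.ball x₀ r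
      · have h1 := hgF (e q) hq.2
        simp only [inChart, Function.comp_apply] at h1
        rw [← he, e.left_inv hq.1, hx₀, e.left_inv (mem_extChartAt_source p)] at h1
        rw [h1, ← hx₀]
        congr 1
        have h2 : e q - x₀ = ∑ a, (e q a - x₀ a) • EuclideanSpace.single a (1 : ℝ) := by
          ext b
          simp [Finset.sum_apply, Pi.single_apply]
        conv_lhs => rw [h2]
        rw [map_sum]
        exact Finset.sum_congr rfl fun a _ => by rw [map_smul, Complex.real_smul]
      · change (ρ q : ℂ) * (ρ q : ℂ) * _ = _
        rw [hρ0 q hq]; simp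
    simp only [map_add, map_mul, map_sub, map_one, AlgHom.commutes, map_sum] at h ⊢
    rw [← h]
    change f.1 q = f.1 p + ((1 - B.1 q * B.1 q) * (f.1 q - f.1 p) + _)
    ring
  rw [hexp, map_add, map_add, Derivation.map_algebraMap, map_zero, zero_add, map_add, map_sum,
    map_add, map_sum,
    Derivation.leibniz]
  have hB : evalHom p (1 - B * B) = 0 := by
    rw [map_sub, map_one, map_mul, evalHom_apply]
    change 1 - (ρ p : ℂ) * (ρ p : ℂ) = 0
    rw [hρp]; simp
  have hXp : ∀ a, evalHom p (X a) = 0 := fun a => by rw [evalHom_apply, hX]; simp [hx₀]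
  have hYp : ∀ a, evalHom p (Y a) = 0 := fun a => by
    rw [evalHom_apply, hY, ← hx₀, hg0, hf]; simp
  have hfp : evalHom p (f - algebraMap ℂ _ (evalHom p f)) = 0 := by
    rw [map_sub, AlgHom.commutes]; exact sub_self _
  rw [map_add, smul_eq_mul, smul_eq_mul, map_mul, map_mul, hB, hfp, zero_mul, zero_mul, zero_add,
    zero_add]
  refine Finset.sum_eq_zero fun a _ => ?_
  rw [Derivation.leibniz, map_add, smul_eq_mul, smul_eq_mul, map_mul, map_mul, hXp, hYp, zero_mul,
    zero_mul, zero_add]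

/-- The chain rule for derivations. -/
theorem derivation_chain_rule {κ : Type*} [Fintype κ] [DecidableEq κ]
    (D : Derivation ℂ (Smooth m 𝓜) (Smooth m 𝓜))
    (y : 𝓜 → κ → ℝ) (Y : κ → Smooth m 𝓜) (hY : ∀ k p, (Y k).1 p = (y p k : ℂ))
    (φ : (κ → ℝ) → ℂ) (f : Smooth m 𝓜) (hf : ∀ p, f.1 p = φ (y p)) (p : 𝓜)
    (hφ : DifferentiableAt ℝ φ (y p)) :
    evalHom p (D f) = ∑ k, fderiv ℝ φ (y p) (Pi.single k 1) * evalHom p (D (Y k)) := by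
  have hy : ContMDiff (𝓡 (2 * m)) 𝓘(ℝ, κ → ℝ) ∞ y := by
    rw [contMDiff_pi_space]
    intro k
    have : (fun p => y p k) = fun p => Complex.reCLM ((Y k).1 p) := by
      funext p; rw [hY]; simp
    rw [this]
    exact Complex.reCLM.contDiff.contMDiff.comp (Y k).contMDiff
  set x₀ := extChartAt (𝓡 (2 * m)) p p
  have hyd : HasFDerivAt (inChart p y) (fderiv ℝ (inChart p y) x₀) x₀ :=
    ((contDiffAt_inChart p hy).differentiableAt (by simp)).hasFDerivAt
  have hy0 : inChart p y x₀ = y p := by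
    simp only [inChart, Function.comp_apply, x₀, extChartAt_to_inv]
  set y' := fderiv ℝ (inChart p y) x₀
  let c : κ → ℂ := fun k => fderiv ℝ φ (y p) (Pi.single k 1)
  have h0 : evalHom p (D (f - ∑ k, c k • Y k)) = 0 := by
    refine derivation_apply_eq_zero D _ p (HasFDerivAt.fderiv ?_)
    have h1 : HasFDerivAt (φ ∘ inChart (m := m) p y) ((fderiv ℝ φ (y p)).comp y') x₀ :=
      HasFDerivAt.comp x₀ (by rw [hy0]; exact hφ.hasFDerivAt) hyd
    have h2 : HasFDerivAt (fun x => ∑ k, c k * (inChart (m := m) p y x k : ℂ))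
        (∑ k, c k • (Complex.ofRealCLM.comp ((ContinuousLinearMap.proj k).comp y'))) x₀ := by
      refine HasFDerivAt.fun_sum fun k _ => ?_
      refine HasFDerivAt.const_mul ?_ _
      exact Complex.ofRealCLM.hasFDerivAt.comp x₀
        ((ContinuousLinearMap.proj (R := ℝ) (φ := fun _ : κ => ℝ) k).hasFDerivAt.comp x₀ hyd)
    have h3 : inChart p (f - ∑ k, c k • Y k).1 =
        fun x => (φ ∘ inChart (m := m) p y) x - ∑ k, c k * (inChart (m := m) p y x k : ℂ) := by
      funext x
      have : ∀ q, (f - ∑ k, c k • Y k).1 q = φ (y q) - ∑ k, c k * (y q k : ℂ) := by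
        intro q
        rw [← evalHom_apply, map_sub, map_sum, evalHom_apply, hf]
        congr 1
        refine Finset.sum_congr rfl fun k _ => ?_
        rw [map_smul, evalHom_apply, hY, smul_eq_mul]
      exact this _
    rw [h3]
    refine (h1.fun_sub h2).congr_fderiv ?_
    ext v
    have h4 : fderiv ℝ φ (y p) (y' v) = ∑ k, (y' v k) • c k := by
      rw [← ContinuousLinearMap.coe_coe, LinearMap.pi_apply_eq_sum_univ]
      refine Finset.sum_congr rfl fun k _ => ?_
      refine congrArg (fun w => (y' v k) • fderiv ℝ φ (y p) w) (funext fun b => ?_)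
      simp [Pi.single_apply, eq_comm]
    simp [h4, mul_comm]
  rw [map_sub, map_sum, map_sub, map_sum, sub_eq_zero] at h0
  rw [h0]
  refine Finset.sum_congr rfl fun k _ => ?_
  rw [Derivation.map_smul, map_smul, smul_eq_mul]

end Manifold

end

/-! ### Global Darboux coordinates as an open embedding -/

section

open Filter Topology

section Coordinates

variable {m : ℕ} {𝓜 : Type*} [TopologicalSpace 𝓜]
  [ChartedSpace (EuclideanSpace ℝ (Fin (2 * m))) 𝓜]

/-- A star product on a symplectic manifold as a formal star product on its algebra of smooth
functions. -/
def StarProduct.toFormal {P : SymplecticBracket m 𝓜} (S : StarProduct P) :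
    FormalStar (Smooth m 𝓜) where
  C := S.C
  bracket := P.bracket
  skew := P.skew
  leibniz := P.leibniz
  jacobi := P.jacobi
  assoc := S.assoc
  one_star := S.one_star
  star_one := S.star_one
  lowest := S.lowest
  commutator := S.commutator

variable {P : SymplecticBracket m 𝓜} {h : Fin m → Smooth m 𝓜}

namespace GlobalActionAngle

variable (aa : GlobalActionAngle P h)

/-- The Darboux coordinates of a point, as real numbers. -/
def coord (p : 𝓜) (a : Fin m ⊕ Fin m) : ℝ := ((aa.z a).1 p).re

theorem z_apply (a : Fin m ⊕ Fin m) (p : 𝓜) : (aa.z a).1 p = (aa.coord p a : ℂ) := by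
  rcases a with i | i
  · rw [coord, aa.z_left, Complex.ofReal_re]
  · rw [coord, aa.z_right, Complex.ofReal_re]

theorem evalHom_z (a : Fin m ⊕ Fin m) (p : 𝓜) : evalHom p (aa.z a) = (aa.coord p a : ℂ) :=
  aa.z_apply a p

theorem star_z (a : Fin m ⊕ Fin m) : star (aa.z a) = aa.z a := by
  refine Smooth.ext_evalHom fun p => ?_
  change starRingEnd ℂ ((aa.z a).1 p) = (aa.z a).1 p
  rw [aa.z_apply, Complex.conj_ofReal]

theorem coord_injective : Function.Injective aa.coord := fun p q hpq =>
  aa.z_injective (funext fun a => by simp only [aa.z_apply, hpq])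

theorem contMDiff_coord : ContMDiff (𝓡 (2 * m)) 𝓘(ℝ, Fin m ⊕ Fin m → ℝ) ∞ aa.coord := by
  rw [contMDiff_pi_space]
  exact fun a => Complex.reCLM.contDiff.contMDiff.comp (aa.z a).contMDiff

/-- A smooth function on the manifold, as a function of the Darboux coordinates (zero outside of
the range of the coordinates). -/
def push (f : Smooth m 𝓜) : (Fin m ⊕ Fin m → ℝ) → ℂ := Function.extend aa.coord f.1 0

theorem push_coord (f : Smooth m 𝓜) (p : 𝓜) : aa.push f (aa.coord p) = f.1 p :=
  aa.coord_injective.extend_apply _ _ _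

/-- A smooth function of the Darboux coordinates, as a function on the manifold. -/
def pull (F : (Fin m ⊕ Fin m → ℝ) → ℂ) (hF : ∀ p, ContDiffAt ℝ ∞ F (aa.coord p)) :
    Smooth m 𝓜 :=
  ⟨fun p => F (aa.coord p), fun p => (hF p).contMDiffAt.comp p (aa.contMDiff_coord p)⟩

theorem evalHom_pull (F : (Fin m ⊕ Fin m → ℝ) → ℂ) (hF : ∀ p, ContDiffAt ℝ ∞ F (aa.coord p))
    (p : 𝓜) : evalHom p (aa.pull F hF) = F (aa.coord p) := rfl

variable [IsManifold (𝓡 (2 * m)) ∞ 𝓜] [T2Space 𝓜]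

/-- The differentials of the Darboux coordinates are independent, by the nondegeneracy of their
brackets. -/
theorem bijective_fderiv_coord (S : StarProduct P) (p : 𝓜) :
    Function.Bijective (fderiv ℝ (inChart p aa.coord) (extChartAt (𝓡 (2 * m)) p p)) := by
  set x₀ := extChartAt (𝓡 (2 * m)) p p
  set L := fderiv ℝ (inChart p aa.coord) x₀
  have hL : HasFDerivAt (inChart p aa.coord) L x₀ :=
    ((contDiffAt_inChart p aa.contMDiff_coord).differentiableAt (by simp)).hasFDerivAt
  have hdim : Module.finrank ℝ (EuclideanSpace ℝ (Fin (2 * m))) =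
      Module.finrank ℝ (Fin m ⊕ Fin m → ℝ) := by
    simp [two_mul]
  have hsurj : Function.Surjective L.toLinearMap := by
    rw [← LinearMap.range_eq_top]
    by_contra hne
    obtain ⟨φ, hφ0, hφ⟩ := Submodule.exists_le_ker_of_lt_top _ (lt_top_iff_ne_top.2 hne)
    refine hφ0 ?_
    let c : Fin m ⊕ Fin m → ℝ := fun a => φ (Pi.single a 1)
    have hφc : ∀ y, φ y = ∑ a, c a * y a := fun y => by
      rw [LinearMap.pi_apply_eq_sum_univ]
      refine Finset.sum_congr rfl fun a _ => ?_
      rw [smul_eq_mul, mul_comm]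
      refine congrArg (fun w => φ w * y a) (funext fun b => ?_)
      simp [Pi.single_apply, eq_comm]
    let f : Smooth m 𝓜 := ∑ a, (c a : ℂ) • aa.z a
    have hf : inChart p f.1 = fun x =>
        ((φ.toContinuousLinearMap (inChart (m := m) p aa.coord x) : ℝ) : ℂ) := by
      funext x
      change evalHom _ f = _
      simp only [f, map_sum, map_smul, evalHom_z, smul_eq_mul]
      simp [hφc, inChart]
    have h0 : fderiv ℝ (inChart p f.1) x₀ = 0 := by
      rw [hf]
      have h1 := Complex.ofRealCLM.hasFDerivAt.comp x₀
        (φ.toContinuousLinearMap.hasFDerivAt.comp x₀ hL)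
      refine h1.fderiv.trans ?_
      ext v
      have : φ (L v) = 0 := hφ ⟨v, rfl⟩
      simp [this]
    have h2 : ∀ b, ∑ a, (c a : ℂ) * matJ m b a = 0 := by
      intro b
      rw [← derivation_apply_eq_zero (S.toFormal.ham (aa.z b)) f p h0]
      simp only [f, map_sum]
      refine Finset.sum_congr rfl fun a _ => ?_
      have h3 := congrArg (evalHom p) (aa.darboux b a)
      rw [AlgHom.commutes] at h3
      rw [Derivation.map_smul, map_smul, smul_eq_mul]
      exact congrArg _ h3.symm
    have hc : ∀ a, c a = 0 := by
      rintro (i | i)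
      · have := h2 (Sum.inr i)
        rw [Fintype.sum_sum_type] at this
        simpa [FormalStar.matJ_inr_inl, FormalStar.matJ_inr_inr] using this
      · have := h2 (Sum.inl i)
        rw [Fintype.sum_sum_type] at this
        simpa [FormalStar.matJ_inl_inr, FormalStar.matJ_inl_inl] using this
    ext y
    simp [hφc, hc]
  exact ⟨(LinearMap.injective_iff_surjective_of_finrank_eq_finrank hdim).2 hsurj, hsurj⟩

/-- Near each point, the coordinates have a smooth inverse. -/
theorem range_coord_mem_nhds_and_contDiffAt_push (S : StarProduct P) (p : 𝓜) :
    Set.range aa.coord ∈ 𝓝 (aa.coord p) ∧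
      ∀ f, ContDiffAt ℝ ∞ (aa.push f) (aa.coord p) := by
  set x₀ := extChartAt (𝓡 (2 * m)) p p with hx₀
  have hF := contDiffAt_inChart p aa.contMDiff_coord
  let L := ContinuousLinearEquiv.ofBijective (fderiv ℝ (inChart p aa.coord) x₀)
    (LinearMap.ker_eq_bot.2 (aa.bijective_fderiv_coord S p).1)
    (LinearMap.range_eq_top.2 (aa.bijective_fderiv_coord S p).2)
  have hF' : HasFDerivAt (inChart p aa.coord) (L : _ →L[ℝ] _) x₀ :=
    (hF.differentiableAt (by simp)).hasFDerivAt
  have hx0 : inChart p aa.coord x₀ = aa.coord p := by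
    simp only [inChart, Function.comp_apply, hx₀, extChartAt_to_inv]
  have hloc := hF.to_localInverse hF' (by simp)
  have hinv : ∀ᶠ y in 𝓝 (inChart p aa.coord x₀),
      inChart p aa.coord (hF.localInverse hF' (by simp) y) = y :=
    (hF.hasStrictFDerivAt' hF' (by simp)).eventually_right_inverse
  have hval : hF.localInverse hF' (by simp) (inChart p aa.coord x₀) = x₀ :=
    (hF.hasStrictFDerivAt' hF' (by simp)).localInverse_apply_image
  rw [← hx0]
  constructor
  · filter_upwards [hinv] with y hy
    exact ⟨_, hy⟩
  · intro f
    have h1 : ContDiffAt ℝ ∞ (inChart p f.1 ∘ hF.localInverse hF' (by simp))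
        (inChart p aa.coord x₀) := by
      refine ContDiffAt.comp _ ?_ hloc
      rw [hval]
      exact contDiffAt_inChart p f.contMDiff
    refine h1.congr_of_eventuallyEq ?_
    filter_upwards [hinv] with y hy
    conv_lhs => rw [← hy]
    exact aa.push_coord f _

theorem isOpen_range_coord (S : StarProduct P) : IsOpen (Set.range aa.coord) :=
  isOpen_iff_mem_nhds.2 (by
    rintro _ ⟨p, rfl⟩
    exact (aa.range_coord_mem_nhds_and_contDiffAt_push S p).1)

theorem contDiffAt_push (S : StarProduct P) (f : Smooth m 𝓜) {x : Fin m ⊕ Fin m → ℝ}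
    (hx : x ∈ Set.range aa.coord) : ContDiffAt ℝ ∞ (aa.push f) x := by
  obtain ⟨p, rfl⟩ := hx
  exact (aa.range_coord_mem_nhds_and_contDiffAt_push S p).2 f

theorem isCoordinateSystem (S : StarProduct P) :
    IsCoordinateSystem (M := 𝓜) evalHom aa.z := by
  refine ⟨fun f hf => Smooth.ext_evalHom fun p => by rw [hf, map_zero], fun p f hf => ?_⟩
  have hU := aa.isOpen_range_coord S
  obtain ⟨g, hg, hgf⟩ := exists_hadamard hU (F := aa.push f)
    (fun x hx => (aa.contDiffAt_push S f hx).contDiffWithinAt) ⟨p, rfl⟩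
  have hfe : f = ∑ a, aa.pull (g a) (fun q => (hg a).contDiffAt (hU.mem_nhds ⟨q, rfl⟩)) *
      (aa.z a - algebraMap ℂ _ (evalHom p (aa.z a))) := by
    refine Smooth.ext_evalHom fun q => ?_
    have h1 := hgf (aa.coord q) ⟨q, rfl⟩
    rw [aa.push_coord, aa.push_coord, show f.1 p = 0 from hf, sub_zero] at h1
    rw [evalHom_apply, h1, map_sum]
    refine Finset.sum_congr rfl fun a _ => ?_
    rw [map_mul, map_sub, AlgHom.commutes, evalHom_pull, evalHom_z, evalHom_z, mul_comm]
    simp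
  rw [hfe]
  exact Ideal.sum_mem _ fun a _ => Ideal.mul_mem_left _ _ (Ideal.subset_span ⟨a, rfl⟩)

/-- A derivation in terms of partial derivatives with respect to the Darboux coordinates. -/
theorem derivation_apply (S : StarProduct P) (D : Derivation ℂ (Smooth m 𝓜) (Smooth m 𝓜))
    (f : Smooth m 𝓜) (p : 𝓜) : evalHom p (D f) =
      ∑ a, fderiv ℝ (aa.push f) (aa.coord p) (Pi.single a 1) * evalHom p (D (aa.z a)) :=
  derivation_chain_rule D aa.coord aa.z aa.z_apply (aa.push f) f
    (fun q => (aa.push_coord f q).symm) p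
    ((aa.contDiffAt_push S f ⟨p, rfl⟩).differentiableAt (by simp))

end GlobalActionAngle

end Coordinates

end

/-! ### Exactness of closed two-forms -/

section

namespace FormalStar

variable {A : Type*} [CommRing A] [Algebra ℂ A] {S : FormalStar A} {σ : Type*} [Fintype σ]

theorem derivation_sum_apply {ι : Type*} (s : Finset ι) (D : ι → Derivation ℂ A A) (f : A) :
    (∑ a ∈ s, D a) f = ∑ a ∈ s, D a f :=
  map_sum (⟨⟨fun D => D f, rfl⟩, fun _ _ => rfl⟩ : Derivation ℂ A A →+ A) D s

/-- If closed two-forms on derivations are exact, then so are antisymmetric matrices that are closed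
in the frame of the commuting Hamiltonian derivations `{z a, ·}`. The functions `y` are dual to `z`:
the one-forms `dy a` are the coframe. -/
theorem closedIsExact [DecidableEq σ] {z y : σ → A}
    (hcoh : ∀ η : Derivation ℂ A A →ₗ[A] Derivation ℂ A A →ₗ[A] A,
      (∀ X, η X X = 0) →
      (∀ X Y W, X (η Y W) - Y (η X W) + W (η X Y)
        - η ⁅X, Y⁆ W + η ⁅X, W⁆ Y - η ⁅Y, W⁆ X = 0) →
      ∃ τ : Derivation ℂ A A →ₗ[A] A, ∀ X Y, η X Y = X (τ Y) - Y (τ X) - τ ⁅X, Y⁆)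
    (hzy : ∀ a b, S.bracket (z a) (y b) = if a = b then 1 else 0)
    (hexp : ∀ (X : Derivation ℂ A A) f, X f = ∑ a, X (y a) * S.bracket (z a) f)
    (hcomm : ∀ a b, ⁅S.ham (z a), S.ham (z b)⁆ = 0) :
    S.ClosedIsExact z := by
  intro e hdiag hanti hclosed
  let η : Derivation ℂ A A →ₗ[A] Derivation ℂ A A →ₗ[A] A :=
    LinearMap.mk₂ A (fun X Y => ∑ a, ∑ b, e a b * (X (y a) * Y (y b)))
      (fun X X' Y => by simp [add_mul, mul_add, Finset.sum_add_distrib])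
      (fun c X Y => by
        simp only [Derivation.smul_apply, smul_eq_mul, Finset.mul_sum]
        exact Finset.sum_congr rfl fun a _ => Finset.sum_congr rfl fun b _ => by ring)
      (fun X Y Y' => by simp [mul_add, Finset.sum_add_distrib])
      (fun c X Y => by
        simp only [Derivation.smul_apply, smul_eq_mul, Finset.mul_sum]
        exact Finset.sum_congr rfl fun a _ => Finset.sum_congr rfl fun b _ => by ring)
  have hη : ∀ X Y, η X Y = ∑ a, ∑ b, e a b * (X (y a) * Y (y b)) := fun _ _ => rfl
  have hswap : ∀ u v : σ → A, ∑ a, ∑ b, e a b * (u a * v b) = -∑ a, ∑ b, e a b * (v a * u b) := by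
    intro u v
    rw [Finset.sum_comm]
    simp only [← Finset.sum_neg_distrib]
    refine Finset.sum_congr rfl fun a _ => Finset.sum_congr rfl fun b _ => ?_
    rw [hanti b a]; ring
  have hdiagsum : ∀ X, η X X = 0 := by
    intro X
    have h1 := hswap (fun a => X (y a)) (fun a => X (y a))
    rw [← hη] at h1
    have h2 : (2 : ℂ) • η X X = 0 := by rw [two_smul]; nth_rewrite 1 [h1]; simp
    simpa using (smul_eq_zero_iff_right (two_ne_zero : (2 : ℂ) ≠ 0)).1 h2
  obtain ⟨τ, hτ⟩ := hcoh η hdiagsum (fun X Y W => by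
    -- terms of second order cancel by antisymmetry, those of first order by closedness
    have h1 : ∑ a, ∑ b, (X (e a b) * (Y (y a) * W (y b)) - Y (e a b) * (X (y a) * W (y b)) +
        W (e a b) * (X (y a) * Y (y b))) = 0 := by
      let T : σ → σ → σ → A := fun c a b => S.bracket (z c) (e a b)
      have hT : ∀ X Y W : Derivation ℂ A A, ∑ a, ∑ b, X (e a b) * (Y (y a) * W (y b)) =
          ∑ a, ∑ b, ∑ c, X (y c) * T c a b * (Y (y a) * W (y b)) := by
        intro X Y W
        refine Finset.sum_congr rfl fun a _ => Finset.sum_congr rfl fun b _ => ?_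
        rw [hexp X, Finset.sum_mul]
      have r1 : ∀ F : σ → σ → σ → A, ∑ a, ∑ b, ∑ c, F a b c = ∑ a, ∑ b, ∑ c, F c b a := by
        intro F
        rw [Finset.sum_comm]
        simp only [fun b => Finset.sum_comm (f := fun a c => F a b c) (s := Finset.univ)
          (t := Finset.univ)]
        rw [Finset.sum_comm]
      have r2 : ∀ F : σ → σ → σ → A, ∑ a, ∑ b, ∑ c, F a b c = ∑ a, ∑ b, ∑ c, F c a b := by
        intro F
        rw [r1, Finset.sum_comm]
      simp only [Finset.sum_add_distrib, Finset.sum_sub_distrib, hT]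
      rw [r1 (fun a b c => Y (y c) * T c a b * (X (y a) * W (y b))),
        r2 (fun a b c => W (y c) * T c a b * (X (y a) * Y (y b)))]
      simp only [← Finset.sum_add_distrib, ← Finset.sum_sub_distrib]
      refine Finset.sum_eq_zero fun a _ => Finset.sum_eq_zero fun b _ =>
        Finset.sum_eq_zero fun c _ => ?_
      have h2 : T a c b = -T a b c := by simp only [T]; rw [hanti c b, map_neg]
      have h3 : T c a b + T a b c + T b c a = 0 := hclosed c a b
      rw [h2]
      linear_combination (X (y c) * Y (y a) * W (y b)) * h3
    have h2 := hswap (fun a => Y (y a)) (fun b => X (W (y b)))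
    have h3 := hswap (fun a => X (y a)) (fun b => Y (W (y b)))
    have h4 := hswap (fun a => X (y a)) (fun b => W (Y (y b)))
    rw [eq_neg_iff_add_eq_zero] at h2 h3 h4
    have h5 : X (η Y W) - Y (η X W) + W (η X Y) - η ⁅X, Y⁆ W + η ⁅X, W⁆ Y - η ⁅Y, W⁆ X =
        ∑ a, ∑ b, (X (e a b) * (Y (y a) * W (y b)) - Y (e a b) * (X (y a) * W (y b)) +
          W (e a b) * (X (y a) * Y (y b))) +
        (∑ a, ∑ b, e a b * (Y (y a) * X (W (y b))) + ∑ a, ∑ b, e a b * (X (W (y a)) * Y (y b))) -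
        (∑ a, ∑ b, e a b * (X (y a) * Y (W (y b))) + ∑ a, ∑ b, e a b * (Y (W (y a)) * X (y b))) +
        (∑ a, ∑ b, e a b * (X (y a) * W (Y (y b))) +
          ∑ a, ∑ b, e a b * (W (Y (y a)) * X (y b))) := by
      simp only [hη, map_sum, Derivation.leibniz, Derivation.commutator_apply, smul_eq_mul,
        ← Finset.sum_add_distrib, ← Finset.sum_sub_distrib]
      exact Finset.sum_congr rfl fun a _ => Finset.sum_congr rfl fun b _ => by ring
    rw [h5, h1, h2, h3, h4]
    simp)
  refine ⟨fun b => τ (S.ham (z b)), fun a b => ?_⟩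
  have h := hτ (S.ham (z a)) (S.ham (z b))
  rw [hcomm, map_zero, sub_zero, ham_apply, ham_apply, hη] at h
  rw [← h]
  simp [hzy]

/-- The case of Darboux coordinates: the dual coordinates are the coordinates up to order and
sign. -/
theorem closedIsExact_of_darboux {m : ℕ} {M : Type*} {ev : M → A →ₐ[ℂ] ℂ} {z : Fin m ⊕ Fin m → A}
    (hc : IsCoordinateSystem ev z)
    (hz : ∀ a b, S.bracket (z a) (z b) = algebraMap ℂ A (matJ m a b))
    (hcoh : ∀ η : Derivation ℂ A A →ₗ[A] Derivation ℂ A A →ₗ[A] A,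
      (∀ X, η X X = 0) →
      (∀ X Y W, X (η Y W) - Y (η X W) + W (η X Y)
        - η ⁅X, Y⁆ W + η ⁅X, W⁆ Y - η ⁅Y, W⁆ X = 0) →
      ∃ τ : Derivation ℂ A A →ₗ[A] A, ∀ X Y, η X Y = X (τ Y) - Y (τ X) - τ ⁅X, Y⁆) :
    S.ClosedIsExact z := by
  let y : Fin m ⊕ Fin m → A := Sum.elim (fun i => z (Sum.inr i)) fun i => -z (Sum.inl i)
  have hzy : ∀ a b, S.bracket (z a) (y b) = if a = b then 1 else 0 := by
    rintro (i | i) (j | j) <;>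
      simp only [y, Sum.elim_inl, Sum.elim_inr, map_neg, hz, matJ_inl_inl, matJ_inl_inr,
        matJ_inr_inl, matJ_inr_inr, Sum.inl.injEq, Sum.inr.injEq, reduceCtorEq, if_false, map_zero,
        neg_zero]
    · split_ifs <;> simp
    · split_ifs <;> simp
  refine closedIsExact hcoh hzy (fun X f => ?_) fun a b => ?_
  · have h0 : X - ∑ a, X (y a) • S.ham (z a) = 0 := by
      have hy : ∀ b, (X - ∑ a, X (y a) • S.ham (z a)) (y b) = 0 := by
        intro b
        rw [Derivation.sub_apply, derivation_sum_apply]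
        simp [hzy]
      refine hc.derivation_eq_zero _ ?_
      rintro (i | i)
      · have := hy (Sum.inr i)
        simp only [y, Sum.elim_inr] at this
        rwa [map_neg, neg_eq_zero] at this
      · exact hy (Sum.inl i)
    have h1 := congrArg (fun D : Derivation ℂ A A => D f) h0
    simp only [Derivation.sub_apply, Derivation.zero_apply] at h1
    rw [sub_eq_zero, derivation_sum_apply] at h1
    simpa using h1
  · ext f
    rw [Derivation.commutator_apply, ham_apply, ham_apply, ham_apply, ham_apply, S.bracket_jacobi,
      hz, S.skew (algebraMap ℂ A _), bracket_algebraMap]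
    simp

end FormalStar

end

/-! ### The torus action -/

section

open Filter Topology

section Rotation

variable {m : ℕ}

/-- The linear vector field on the space of coordinates that generates the rotation of the `j`-th
coordinate plane. -/
def angularField (j : Fin m) : (Fin m ⊕ Fin m → ℝ) →L[ℝ] (Fin m ⊕ Fin m → ℝ) :=
  ContinuousLinearMap.pi (Sum.elim
    (fun i => if i = j then -ContinuousLinearMap.proj (Sum.inr j) else 0)
    (fun i => if i = j then ContinuousLinearMap.proj (Sum.inl j) else 0))

theorem angularField_inl (j i : Fin m) (x : Fin m ⊕ Fin m → ℝ) :
    angularField j x (Sum.inl i) = if i = j then -x (Sum.inr j) else 0 := by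
  simp only [angularField, ContinuousLinearMap.pi_apply, Sum.elim_inl]
  split_ifs <;> simp

theorem angularField_inr (j i : Fin m) (x : Fin m ⊕ Fin m → ℝ) :
    angularField j x (Sum.inr i) = if i = j then x (Sum.inl j) else 0 := by
  simp only [angularField, ContinuousLinearMap.pi_apply, Sum.elim_inr]
  split_ifs <;> simp

theorem angularField_comm (j k : Fin m) (x : Fin m ⊕ Fin m → ℝ) :
    angularField j (angularField k x) = angularField k (angularField j x) := by
  by_cases hjk : j = k
  · rw [hjk]
  funext a
  rcases a with i | i <;> simp only [angularField_inl, angularField_inr, hjk, Ne.symm hjk,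
    if_false, neg_zero, ite_self]

theorem angularField_cube (j : Fin m) (x : Fin m ⊕ Fin m → ℝ) :
    angularField j (angularField j (angularField j x)) = -angularField j x := by
  funext a
  rcases a with i | i <;> simp only [angularField_inl, angularField_inr, Pi.neg_apply, if_true] <;>
    split_ifs <;> simp

/-- Rotation of the `j`-th coordinate plane by the angle `t`. -/
def rot (j : Fin m) (t : ℝ) (x : Fin m ⊕ Fin m → ℝ) : Fin m ⊕ Fin m → ℝ :=
  x + Real.sin t • angularField j x + (1 - Real.cos t) • angularField j (angularField j x)

theorem rot_zero (j : Fin m) (x : Fin m ⊕ Fin m → ℝ) : rot j 0 x = x := by simp [rot]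

theorem rot_two_pi (j : Fin m) (x : Fin m ⊕ Fin m → ℝ) : rot j (2 * Real.pi) x = x := by
  simp [rot]

theorem contDiff_rot (j : Fin m) :
    ContDiff ℝ ∞ fun y : (Fin m ⊕ Fin m → ℝ) × ℝ => rot j y.2 y.1 := by
  unfold rot
  have h1 : ContDiff ℝ ∞ fun y : (Fin m ⊕ Fin m → ℝ) × ℝ => angularField j y.1 :=
    (angularField j).contDiff.comp contDiff_fst
  exact (contDiff_fst.add ((Real.contDiff_sin.comp contDiff_snd).smul h1)).add
    ((contDiff_const.sub (Real.contDiff_cos.comp contDiff_snd)).smul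
      ((angularField j).contDiff.comp h1))

theorem hasDerivAt_rot (j : Fin m) (x : Fin m ⊕ Fin m → ℝ) (t : ℝ) :
    HasDerivAt (fun t => rot j t x) (angularField j (rot j t x)) t := by
  have h := (((Real.hasDerivAt_sin t).smul_const (angularField j x)).const_add x).add
    (((Real.hasDerivAt_cos t).const_sub 1).smul_const (angularField j (angularField j x)))
  refine h.congr_deriv ?_
  rw [rot, map_add, map_add, map_smul, map_smul, angularField_cube]
  module

theorem angularField_rot (j k : Fin m) (t : ℝ) (x : Fin m ⊕ Fin m → ℝ) :
    angularField k (rot j t x) = rot j t (angularField k x) := by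
  simp only [rot, map_add, map_smul, angularField_comm j k]

theorem hasFDerivAt_rot (j : Fin m) (t : ℝ) (x : Fin m ⊕ Fin m → ℝ) :
    HasFDerivAt (rot j t) (ContinuousLinearMap.id ℝ _ + Real.sin t • angularField j +
      (1 - Real.cos t) • (angularField j).comp (angularField j)) x := by
  have h := (ContinuousLinearMap.id ℝ _ + Real.sin t • angularField j +
    (1 - Real.cos t) • (angularField j).comp (angularField j)).hasFDerivAt (x := x)
  exact h

end Rotation

section Torus

variable {m : ℕ} {𝓜 : Type*} [TopologicalSpace 𝓜]
  [ChartedSpace (EuclideanSpace ℝ (Fin (2 * m))) 𝓜]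
  {P : SymplecticBracket m 𝓜} {h : Fin m → Smooth m 𝓜}

namespace GlobalActionAngle

open FormalStar

variable (aa : GlobalActionAngle P h)

theorem coord_inl (i : Fin m) (p : 𝓜) :
    aa.coord p (Sum.inl i) = Real.sqrt (2 * aa.act i p) * (aa.ang i p).cos := by
  rw [coord, aa.z_left, Complex.ofReal_re]

theorem coord_inr (i : Fin m) (p : 𝓜) :
    aa.coord p (Sum.inr i) = -(Real.sqrt (2 * aa.act i p) * (aa.ang i p).sin) := by
  rw [coord, aa.z_right, Complex.ofReal_re]

/-- Since the level sets of the actions are full tori, rotations map the range of the coordinates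
to itself. -/
theorem rot_mem_range_coord (j : Fin m) (t : ℝ) {x : Fin m ⊕ Fin m → ℝ}
    (hx : x ∈ Set.range aa.coord) : rot j t x ∈ Set.range aa.coord := by
  obtain ⟨p, rfl⟩ := hx
  obtain ⟨q, hq⟩ := aa.full_torus p
    (Function.update (fun i => aa.ang i p) j (aa.ang j p - (t : Real.Angle)))
  refine ⟨q, funext fun a => ?_⟩
  have hz : ∀ i, ¬ 0 < aa.act i p → Real.sqrt (2 * aa.act i p) = 0 := fun i hi => by
    rw [le_antisymm (not_lt.1 hi) (aa.act_nonneg i p), mul_zero, Real.sqrt_zero]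
  rcases a with i | i
  · simp only [rot, Pi.add_apply, Pi.smul_apply, smul_eq_mul, angularField_inl, angularField_inr,
      coord_inl, coord_inr, (hq i).1]
    by_cases hi : 0 < aa.act i p
    · rw [(hq i).2 hi]
      by_cases hij : i = j
      · subst hij
        simp [sub_eq_add_neg, Real.Angle.cos_add]
        ring
      · simp [hij]
    -- where an action vanishes its angle is arbitrary, but both coordinates are zero
    · have := hz i hi
      by_cases hij : i = j
      · subst hij; simp [this]
      · simp [this, hij]
  · simp only [rot, Pi.add_apply, Pi.smul_apply, smul_eq_mul, angularField_inl, angularField_inr,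
      coord_inl, coord_inr, (hq i).1]
    by_cases hi : 0 < aa.act i p
    · rw [(hq i).2 hi]
      by_cases hij : i = j
      · subst hij
        simp [sub_eq_add_neg, Real.Angle.sin_add]
        ring
      · simp [hij]
    · have := hz i hi
      by_cases hij : i = j
      · subst hij; simp [this]
      · simp [this, hij]

theorem evalHom_action (k : Fin m) (p : 𝓜) : evalHom p (action aa.z k) = (aa.act k p : ℂ) := by
  rw [action_eq, map_smul, map_add, map_pow, map_pow, evalHom_z, evalHom_z, coord_inl, coord_inr,
    smul_eq_mul, ← Complex.ofReal_pow, ← Complex.ofReal_pow, ← Complex.ofReal_add]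
  have h1 : (Real.sqrt (2 * aa.act k p) * (aa.ang k p).cos) ^ 2 +
      (-(Real.sqrt (2 * aa.act k p) * (aa.ang k p).sin)) ^ 2 = 2 * aa.act k p := by
    have h2 := Real.Angle.cos_sq_add_sin_sq (aa.ang k p)
    have h3 := Real.sq_sqrt (mul_nonneg zero_le_two (aa.act_nonneg k p))
    linear_combination (Real.sqrt (2 * aa.act k p)) ^ 2 * h2 + h3
  rw [h1]
  push_cast
  ring

theorem push_add {f g : Smooth m 𝓜} {x : Fin m ⊕ Fin m → ℝ} (hx : x ∈ Set.range aa.coord) :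
    aa.push (f + g) x = aa.push f x + aa.push g x := by
  obtain ⟨p, rfl⟩ := hx
  rw [push_coord, push_coord, push_coord]; rfl

theorem push_smul {c : ℂ} {f : Smooth m 𝓜} {x : Fin m ⊕ Fin m → ℝ}
    (hx : x ∈ Set.range aa.coord) : aa.push (c • f) x = c * aa.push f x := by
  obtain ⟨p, rfl⟩ := hx
  rw [push_coord, push_coord]; rfl

/-- The frequencies `∂h i / ∂I k`, as functions on the manifold. -/
def frequency (i k : Fin m) : Smooth m 𝓜 :=
  ⟨fun p => (fderiv ℝ aa.f (fun l => aa.act l p) (Pi.single k 1) i : ℂ), fun p => by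
    have hact : ContMDiff (𝓡 (2 * m)) 𝓘(ℝ, Fin m → ℝ) ∞ fun (p : 𝓜) l => aa.act l p := by
      rw [contMDiff_pi_space]
      intro l
      have h1 : (fun p => aa.act l p) = fun p => Complex.reCLM ((action aa.z l).1 p) := by
        funext p
        rw [← evalHom_apply, aa.evalHom_action]; simp
      rw [h1]
      exact Complex.reCLM.contDiff.contMDiff.comp (action aa.z l).contMDiff
    have h2 : ContDiffAt ℝ ∞ (fun x => (fderiv ℝ aa.f x (Pi.single k 1) i : ℂ))
        (fun l => aa.act l p) := by
      refine Complex.ofRealCLM.contDiff.contDiffAt.comp _ ?_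
      exact contDiffAt_pi.1
        (((aa.f_smooth p).fderiv_right (m := ∞) le_rfl).clm_apply contDiffAt_const) i
    exact h2.contMDiffAt.comp p (hact p)⟩

theorem evalHom_frequency (i k : Fin m) (p : 𝓜) : evalHom p (aa.frequency i k) =
    (fderiv ℝ aa.f (fun l => aa.act l p) (Pi.single k 1) i : ℂ) := rfl

theorem isUnit_of_evalHom_ne_zero {f : Smooth m 𝓜} (hf : ∀ p, evalHom p f ≠ 0) : IsUnit f := by
  refine IsUnit.of_mul_eq_one (⟨fun p => (f.1 p)⁻¹, fun p => ?_⟩ : Smooth m 𝓜)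
    (Smooth.ext_evalHom fun p => mul_inv_cancel₀ (hf p))
  exact ((contDiffAt_inv ℝ (hf p)).contMDiffAt (f := fun w : ℂ => w⁻¹)).comp p (f.contMDiff p)

theorem isUnit_det_frequency : IsUnit (Matrix.of aa.frequency).det := by
  refine isUnit_of_evalHom_ne_zero fun p => ?_
  have h1 : evalHom p (Matrix.of aa.frequency).det =
      ((fderiv ℝ aa.f (fun l => aa.act l p)).det : ℂ) := by
    rw [AlgHom.map_det, ContinuousLinearMap.det, ← LinearMap.det_toMatrix',
      ← Complex.ofRealHom_eq_coe,
      RingHom.map_det]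
    congr 1
  rw [h1, Complex.ofReal_ne_zero]
  exact aa.independent p

theorem act_eq_action (k : Fin m) (p : 𝓜) : (action aa.z k).1 p = (aa.act k p : ℂ) :=
  aa.evalHom_action k p

variable [IsManifold (𝓡 (2 * m)) ∞ 𝓜] [T2Space 𝓜]

/-- The Hamiltonian flow of an action is a rotation. -/
theorem evalHom_bracket_action (S : StarProduct P) (k : Fin m) (f : Smooth m 𝓜) (p : 𝓜) :
    evalHom p (P.bracket (action aa.z k) f) =
      fderiv ℝ (aa.push f) (aa.coord p) (angularField k (aa.coord p)) := by
  have hv : angularField k (aa.coord p) =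
      ∑ a, angularField k (aa.coord p) a • (Pi.single a (1 : ℝ) : Fin m ⊕ Fin m → ℝ) := by
    funext b
    simp [Finset.sum_apply, Pi.single_apply]
  have h1 := aa.derivation_apply S (S.toFormal.ham (action aa.z k)) f p
  rw [ham_apply] at h1
  refine h1.trans ?_
  rw [hv, map_sum]
  refine Finset.sum_congr rfl fun a _ => ?_
  rw [map_smul, Complex.real_smul, mul_comm, ham_apply]
  congr 1
  rcases a with i | i
  · rw [bracket_action_inl aa.darboux, angularField_inl]
    by_cases hik : k = i
    · subst hik; simp [evalHom_z]
    · simp [hik, Ne.symm hik]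
  · rw [bracket_action_inr aa.darboux, angularField_inr]
    by_cases hik : k = i
    · subst hik; simp [evalHom_z]
    · simp [hik, Ne.symm hik]

/-- The derivative of a function along a rotation. -/
theorem hasDerivAt_push_rot (S : StarProduct P) (j : Fin m) (f : Smooth m 𝓜) (p : 𝓜) (t : ℝ) :
    HasDerivAt (fun t => aa.push f (rot j t (aa.coord p)))
      (aa.push (P.bracket (action aa.z j) f) (rot j t (aa.coord p))) t := by
  have hx := aa.rot_mem_range_coord j t ⟨p, rfl⟩
  have h1 := ((aa.contDiffAt_push S f hx).differentiableAt (by simp)).hasFDerivAt.comp_hasDerivAt t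
    (hasDerivAt_rot j (aa.coord p) t)
  obtain ⟨q, hq⟩ := hx
  refine h1.congr_deriv ?_
  rw [← hq, aa.push_coord, ← evalHom_apply, aa.evalHom_bracket_action S]

/-- The integrand of the averages over the circles: the values of `f` along a circle, times the
affine function of the angle that increases from `-1/2` to `1/2`, the Green function of `d/dt` on
functions of mean zero. -/
def circleIntegrand (j : Fin m) (f : Smooth m 𝓜) (y : (Fin m ⊕ Fin m → ℝ) × ℝ) : ℂ :=
  (((y.2 - Real.pi) / (2 * Real.pi) : ℝ) : ℂ) * aa.push f (rot j y.2 y.1)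

theorem contDiffAt_circleIntegrand (S : StarProduct P) (j : Fin m) (f : Smooth m 𝓜)
    {x : Fin m ⊕ Fin m → ℝ} (hx : x ∈ Set.range aa.coord) (t : ℝ) :
    ContDiffAt ℝ ∞ (aa.circleIntegrand j f) (x, t) := by
  refine ContDiffAt.mul ?_ ?_
  · refine Complex.ofRealCLM.contDiff.contDiffAt.comp _ ?_
    exact (contDiffAt_snd.sub contDiffAt_const).div_const _
  · exact ContDiffAt.comp (x, t) (aa.contDiffAt_push S f (aa.rot_mem_range_coord j t hx))
      (contDiff_rot j).contDiffAt

theorem contDiffAt_integral_circle (S : StarProduct P) (j : Fin m) (f : Smooth m 𝓜) (p : 𝓜) :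
    ContDiffAt ℝ ∞ (fun x => ∫ t in (0 : ℝ)..(2 * Real.pi), aa.circleIntegrand j f (x, t))
      (aa.coord p) :=
  (contDiffOn_parametric_integral (aa.isOpen_range_coord S)
    fun _ hx t _ => aa.contDiffAt_circleIntegrand S j f hx t).contDiffAt
    ((aa.isOpen_range_coord S).mem_nhds ⟨p, rfl⟩)

theorem intervalIntegrable_circleIntegrand (S : StarProduct P) (j : Fin m) (f : Smooth m 𝓜)
    (p : 𝓜) :
    IntervalIntegrable (fun t => aa.circleIntegrand j f (aa.coord p, t)) MeasureTheory.volume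
      0 (2 * Real.pi) :=
  (continuousOn_slice fun t _ =>
    aa.contDiffAt_circleIntegrand S j f ⟨p, rfl⟩ t).intervalIntegrable

/-- The antiderivative along the `j`-th angle, for functions that have mean zero over the
circles. -/
def angleInv (S : StarProduct P) (j : Fin m) : Smooth m 𝓜 →ₗ[ℂ] Smooth m 𝓜 where
  toFun f := aa.pull (fun x => ∫ t in (0 : ℝ)..(2 * Real.pi), aa.circleIntegrand j f (x, t))
    (aa.contDiffAt_integral_circle S j f)
  map_add' f g := Smooth.ext_evalHom fun p => by
    rw [map_add, evalHom_pull, evalHom_pull, evalHom_pull, ← intervalIntegral.integral_add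
      (aa.intervalIntegrable_circleIntegrand S j f p)
      (aa.intervalIntegrable_circleIntegrand S j g p)]
    refine intervalIntegral.integral_congr fun t _ => ?_
    simp only [circleIntegrand]
    rw [aa.push_add (aa.rot_mem_range_coord j t ⟨p, rfl⟩), mul_add]
  map_smul' c f := Smooth.ext_evalHom fun p => by
    rw [RingHom.id_apply, map_smul, evalHom_pull, evalHom_pull, smul_eq_mul,
      ← intervalIntegral.integral_const_mul]
    refine intervalIntegral.integral_congr fun t _ => ?_
    simp only [circleIntegrand]
    rw [aa.push_smul (aa.rot_mem_range_coord j t ⟨p, rfl⟩)]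
    ring

theorem evalHom_angleInv (S : StarProduct P) (j : Fin m) (f : Smooth m 𝓜) (p : 𝓜) :
    evalHom p (aa.angleInv S j f) =
      ∫ t in (0 : ℝ)..(2 * Real.pi), aa.circleIntegrand j f (aa.coord p, t) := rfl

/-- Rotations commute, so that differentiation along the `k`-th angle passes through the
rotations. -/
theorem fderiv_circleIntegrand (S : StarProduct P) (j k : Fin m) (f : Smooth m 𝓜) (p : 𝓜) (t : ℝ) :
    fderiv ℝ (aa.circleIntegrand j f) (aa.coord p, t) (angularField k (aa.coord p), 0) =
      aa.circleIntegrand j (P.bracket (action aa.z k) f) (aa.coord p, t) := by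
  have hx := aa.rot_mem_range_coord j t ⟨p, rfl⟩
  have hslice : HasFDerivAt (fun x => aa.circleIntegrand j f (x, t))
      ((fderiv ℝ (aa.circleIntegrand j f) (aa.coord p, t)).comp
        ((ContinuousLinearMap.id ℝ _).prod 0)) (aa.coord p) :=
    HasFDerivAt.comp (f := fun x => (x, t)) (aa.coord p)
      ((aa.contDiffAt_circleIntegrand S j f ⟨p, rfl⟩ t).differentiableAt (by simp)).hasFDerivAt
      ((hasFDerivAt_id (aa.coord p)).prodMk (hasFDerivAt_const t _))
  have h2 := (((aa.contDiffAt_push S f hx).differentiableAt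
    (by simp)).hasFDerivAt.comp (aa.coord p) (hasFDerivAt_rot j t _)).const_mul
      (((t - Real.pi) / (2 * Real.pi) : ℝ) : ℂ)
  have h3 := congrArg (fun L => L (angularField k (aa.coord p))) (hslice.unique h2)
  have h4 : angularField k (aa.coord p) + Real.sin t • angularField j (angularField k (aa.coord p))
      + (1 - Real.cos t) • angularField j (angularField j (angularField k (aa.coord p))) =
      angularField k (rot j t (aa.coord p)) := (angularField_rot j k t _).symm
  simp only [ContinuousLinearMap.comp_apply, ContinuousLinearMap.prod_apply,
    ContinuousLinearMap.id_apply, zero_apply, smul_apply,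
    add_apply, smul_eq_mul] at h3
  rw [h3, h4, circleIntegrand]
  congr 1
  obtain ⟨q, hq⟩ := hx
  rw [← hq, aa.push_coord, ← evalHom_apply, aa.evalHom_bracket_action S]

theorem bracket_angleInv (S : StarProduct P) (k j : Fin m) (f : Smooth m 𝓜) :
    P.bracket (action aa.z k) (aa.angleInv S j f) =
      aa.angleInv S j (P.bracket (action aa.z k) f) := by
  refine Smooth.ext_evalHom fun p => ?_
  have hU := aa.isOpen_range_coord S
  have hF : ∀ x ∈ Set.range aa.coord, ∀ t ∈ Set.uIcc 0 (2 * Real.pi),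
      ContDiffAt ℝ ∞ (aa.circleIntegrand j f) (x, t) :=
    fun x hx t _ => aa.contDiffAt_circleIntegrand S j f hx t
  have hev : aa.push (aa.angleInv S j f) =ᶠ[𝓝 (aa.coord p)]
      fun x => ∫ t in (0 : ℝ)..(2 * Real.pi), aa.circleIntegrand j f (x, t) := by
    filter_upwards [hU.mem_nhds ⟨p, rfl⟩]
    rintro _ ⟨q, rfl⟩
    exact aa.push_coord _ q
  rw [aa.evalHom_bracket_action S, hev.fderiv_eq,
    (hasFDerivAt_parametric_integral hU hF ⟨p, rfl⟩).fderiv, evalHom_angleInv,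
    ContinuousLinearMap.intervalIntegral_apply]
  · refine intervalIntegral.integral_congr fun t _ => ?_
    exact aa.fderiv_circleIntegrand S j k f p t
  · refine ContinuousOn.intervalIntegrable fun t ht => ?_
    exact ((contDiffAt_fderiv_inl (hF _ ⟨p, rfl⟩ t ht)).continuousAt.comp
      (f := fun t : ℝ => (aa.coord p, t)) (by fun_prop)).continuousWithinAt

/-- Integration by parts: the boundary terms at `0` and `2π` add up to the value of the function,
and the remaining integral is its mean, which vanishes for a derivative along the circle. -/
theorem bracket_angleInv_bracket (S : StarProduct P) (k : Fin m) (f : Smooth m 𝓜) :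
    P.bracket (action aa.z k) (aa.angleInv S k (P.bracket (action aa.z k) f)) =
      P.bracket (action aa.z k) f := by
  rw [aa.bracket_angleInv S]
  refine Smooth.ext_evalHom fun p => ?_
  have hcont : ∀ g : Smooth m 𝓜, Continuous fun t => aa.push g (rot k t (aa.coord p)) := fun g =>
    continuous_iff_continuousAt.2 fun t => (aa.hasDerivAt_push_rot S k g p t).continuousAt
  have hw : ∀ t, HasDerivAt (fun t : ℝ => (((t - Real.pi) / (2 * Real.pi) : ℝ) : ℂ))
      ((1 / (2 * Real.pi) : ℝ) : ℂ) t := fun t =>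
    (((hasDerivAt_id t).sub_const Real.pi).div_const (2 * Real.pi)).ofReal_comp
  have h1 := intervalIntegral.integral_mul_deriv_eq_deriv_mul (a := 0) (b := 2 * Real.pi)
    (fun t _ => hw t)
    (fun t _ => aa.hasDerivAt_push_rot S k (P.bracket (action aa.z k) f) p t)
    intervalIntegrable_const ((hcont _).intervalIntegrable _ _)
  have h2 := intervalIntegral.integral_eq_sub_of_hasDerivAt (a := 0) (b := 2 * Real.pi)
    (fun t _ => aa.hasDerivAt_push_rot S k f p t) ((hcont _).intervalIntegrable _ _)
  rw [rot_two_pi, rot_zero, sub_self] at h2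
  have hpi : (Real.pi : ℂ) ≠ 0 := Complex.ofReal_ne_zero.2 Real.pi_ne_zero
  rw [intervalIntegral.integral_const_mul, h2, rot_two_pi, rot_zero, aa.push_coord] at h1
  rw [evalHom_angleInv]
  refine h1.trans ?_
  rw [evalHom_apply]
  push_cast
  field_simp
  ring

theorem bracket_frequency (S : StarProduct P) (c i k : Fin m) :
    P.bracket (action aa.z c) (aa.frequency i k) = 0 := by
  refine Smooth.ext_evalHom fun p => ?_
  have hd : DifferentiableAt ℝ (fun x => (fderiv ℝ aa.f x (Pi.single k 1) i : ℂ))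
      (fun l => aa.act l p) := by
    have h1 : ContDiffAt ℝ ∞ (fun x => (fderiv ℝ aa.f x (Pi.single k 1) i : ℂ))
        (fun l => aa.act l p) :=
      Complex.ofRealCLM.contDiff.contDiffAt.comp _ (contDiffAt_pi.1
        (((aa.f_smooth p).fderiv_right (m := ∞) le_rfl).clm_apply contDiffAt_const) i)
    exact h1.differentiableAt (by simp)
  refine (derivation_chain_rule (S.toFormal.ham (action aa.z c)) (fun p l => aa.act l p)
    (action aa.z) aa.act_eq_action _ (aa.frequency i k) (fun _ => rfl) p hd).trans ?_
  rw [map_zero]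
  refine Finset.sum_eq_zero fun l _ => ?_
  rw [ham_apply, bracket_action_action aa.darboux, map_zero, mul_zero]

theorem bracket_h (S : StarProduct P) (i : Fin m) (g : Smooth m 𝓜) :
    P.bracket (h i) g = ∑ k, aa.frequency i k * P.bracket (action aa.z k) g := by
  refine Smooth.ext_evalHom fun p => ?_
  have hd : HasFDerivAt (fun x => (aa.f x i : ℂ)) (Complex.ofRealCLM.comp
      ((ContinuousLinearMap.proj i).comp (fderiv ℝ aa.f fun l => aa.act l p)))
      (fun l => aa.act l p) :=
    Complex.ofRealCLM.hasFDerivAt.comp _ ((ContinuousLinearMap.proj (R := ℝ)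
      (φ := fun _ : Fin m => ℝ) i).hasFDerivAt.comp _
        ((aa.f_smooth p).differentiableAt (by simp)).hasFDerivAt)
  have h1 := derivation_chain_rule (S.toFormal.ham g) (fun p l => aa.act l p)
    (action aa.z) aa.act_eq_action _ (h i) (aa.h_eq i) p hd.differentiableAt
  rw [hd.fderiv] at h1
  rw [P.skew, map_neg, map_sum]
  refine (congrArg Neg.neg h1).trans ?_
  rw [← Finset.sum_neg_distrib]
  refine Finset.sum_congr rfl fun k _ => ?_
  rw [map_mul, P.skew (action aa.z k), map_neg, mul_neg, evalHom_frequency]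
  rfl

/-- The classical data of global action-angle variables. -/
def classicalData (S : StarProduct P) : ClassicalData S.toFormal aa.z h where
  darboux := aa.darboux
  freq := Matrix.of aa.frequency
  isUnit_det := aa.isUnit_det_frequency
  bracket_h := aa.bracket_h S
  bracket_freq := aa.bracket_frequency S
  inv := aa.angleInv S
  bracket_inv := aa.bracket_angleInv S
  bracket_inv_bracket := aa.bracket_angleInv_bracket S

end GlobalActionAngle

end Torus

end

/-! ### Star products on manifolds -/

section

section

variable {m : ℕ} {𝓜 : Type*} [TopologicalSpace 𝓜]
  [ChartedSpace (EuclideanSpace ℝ (Fin (2 * m))) 𝓜] {P : SymplecticBracket m 𝓜}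

theorem StarProduct.isDifferential (S : StarProduct P) : S.toFormal.IsDifferential := by
  intro k f
  obtain ⟨N, hN⟩ := S.bidifferential k
  have hext : ∀ f : Smooth m 𝓜, (∀ p, evalHom p f = 0) → f = 0 := fun f hf =>
    Smooth.ext_evalHom fun p => by rw [hf, map_zero]
  exact ⟨⟨N + 1, isDiffEnd_of_ev_eq_zero hext fun p g hg => hN p f g (Or.inr hg)⟩,
    ⟨N + 1, isDiffEnd_of_ev_eq_zero hext fun p g hg => hN p g f (Or.inl hg)⟩⟩

theorem StarProduct.IsHermitian.toFormal {S : StarProduct P} (hS : S.IsHermitian) :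
    S.toFormal.IsHermitian where
  conj_mul := hS
  star_bracket f g := (P.real f g).symm

end

end

end DefQuant

end

theorem theorem3 (m : ℕ) (𝓜 : Type*) [TopologicalSpace 𝓜] [T2Space 𝓜]
    [SecondCountableTopology 𝓜] [ChartedSpace (EuclideanSpace ℝ (Fin (2 * m))) 𝓜]
    [IsManifold (𝓡 (2 * m)) ∞ 𝓜]
    (hcoh : DefQuant.SecondCohomologyTrivial m 𝓜)
    (P : DefQuant.SymplecticBracket m 𝓜) (S : DefQuant.StarProduct P)
    (H : Fin m → DefQuant.Symbol m 𝓜)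
    (hH : ∀ i j, S.comm (H i) (H j) = 0)
    (aa : DefQuant.GlobalActionAngle P (fun i => DefQuant.principal (H i))) :
    ∃ Z : Fin m ⊕ Fin m → DefQuant.Symbol m 𝓜,
      (∀ a, DefQuant.principal (Z a) = aa.z a) ∧
      DefQuant.IsSDarboux S Z ∧
      DefQuant.IsCompatible S H Z ∧
      (S.IsHermitian → (∀ j, DefQuant.IsRealSymbol (H j)) →
        (∀ a, DefQuant.IsRealSymbol (Z a)) ∧
        ∀ i, DefQuant.creation Z i = DefQuant.conjSymbol (DefQuant.annihilation Z i)) := by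
  have hc := aa.isCoordinateSystem S
  obtain ⟨Z, hZ0, hZ, hHN, hZr⟩ := DefQuant.FormalStar.exists_compatible S.isDifferential hc
    (aa.classicalData S) (DefQuant.FormalStar.closedIsExact_of_darboux hc aa.darboux hcoh)
    (Q := S.IsHermitian ∧ ∀ j, DefQuant.IsRealSymbol (H j)) (fun q => ⟨q.1.toFormal, q.2⟩) aa.star_z
    (fun _ => rfl) hH
  exact ⟨Z, hZ0, hZ, hHN, fun h1 h2 =>
    ⟨hZr ⟨h1, h2⟩, fun i => (DefQuant.FormalStar.conjSeries_annih (hZr ⟨h1, h2⟩) i).symm⟩⟩
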